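/- **Setting.** Let $N$ be a smooth $n$-dimensional manifold without boundary, oriented by a volume form $\mathbf v$; let $G$ be a Lie group with Lie algebra $\mathfrak g$, and let $\pi:Q\to\Sigma=Q/G$ be a smooth principal $G$-bundle (finite-dimensional, right action $R_g$) with a principal connection $\mathcal A$, that is, a smooth $\mathfrak g$-valued $1$-form on $Q$ with $R_g^*\mathcal A=\mathrm{Ad}_{g^{-1}}\circ\mathcal A$ and $\mathcal A(\xi_Q)=\xi$, where $\xi_Q$ is the infinitesimal generator of $\xi\in\mathfrak g$. Let $p^v=(\mathcal A(\cdot))_Q$ and $p^h=\mathrm{id}-p^v$ be the projectors of $TQ=HQ\oplus VQ$, $HQ=\ker\mathcal A$; let $w\mapsto w^h_q$ be the horizontal lift $T_{\pi(q)}\Sigma\to H_qQ$; let $\mathcal B=d\mathcal A+[\mathcal A,\mathcal A]$ be the curvature, where $[\mathcal A,\mathcal A](u,w)=[\mathcal A(u),\mathcal A(w)]$; let $\tilde{\mathfrak g}=(Q\times\mathfrak g)/G$ be the adjoint bundle over $\Sigma$, and $\bar{\mathcal B}(u,w)=[q,\mathcal B(u^h_q,w^h_q)]_G$ the induced $\tilde{\mathfrak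 g}$-valued $2$-form on $\Sigma$. We identify $J^1(N,M)=T^*N\otimes TM$, with fibres $\mathrm{Hom}(T_xN,T_qM)$, for $M=Q,\Sigma$. For a smooth Lagrangian $L:J^1(N,M)\to\mathbb R$, the Euler–Lagrange form is $\mathcal{EL}(L)(j^2s)=\frac{\nabla L}{ds}-\mathrm{div}^{\nabla,\mathbf v}\frac{\partial L}{\partial j^1s}$ for any torsion-free linear connection $\nabla$ on $M$; in coordinates with $\mathbf v=\varrho\,dx^1\wedge\dots\wedge dx^n$ it is $\frac{\partial L}{\partial q^a}-\frac1\varrho\,\partial_i\big(\varrho\,\frac{\partial L}{\partial q^a_i}\big)$. For a smooth force $F:J^1(N,M)\to T^*M$ over $M$, a smooth map $s:N\to M$ is *critical* for $(L,F)$ if $$\delta\int_N L(j^1s)\,\mathbf v+\int_N\langle F(j^1s),\delta s\rangle\,\mathbf v=0$$ for all smooth variations of $s$ with compact support. The momentum map $\mathbf J:TN\otimes T^*Q\to TN\otimes\mathfrak g^*$ is the trivial extension in the factor $TN$ of $\langle\mathbf J(\alpha),\xi\rangle=\langle\alpha,\xi_Q\rangle$. **Theorem.** Let $l:J^1(N,\Sigma)\to\mathbb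 R$ be a smooth Lagrangian, and let $L^h:J^1(N,Q)\to\mathbb R$ be the Lagrangian determined by it, $L^h(j^1s)=l(j^1(\pi\circ s))$. Let $L^v:J^1(N,Q)\to\mathbb R$ be an arbitrary smooth $G$-invariant Lagrangian with $L^v\circ p^v=L^v$, put $L=L^h+L^v$, and let $\ell^v:T^*N\otimes\tilde{\mathfrak g}\to\mathbb R$ be the function induced by $L^v$, that is, $\ell^v([q,\xi]_G)=L^v(\xi_Q(q))$ for $\xi\in T_x^*N\otimes\mathfrak g$. Let $F:J^1(N,Q)\to T^*Q$ be a smooth $G$-equivariant force whose vertical part $F^v=F\circ p^v$ is arbitrary and whose horizontal part $F^h=F\circ p^h$ is such that the induced map $f^h:J^1(N,\Sigma)\oplus(T^*N\otimes\tilde{\mathfrak g})\to T^*\Sigma$ is $$f^h=-\frac{\nabla\ell^v}{\delta\rho}+\Big\langle\frac{\delta\ell^v}{\delta\sigma},\,i_{T\rho}\bar{\mathcal B}\Big\rangle ,$$ where $\nabla\ell^v/\delta\rho$ is the derivative of $\ell^v$ along horizontal lifts of vectors of $\Sigma$ for the connection induced by $\mathcal A$ on $\tilde{\mathfrak g}$,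 and $\delta\ell^v/\delta\sigma$ is the fibre derivative of $\ell^v$. Then: 1. $L$ is $G$-invariant and $L^h\circ p^h=L^h$. 2. A smooth map $s:N\to Q$ is critical for $(L,F)$ if and only if $$\mathcal{EL}(L^h)(j^2s)=0,\qquad \mathcal A^*\,\mathrm{div}^{\mathbf v}\Big(\mathbf J\Big(\frac{\delta L^v}{\delta j^1s}\Big)\Big)=F^v(j^1s),$$ where $\mathcal A^*:\mathfrak g^*\to V^*Q$ is the dual of the connection form. 3. If a smooth map $s:N\to Q$ satisfies these equations, then $\rho=\pi\circ s=[s]_G$ satisfies the Euler–Lagrange equations $\mathcal{EL}(l)(j^2\rho)=0$, and $\rho$ is critical for $l$ (with zero force). -/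

import Mathlib

open scoped Manifold ContDiff Topology RightActions
open MeasureTheory Set

noncomputable section

namespace Unreduction

/-! ### Tangent maps of charts -/

section Charts

variable {E : Type*} [NormedAddCommGroup E] [NormedSpace ℝ E]
  {M : Type*} [TopologicalSpace M] [ChartedSpace E M]

/-- The tangent map at `q` of the preferred chart around `q₀`. -/
def chartFwd (q₀ q : M) : TangentSpace 𝓘(ℝ, E) q →L[ℝ] E :=
  mfderiv 𝓘(ℝ, E) 𝓘(ℝ, E) (extChartAt 𝓘(ℝ, E) q₀) q

/-- The tangent map at `z ∈ E` of the inverse of the preferred chart around `q₀`. -/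
def chartBwd (q₀ : M) (z : E) :
    E →L[ℝ] TangentSpace 𝓘(ℝ, E) ((extChartAt 𝓘(ℝ, E) q₀).symm z) :=
  mfderiv 𝓘(ℝ, E) 𝓘(ℝ, E) (extChartAt 𝓘(ℝ, E) q₀).symm z

end Charts

/-! ### Volume forms, divergence and integration on the source manifold `N` -/

section Source

variable {n : ℕ} {N : Type*} [TopologicalSpace N] [ChartedSpace (EuclideanSpace ℝ (Fin n)) N]

/-- The `i`-th vector of the standard basis of `ℝⁿ`. -/
abbrev stdVec {n : ℕ} (i : Fin n) : EuclideanSpace ℝ (Fin n) := EuclideanSpace.single i 1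

/-- The standard basis `e_i` of `T_x N`. -/
def tanVec (x : N) (i : Fin n) : TangentSpace (𝓡 n) x := stdVec i

/-- The basis `e^i` of `T*_x N` dual to `e_i`. -/
def tanForm (x : N) (i : Fin n) : TangentSpace (𝓡 n) x →L[ℝ] ℝ :=
  (EuclideanSpace.proj i : EuclideanSpace ℝ (Fin n) →L[ℝ] ℝ)

/-- The component `η(∂₁, …, ∂ₙ)` at the point with coordinates `y` of a field `η` of `n`-forms, in
the preferred chart around `x₀`. -/
def formDensity (η : ∀ x : N, TangentSpace (𝓡 n) x [⋀^Fin n]→L[ℝ] ℝ) (x₀ : N)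
    (y : EuclideanSpace ℝ (Fin n)) : ℝ :=
  η ((extChartAt (𝓡 n) x₀).symm y) (fun i => chartBwd x₀ y (stdVec i))

variable (n N) in
/-- A volume form: a smooth, nowhere vanishing differential form of top degree `n = dim N`. -/
structure VolumeForm where
  /-- the `n`-form at each point -/
  form : ∀ x : N, TangentSpace (𝓡 n) x [⋀^Fin n]→L[ℝ] ℝ
  smooth : ∀ x₀ : N, ContDiffOn ℝ ∞ (formDensity form x₀) (extChartAt (𝓡 n) x₀).target
  ne_zero : ∀ x : N, form x ≠ 0

/-- The divergence of a vector field `X` with respect to the volume form `v`: in coordinates, if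
`v = ϱ dx¹ ∧ ⋯ ∧ dxⁿ` then `div X = ϱ⁻¹ ∑ᵢ ∂ᵢ (ϱ Xⁱ)`. -/
def divergence (v : VolumeForm n N) (X : ∀ x : N, TangentSpace (𝓡 n) x) (x₀ : N) : ℝ :=
  (∑ i : Fin n,
    fderiv ℝ
      (fun y : EuclideanSpace ℝ (Fin n) =>
        formDensity v.form x₀ y *
          (chartFwd x₀ ((extChartAt (𝓡 n) x₀).symm y) (X ((extChartAt (𝓡 n) x₀).symm y))) i)
      (extChartAt (𝓡 n) x₀ x₀) (stdVec i))
    / formDensity v.form x₀ (extChartAt (𝓡 n) x₀ x₀)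

/-- The measure `|v(∂₁, …, ∂ₙ)| dx¹ ⋯ dxⁿ` carried by the domain of the preferred chart around
`x₀`. -/
def chartMeasure [MeasurableSpace N] (v : VolumeForm n N) (x₀ : N) : Measure N :=
  Measure.map (extChartAt (𝓡 n) x₀).symm
    ((volume.restrict (extChartAt (𝓡 n) x₀).target).withDensity
      (fun y => ENNReal.ofReal |formDensity v.form x₀ y|))

/-- The measure on `N` of the volume form `v`, where `N` is oriented by `v`, so that
`∫_N f v = ∫ f ∂(volMeasure v)`. The measures `chartMeasure v x₀` agree on the overlaps of the
charts, and this is the measure which restricts to each of them. -/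
def volMeasure [MeasurableSpace N] (v : VolumeForm n N) : Measure N :=
  ⨆ x₀ : N, chartMeasure v x₀

end Source

/-! ### First order variational problems with forces for maps `N → M` -/

section Variational

/-- Functions `L : J¹(N, M) → ℝ`, where `J¹(N, M) = T*N ⊗ TM` is the bundle over `N × M` with fibre
`Hom(T_x N, T_q M)`; the `1`-jet of `s` at `x` is `(x, s x, T_x s)`. -/
abbrev Lagrangian (n : ℕ) (N : Type*) [TopologicalSpace N]
    [ChartedSpace (EuclideanSpace ℝ (Fin n)) N] (E : Type*) [NormedAddCommGroup E]
    [NormedSpace ℝ E] (M : Type*) [TopologicalSpace M] [ChartedSpace E M] : Type _ :=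
  ∀ (x : N) (q : M), (TangentSpace (𝓡 n) x →L[ℝ] TangentSpace 𝓘(ℝ, E) q) → ℝ

/-- Fibre maps `F : J¹(N, M) → T*M`. -/
abbrev Force (n : ℕ) (N : Type*) [TopologicalSpace N]
    [ChartedSpace (EuclideanSpace ℝ (Fin n)) N] (E : Type*) [NormedAddCommGroup E]
    [NormedSpace ℝ E] (M : Type*) [TopologicalSpace M] [ChartedSpace E M] : Type _ :=
  ∀ (x : N) (q : M), (TangentSpace (𝓡 n) x →L[ℝ] TangentSpace 𝓘(ℝ, E) q) →
    (TangentSpace 𝓘(ℝ, E) q →L[ℝ] ℝ)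

variable {n : ℕ} {N : Type*} [TopologicalSpace N] [ChartedSpace (EuclideanSpace ℝ (Fin n)) N]
  {E : Type*} [NormedAddCommGroup E] [NormedSpace ℝ E]
  {M : Type*} [TopologicalSpace M] [ChartedSpace E M]

/-- The jet with coordinates `(y, z, J)` in the chart of `J¹(N, M)` induced by the preferred charts
around `x₀` and `q₀`. -/
def jetOfCoord (x₀ : N) (q₀ : M) (y : EuclideanSpace ℝ (Fin n)) (z : E)
    (J : EuclideanSpace ℝ (Fin n) →L[ℝ] E) :
    TangentSpace (𝓡 n) ((extChartAt (𝓡 n) x₀).symm y) →L[ℝ]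
      TangentSpace 𝓘(ℝ, E) ((extChartAt 𝓘(ℝ, E) q₀).symm z) :=
  (chartBwd q₀ z) ∘L J ∘L (chartFwd x₀ ((extChartAt (𝓡 n) x₀).symm y))

/-- Smoothness of a function on `J¹(N, M)`: all its expressions in the charts of `J¹(N, M)` induced
by charts of `N` and `M` are smooth. -/
def SmoothLagrangian (L : Lagrangian n N E M) : Prop :=
  ∀ (x₀ : N) (q₀ : M), ContDiffOn ℝ ∞
    (fun p : (EuclideanSpace ℝ (Fin n) × E) × (EuclideanSpace ℝ (Fin n) →L[ℝ] E) =>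
      L _ _ (jetOfCoord x₀ q₀ p.1.1 p.1.2 p.2))
    (((extChartAt (𝓡 n) x₀).target ×ˢ (extChartAt 𝓘(ℝ, E) q₀).target) ×ˢ univ)

/-- Smoothness of a fibre map `J¹(N, M) → T*M`, in the charts induced by charts of `N` and `M`. -/
def SmoothForce (F : Force n N E M) : Prop :=
  ∀ (x₀ : N) (q₀ : M), ContDiffOn ℝ ∞
    (fun p : (EuclideanSpace ℝ (Fin n) × E) × (EuclideanSpace ℝ (Fin n) →L[ℝ] E) =>
      (F _ _ (jetOfCoord x₀ q₀ p.1.1 p.1.2 p.2)) ∘L (chartBwd q₀ p.1.2))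
    (((extChartAt (𝓡 n) x₀).target ×ˢ (extChartAt 𝓘(ℝ, E) q₀).target) ×ˢ univ)

/-- The fibre derivative `∂L/∂j¹s ∈ T_x N ⊗ T*_q M = Hom(T_q M, T_x N)`, characterized by
`⟨α, (∂L/∂j¹s)(c)⟩ = d/dε|₀ L(j + ε α ⊗ c)` for `α ∈ T*_x N` and `c ∈ T_q M`. -/
def fiberDeriv (L : Lagrangian n N E M) (x : N) (q : M)
    (j : TangentSpace (𝓡 n) x →L[ℝ] TangentSpace 𝓘(ℝ, E) q) (c : TangentSpace 𝓘(ℝ, E) q) :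
    TangentSpace (𝓡 n) x :=
  ∑ i : Fin n,
    (deriv (fun ε : ℝ => L x q
      (j + ε • (tanForm x i).smulRight c)) 0) • tanVec x i

/-- The vector field around `q₀` whose components in the preferred chart around `q₀` are constant
and whose value at `q₀` is `u`; it is parallel for the flat torsion-free connection given by that
chart. -/
def coordField (q₀ : M) (u : TangentSpace 𝓘(ℝ, E) q₀) (q : M) : TangentSpace 𝓘(ℝ, E) q :=
  chartBwd q₀ (extChartAt 𝓘(ℝ, E) q₀ q) (chartFwd q₀ q₀ u)

/-- The derivative `∇L/ds (j) · u` of `L` along the horizontal lift of `u` to `T*N ⊗ TM`, for the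
flat torsion-free connection given by the preferred chart around the target point `q` of `j`. -/
def baseDeriv (L : Lagrangian n N E M) (x : N) (q : M)
    (j : TangentSpace (𝓡 n) x →L[ℝ] TangentSpace 𝓘(ℝ, E) q) (u : TangentSpace 𝓘(ℝ, E) q) : ℝ :=
  deriv (fun ε : ℝ =>
    let z : E := extChartAt 𝓘(ℝ, E) q q + ε • chartFwd q q u
    L x ((extChartAt 𝓘(ℝ, E) q).symm z) ((chartBwd q z) ∘L (chartFwd q q) ∘L j)) 0

/-- The tangent map of `s`, i.e. the fibre part of the `1`-jet of `s` at `x`. -/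
abbrev jet (s : N → M) (x : N) : TangentSpace (𝓡 n) x →L[ℝ] TangentSpace 𝓘(ℝ, E) (s x) :=
  mfderiv (𝓡 n) 𝓘(ℝ, E) s x

/-- The Euler–Lagrange form `EL(L)(j²s)(x) ∈ T*_{s x} M`,
`EL(L)(j²s) = ∇L/ds (j¹s) - div^{∇, v} (∂L/∂j¹s (j¹s))`.
It does not depend on the torsion-free connection `∇` of `M`; at `x` we use the flat connection of
the preferred chart around `s x`, for which `⟨div^{∇, v} 𝒳, U⟩ = div^v ⟨𝒳, U⟩` for every `U` with
constant components. In coordinates, with `v = ϱ dx¹ ∧ ⋯ ∧ dxⁿ`, this is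
`∂L/∂q^a - ϱ⁻¹ ∂ᵢ (ϱ ∂L/∂q^a_i)`. -/
def eulerLagrange (v : VolumeForm n N) (L : Lagrangian n N E M) (s : N → M) (x : N)
    (u : TangentSpace 𝓘(ℝ, E) (s x)) : ℝ :=
  baseDeriv L x (s x) (jet s x) u -
    divergence v (fun x' => fiberDeriv L x' (s x') (jet s x') (coordField (s x) u (s x'))) x

/-- `s` is critical for the variational principle
`δ ∫_N L(j¹s) v + ∫_N ⟨F(j¹s), δs⟩ v = 0` with free variations of compact support: for all smooth
families `S ε` of maps with `S 0 = s` and `S ε = s` outside of a compact set `K`. -/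
def IsCritical [MeasurableSpace N] (v : VolumeForm n N) (L : Lagrangian n N E M)
    (F : Force n N E M) (s : N → M) : Prop :=
  ∀ (S : ℝ → N → M) (K : Set N),
    ContMDiff (𝓘(ℝ, ℝ).prod (𝓡 n)) 𝓘(ℝ, E) ∞ (fun p : ℝ × N => S p.1 p.2) →
    S 0 = s → IsCompact K → (∀ ε : ℝ, ∀ x ∉ K, S ε x = s x) →
    ∃ δ : ℝ,
      HasDerivAt (fun ε : ℝ => ∫ x in K, L x (S ε x) (jet (S ε) x) ∂(volMeasure v)) δ 0 ∧
      δ + ∫ x in K, F x (S 0 x) (jet (S 0) x)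
        (mfderiv 𝓘(ℝ, ℝ) 𝓘(ℝ, E) (fun ε : ℝ => S ε x) 0 (1 : ℝ)) ∂(volMeasure v) = 0

end Variational

/-! ### Principal bundles and principal connections -/

section Principal

variable {EQ : Type*} [NormedAddCommGroup EQ] [NormedSpace ℝ EQ]
  {Q : Type*} [TopologicalSpace Q] [ChartedSpace EQ Q]
  {ES : Type*} [NormedAddCommGroup ES] [NormedSpace ℝ ES]
  {S : Type*} [TopologicalSpace S] [ChartedSpace ES S]
  {EG : Type*} [NormedAddCommGroup EG] [NormedSpace ℝ EG]
  {G : Type*} [TopologicalSpace G] [ChartedSpace EG G] [Group G]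
  [MulAction Gᵐᵒᵖ Q]

variable (EQ ES EG G) in
/-- `π : Q → S` is a smooth principal `G`-bundle, where `G` acts on `Q` on the right by
`R_g q = q <• g`: it is locally isomorphic to `U × G → U`, equivariantly. -/
structure IsPrincipalBundle (π : Q → S) : Prop where
  smooth_act : ContMDiff (𝓘(ℝ, EQ).prod 𝓘(ℝ, EG)) 𝓘(ℝ, EQ) ∞ (fun p : Q × G => p.1 <• p.2)
  smooth_proj : ContMDiff 𝓘(ℝ, EQ) 𝓘(ℝ, ES) ∞ π
  proj_act : ∀ (q : Q) (g : G), π (q <• g) = π q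
  locally_trivial : ∀ b : S, ∃ (U : Set S) (e : OpenPartialHomeomorph Q (S × G)),
    IsOpen U ∧ b ∈ U ∧ e.source = π ⁻¹' U ∧ e.target = U ×ˢ univ ∧
    ContMDiffOn 𝓘(ℝ, EQ) (𝓘(ℝ, ES).prod 𝓘(ℝ, EG)) ∞ e e.source ∧
    ContMDiffOn (𝓘(ℝ, ES).prod 𝓘(ℝ, EG)) 𝓘(ℝ, EQ) ∞ e.symm e.target ∧
    (∀ q ∈ e.source, (e q).1 = π q) ∧
    (∀ q ∈ e.source, ∀ g : G, (e (q <• g)).2 = (e q).2 * g)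

variable (EG G) in
/-- The Lie algebra `𝔤 = T_1 G`, with the bracket of left-invariant vector fields. -/
abbrev LieAlg : Type _ := GroupLieAlgebra 𝓘(ℝ, EG) G

/-- The tangent map `T_q R_g : T_q Q → T_{qg} Q` of the right translation. -/
def transl (g : G) (q : Q) : TangentSpace 𝓘(ℝ, EQ) q →L[ℝ] TangentSpace 𝓘(ℝ, EQ) (q <• g) :=
  mfderiv 𝓘(ℝ, EQ) 𝓘(ℝ, EQ) (fun q' : Q => q' <• g) q

variable (EG G) in
/-- The infinitesimal generators `ξ ↦ ξ_Q(q) = d/dε|₀ q · exp(ε ξ)`, i.e. the tangent map at `1` of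
`g ↦ q · g`. -/
def gen (q : Q) : LieAlg EG G →L[ℝ] TangentSpace 𝓘(ℝ, EQ) q :=
  mfderiv 𝓘(ℝ, EG) 𝓘(ℝ, EQ) (fun g : G => q <• g) 1

/-- The adjoint representation `Ad_g : 𝔤 → 𝔤`. -/
def adj (g : G) : LieAlg EG G →L[ℝ] LieAlg EG G :=
  mfderiv 𝓘(ℝ, EG) 𝓘(ℝ, EG) (fun h : G => g * h * g⁻¹) 1

/-- The expression of a `𝔤`-valued `1`-form on `Q` in the preferred chart around `q₀`. -/
def formCoord (A : ∀ q : Q, TangentSpace 𝓘(ℝ, EQ) q →L[ℝ] LieAlg EG G) (q₀ : Q) (z : EQ) :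
    EQ →L[ℝ] EG :=
  (A ((extChartAt 𝓘(ℝ, EQ) q₀).symm z)) ∘L (chartBwd q₀ z)

variable (EQ Q EG G) in
/-- A principal connection: a smooth `𝔤`-valued `1`-form `A` on `Q` with
`R_g^* A = Ad_{g⁻¹} ∘ A` and `A(ξ_Q) = ξ`. -/
structure PrincipalConnection where
  /-- the connection form -/
  form : ∀ q : Q, TangentSpace 𝓘(ℝ, EQ) q →L[ℝ] LieAlg EG G
  smooth : ∀ q₀ : Q, ContDiffOn ℝ ∞ (formCoord form q₀) (extChartAt 𝓘(ℝ, EQ) q₀).target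
  equivariant : ∀ (q : Q) (g : G) (u : TangentSpace 𝓘(ℝ, EQ) q),
    form (q <• g) (transl g q u) = adj g⁻¹ (form q u)
  form_gen : ∀ (q : Q) (ξ : LieAlg EG G), form q (gen EG G q ξ) = ξ

namespace PrincipalConnection

variable (A : PrincipalConnection EQ Q EG G)

/-- The projector `p^v` onto the vertical space `V_q Q = {ξ_Q(q)}`. -/
def verProj (q : Q) : TangentSpace 𝓘(ℝ, EQ) q →L[ℝ] TangentSpace 𝓘(ℝ, EQ) q :=
  (gen EG G q) ∘L (A.form q)

/-- The projector `p^h` onto the horizontal space `H_q Q = ker A`. -/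
def horProj (q : Q) : TangentSpace 𝓘(ℝ, EQ) q →L[ℝ] TangentSpace 𝓘(ℝ, EQ) q :=
  ContinuousLinearMap.id ℝ _ - A.verProj q

variable (ES) in
/-- The horizontal lift `w ↦ w^h_q`: the unique linear map `T_{π q} S → T_q Q` such that `w^h_q` is
horizontal and projects to `w`. -/
def horLift (π : Q → S) (q : Q) :
    TangentSpace 𝓘(ℝ, ES) (π q) →L[ℝ] TangentSpace 𝓘(ℝ, EQ) q :=
  Classical.epsilon fun H : TangentSpace 𝓘(ℝ, ES) (π q) →L[ℝ] TangentSpace 𝓘(ℝ, EQ) q =>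
    ∀ w, A.form q (H w) = 0 ∧ mfderiv 𝓘(ℝ, EQ) 𝓘(ℝ, ES) π q (H w) = w

/-- The exterior derivative of the connection form. -/
def extDer (q : Q) (u w : TangentSpace 𝓘(ℝ, EQ) q) : LieAlg EG G :=
  let D : EQ →L[ℝ] EQ →L[ℝ] EG :=
    fderiv ℝ (formCoord A.form q) (extChartAt 𝓘(ℝ, EQ) q q)
  D (chartFwd q q u) (chartFwd q q w) - D (chartFwd q q w) (chartFwd q q u)

/-- The curvature `B = dA + [A, A]`. -/
def curvature (q : Q) (u w : TangentSpace 𝓘(ℝ, EQ) q) : LieAlg EG G :=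
  A.extDer q u w + ⁅A.form q u, A.form q w⁆

variable (ES) in
/-- The reduced curvature `B̄(u, w) = [q, B(u^h_q, w^h_q)]_G`, a `2`-form on `S` with values in the
adjoint bundle `(Q × 𝔤)/G`; this is the representative over `q` of `B̄(u, w)`. -/
def redCurvature (π : Q → S) (q : Q) (u w : TangentSpace 𝓘(ℝ, ES) (π q)) : LieAlg EG G :=
  A.curvature q (A.horLift ES π q u) (A.horLift ES π q w)

end PrincipalConnection

end Principal

/-! ### Reduction of Lagrangians and forces -/

section Reduction

variable {n : ℕ} {N : Type*} [TopologicalSpace N] [ChartedSpace (EuclideanSpace ℝ (Fin n)) N]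
  {EQ : Type*} [NormedAddCommGroup EQ] [NormedSpace ℝ EQ]
  {Q : Type*} [TopologicalSpace Q] [ChartedSpace EQ Q]
  {ES : Type*} [NormedAddCommGroup ES] [NormedSpace ℝ ES]
  {S : Type*} [TopologicalSpace S] [ChartedSpace ES S]
  {EG : Type*} [NormedAddCommGroup EG] [NormedSpace ℝ EG]
  {G : Type*} [TopologicalSpace G] [ChartedSpace EG G] [Group G]
  [MulAction Gᵐᵒᵖ Q]

variable (G) in
/-- Invariance of `L` under the lifted action `R_g^{(1)}(j¹_x s) = j¹_x (R_g ∘ s)`. -/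
def GInvariant (L : Lagrangian n N EQ Q) : Prop :=
  ∀ (g : G) (x : N) (q : Q) (j : TangentSpace (𝓡 n) x →L[ℝ] TangentSpace 𝓘(ℝ, EQ) q),
    L x (q <• g) ((transl g q) ∘L j) = L x q j

variable (G) in
/-- Equivariance of a force `F : J¹(N, Q) → T*Q` under the lifted actions of `G`. -/
def GEquivariant (F : Force n N EQ Q) : Prop :=
  ∀ (g : G) (x : N) (q : Q) (j : TangentSpace (𝓡 n) x →L[ℝ] TangentSpace 𝓘(ℝ, EQ) q)
    (u : TangentSpace 𝓘(ℝ, EQ) q),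
    F x (q <• g) ((transl g q) ∘L j) (transl g q u) = F x q j u

/-- The Lagrangian `L^h` on `J¹(N, Q)` determined by `l`: `L^h(j¹s) = l(j¹(π ∘ s))`. -/
def liftLagrangian (π : Q → S) (l : Lagrangian n N ES S) : Lagrangian n N EQ Q :=
  fun x q j => l x (π q) ((mfderiv 𝓘(ℝ, EQ) 𝓘(ℝ, ES) π q) ∘L j)

/-- The relation `(q, ξ) ∼ (q g, Ad_{g⁻¹} ∘ ξ)` on `Q × (T*_x N ⊗ 𝔤)`. -/
def adjRel (x : N) (a b : Q × (TangentSpace (𝓡 n) x →L[ℝ] LieAlg EG G)) : Prop :=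
  ∃ g : G, b = (a.1 <• g, (adj g⁻¹) ∘L a.2)

variable (n Q EG G) in
/-- The fibre over `x ∈ N` of `T*N ⊗ 𝔤̃`, where `𝔤̃ = (Q × 𝔤)/G` is the adjoint bundle over `S`:
classes `[q, ξ]_G` with `ξ ∈ T*_x N ⊗ 𝔤 = Hom(T_x N, 𝔤)`. -/
def AdjointJet (x : N) : Type _ :=
  Quot (adjRel (n := n) (Q := Q) (EG := EG) (G := G) x)

/-- The class `[q, ξ]_G`. -/
def AdjointJet.mk {x : N} (q : Q) (ξ : TangentSpace (𝓡 n) x →L[ℝ] LieAlg EG G) :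
    AdjointJet n Q EG G x :=
  Quot.mk _ (q, ξ)

/-- `T R_g (ξ_Q(q)) = (Ad_{g⁻¹} ξ)_Q (q g)`. -/
theorem transl_gen [LieGroup 𝓘(ℝ, EG) ∞ G] {π : Q → S}
    (hπ : IsPrincipalBundle EQ ES EG G π) (q : Q) (g : G) (ξ : LieAlg EG G) :
    transl (EQ := EQ) g q (gen EG G q ξ) = gen EG G (q <• g) (adj g⁻¹ ξ) := by
  have hR : MDifferentiable 𝓘(ℝ, EQ) 𝓘(ℝ, EQ) (fun q' : Q => q' <• g) :=
    (hπ.smooth_act.comp (contMDiff_id.prodMk contMDiff_const)).mdifferentiable (by simp)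
  have hO : ∀ p : Q, MDifferentiable 𝓘(ℝ, EG) 𝓘(ℝ, EQ) (fun h : G => p <• h) := fun p =>
    (hπ.smooth_act.comp (contMDiff_const.prodMk contMDiff_id)).mdifferentiable (by simp)
  have hC : MDifferentiable 𝓘(ℝ, EG) 𝓘(ℝ, EG) (fun h : G => g⁻¹ * h * g⁻¹⁻¹) :=
    ((contMDiff_const.mul contMDiff_id).mul contMDiff_const :
      ContMDiff 𝓘(ℝ, EG) 𝓘(ℝ, EG) ∞ (fun h : G => g⁻¹ * h * g⁻¹⁻¹)).mdifferentiable (by simp)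
  have e1 : q <• (1 : G) = q := by simp
  have e2 : g⁻¹ * 1 * g⁻¹⁻¹ = 1 := by group
  have h1 := mfderiv_comp_apply (I := 𝓘(ℝ, EG)) (I' := 𝓘(ℝ, EQ)) (I'' := 𝓘(ℝ, EQ))
    (f := fun h : G => q <• h) (g := fun q' : Q => q' <• g) (1 : G) (hR _) (hO q 1) ξ
  have h2 := mfderiv_comp_apply (I := 𝓘(ℝ, EG)) (I' := 𝓘(ℝ, EG)) (I'' := 𝓘(ℝ, EQ))
    (f := fun h : G => g⁻¹ * h * g⁻¹⁻¹) (g := fun h : G => (q <• g) <• h) (1 : G)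
    (hO (q <• g) _) (hC 1) ξ
  have h3 : (fun q' : Q => q' <• g) ∘ (fun h : G => q <• h) =
      (fun h : G => (q <• g) <• h) ∘ (fun h : G => g⁻¹ * h * g⁻¹⁻¹) := by
    funext h
    simp [← mul_smul, ← MulOpposite.op_mul, mul_assoc]
  rw [h3] at h1
  have k1 : ∀ p : Q, p = q → ∀ u : EQ,
      (show EQ from mfderiv 𝓘(ℝ, EQ) 𝓘(ℝ, EQ) (fun q' : Q => q' <• g) p u) =
        (show EQ from mfderiv 𝓘(ℝ, EQ) 𝓘(ℝ, EQ) (fun q' : Q => q' <• g) q u) := by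
    rintro p rfl u
    rfl
  have k2 : ∀ h : G, h = 1 → ∀ u : EG,
      (show EQ from mfderiv 𝓘(ℝ, EG) 𝓘(ℝ, EQ) (fun h : G => (q <• g) <• h) h u) =
        (show EQ from mfderiv 𝓘(ℝ, EG) 𝓘(ℝ, EQ) (fun h : G => (q <• g) <• h) 1 u) := by
    rintro h rfl u
    rfl
  exact (k1 _ e1 _).symm.trans ((h1.symm.trans h2).trans (k2 _ e2 _))

/-- The reduced Lagrangian `ℓ^v : T*N ⊗ 𝔤̃ → ℝ` of a `G`-invariant `L^v`, given by
`ℓ^v([q, ξ]_G) = L^v(ξ_Q(q))`. -/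
def redLagrangian [LieGroup 𝓘(ℝ, EG) ∞ G] {π : Q → S}
    (hπ : IsPrincipalBundle EQ ES EG G π) (Lv : Lagrangian n N EQ Q) (hLv : GInvariant G Lv)
    (x : N) : AdjointJet n Q EG G x → ℝ :=
  Quot.lift (fun a => Lv x a.1 ((gen EG G a.1) ∘L a.2)) (by
    rintro ⟨q, ξ⟩ b ⟨g, rfl⟩
    have h : (transl (EQ := EQ) g q) ∘L ((gen EG G q) ∘L ξ) =
        (gen EG G (q <• g)) ∘L ((adj g⁻¹) ∘L ξ) :=
      ContinuousLinearMap.ext fun w => transl_gen hπ q g (ξ w)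
    exact (hLv g x q _).symm.trans (congrArg _ h))

namespace PrincipalConnection

variable (A : PrincipalConnection EQ Q EG G)

/-- The derivative `⟨∇ℓ/δρ, w⟩` at `[q, ξ]_G` of a function `ℓ` on `T*N ⊗ 𝔤̃`, along the horizontal
lift of `w ∈ T_{π q} S` for the connection induced by `A` on the associated bundle `𝔤̃`. The
horizontal space at `[q, ξ]_G` is the image of `H_q Q` under the tangent map of
`q' ↦ [q', ξ]_G`. -/
def nablaBase (π : Q → S) {x : N} (ℓ : AdjointJet n Q EG G x → ℝ) (q : Q)
    (ξ : TangentSpace (𝓡 n) x →L[ℝ] LieAlg EG G) (w : TangentSpace 𝓘(ℝ, ES) (π q)) : ℝ :=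
  mfderiv 𝓘(ℝ, EQ) 𝓘(ℝ, ℝ) (fun q' : Q => ℓ (AdjointJet.mk q' ξ)) q (A.horLift ES π q w)

/-- The section `i_τ B̄ (w) = B̄(τ ·, w)` of `T*N ⊗ 𝔤̃`, for `τ = T_x ρ ∈ T*_x N ⊗ T_{π q} S`,
represented over `q`. -/
def contrCurvature (π : Q → S) {x : N} (q : Q)
    (τ : TangentSpace (𝓡 n) x →L[ℝ] TangentSpace 𝓘(ℝ, ES) (π q))
    (w : TangentSpace 𝓘(ℝ, ES) (π q)) : TangentSpace (𝓡 n) x →L[ℝ] LieAlg EG G :=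
  ∑ i : Fin n, (tanForm x i).smulRight (A.redCurvature ES π q (τ (tanVec x i)) w)

/-- The value `⟨f^h(τ, [q, ξ]_G), w⟩ = ⟨F^h(j), w^h_q⟩` of the reduced horizontal force
`f^h : J¹(N, S) ⊕ (T*N ⊗ 𝔤̃) → T*S`, where `j = τ^h + ξ_Q` is the jet over `q` corresponding to
`(τ, [q, ξ]_G)`. -/
def redForce (π : Q → S) (F : Force n N EQ Q) (x : N) (q : Q)
    (τ : TangentSpace (𝓡 n) x →L[ℝ] TangentSpace 𝓘(ℝ, ES) (π q))
    (ξ : TangentSpace (𝓡 n) x →L[ℝ] LieAlg EG G) (w : TangentSpace 𝓘(ℝ, ES) (π q)) : ℝ :=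
  ((F x q ((A.horLift ES π q) ∘L τ + (gen EG G q) ∘L ξ)) ∘L (A.horProj q)) (A.horLift ES π q w)

end PrincipalConnection

/-- The fibre derivative `⟨δℓ/δσ, [q, ζ]_G⟩` at `[q, ξ]_G` of a function `ℓ` on `T*N ⊗ 𝔤̃`. -/
def adjointDeriv {x : N} (ℓ : AdjointJet n Q EG G x → ℝ) (q : Q)
    (ξ ζ : TangentSpace (𝓡 n) x →L[ℝ] LieAlg EG G) : ℝ :=
  deriv (fun ε : ℝ => ℓ (AdjointJet.mk q (ξ + ε • ζ))) 0

/-- The momentum map `J : T*Q → 𝔤*`, `⟨J(α), ξ⟩ = ⟨α, ξ_Q⟩`, extended to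
`T_x N ⊗ T*_q Q = Hom(T_q Q, T_x N) → T_x N ⊗ 𝔤* = Hom(𝔤, T_x N)`. -/
def momentum {x : N} {q : Q} (P : TangentSpace 𝓘(ℝ, EQ) q → TangentSpace (𝓡 n) x)
    (ξ : LieAlg EG G) : TangentSpace (𝓡 n) x :=
  P (gen EG G q ξ)

/-- The divergence `div^v J(δL/δj¹s) ∈ 𝔤*` at `x`. -/
def divMomentum (v : VolumeForm n N) (L : Lagrangian n N EQ Q) (s : N → Q) (x : N)
    (ξ : LieAlg EG G) : ℝ :=
  divergence v (fun x' => momentum (fiberDeriv L x' (s x') (jet s x')) ξ) x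

/-- The un-reduced equations `EL(L^h)(j²s) = 0`, `A^* div^v J(δL^v/δj¹s) = F^v(j¹s)`, where
`A^* : 𝔤* → V*Q` and `F^v = F ∘ p^v`. -/
def UnreducedEquations (v : VolumeForm n N) (A : PrincipalConnection EQ Q EG G)
    (Lh Lv : Lagrangian n N EQ Q) (F : Force n N EQ Q) (s : N → Q) : Prop :=
  (∀ (x : N) (u : TangentSpace 𝓘(ℝ, EQ) (s x)), eulerLagrange v Lh s x u = 0) ∧
  (∀ (x : N) (u : TangentSpace 𝓘(ℝ, EQ) (s x)),
    divMomentum v Lv s x (A.form (s x) u) = F x (s x) (jet s x) (A.verProj (s x) u))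

end Reduction

end Unreduction

end

/-! The variational principle is equivalent to the pointwise equation `EL(L)(u) + F(u) = 0` for all
`u` (`isCritical_iff`). This rests on the first variation formula `d/dε L(j¹S_ε) = EL(L)(δs) +
div(∂L/∂j¹s (δs))` (`hasDerivAt_lagVal`), the divergence theorem for compactly supported fields
(`integral_divVal_eq_zero`), and bump variations. Since the divergence at a point is defined in the
chart around that point, the divergence theorem needs its independence of the chart, which is the
Piola identity (`trace_fderiv_piola`).

The pointwise equation is then tested along `TQ = HQ ⊕ VQ`. On a vertical vector `ξ_Q`, Noether's
theorem (`elVal_gen`) says that an invariant Lagrangian has `EL(L)(ξ_Q) = -div ⟨J, ξ⟩`. For `L^h`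
the momentum is zero because `Tπ` kills generators, so `EL(L^h)` vanishes on vertical vectors and
the vertical equation involves only `L^v` and `F^v`.

On a horizontal vector `u` the point is that `L^v` sees a jet `j` only through its base point and `A
∘ j`. Its fibre derivative kills horizontal vectors, so the divergence term disappears for a
variation that is horizontal near the point, and `EL(L^v)(u)` is the plain derivative of `L^v` along
that variation (`elVal_variation_horizontal`). The derivative of `A ∘ Ts` along it is `dA(u, Ts ·)`.
As `dA(ξ_Q, u) = 0` for horizontal `u` (`PrincipalConnection.extVal_gen`) and the bracket term of
the curvature vanishes on horizontal vectors, this equals `-i_{Tρ} B̄(Tπ u)`. Hence `EL(L^v)(u)` is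
`∇ℓ^v/δρ - ⟨δℓ^v/δσ, i_{Tρ} B̄⟩` on `Tπ u`, exactly the negative of the prescribed horizontal force
(`elVal_horizontal`), and what survives on horizontal vectors is `EL(L^h) = 0`.

For the projection, `EL(L^h)(u) = EL(l)(Tπ u)` (`elVal_lift`) and every tangent vector of the base
has a horizontal lift. The converse direction of `isCritical_iff`, with zero force, turns the
equation into criticality of `π ∘ s`. -/

set_option linter.unusedSectionVars false

noncomputable section

namespace Unreduction

/-! ### Tangent maps as maps between model spaces -/

section TangentMaps

variable {E : Type*} [NormedAddCommGroup E] [NormedSpace ℝ E]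
  {M : Type*} [TopologicalSpace M] [ChartedSpace E M]
  {E' : Type*} [NormedAddCommGroup E'] [NormedSpace ℝ E']
  {M' : Type*} [TopologicalSpace M'] [ChartedSpace E' M']
  {E'' : Type*} [NormedAddCommGroup E''] [NormedSpace ℝ E'']
  {M'' : Type*} [TopologicalSpace M''] [ChartedSpace E'' M'']

/-- The tangent map of `f` at `x`, where the tangent spaces are identified with the model spaces. -/
def tmap (f : M → M') (x : M) : E →L[ℝ] E' := mfderiv 𝓘(ℝ, E) 𝓘(ℝ, E') f x

theorem tmap_comp {g : M' → M''} {f : M → M'} {x : M}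
    (hg : MDifferentiableAt 𝓘(ℝ, E') 𝓘(ℝ, E'') g (f x))
    (hf : MDifferentiableAt 𝓘(ℝ, E) 𝓘(ℝ, E') f x) :
    tmap (E := E) (E' := E'') (fun y => g (f y)) x =
      (tmap (E := E') (E' := E'') g (f x)) ∘L (tmap (E := E) (E' := E') f x) :=
  mfderiv_comp x hg hf

theorem tmap_eq_fderiv (f : E → E') (x : E) : tmap (E := E) (E' := E') f x = fderiv ℝ f x :=
  mfderiv_eq_fderiv

theorem tmap_congr {f g : M → M'} {x : M} (h : f =ᶠ[𝓝 x] g) :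
    tmap (E := E) (E' := E') f x = tmap (E := E) (E' := E') g x :=
  Filter.EventuallyEq.mfderiv_eq h

theorem tmap_const (c : M') (x : M) :
    tmap (E := E) (E' := E') (fun _ : M => c) x = 0 :=
  mfderiv_const

/-- The tangent map of the preferred chart around `q₀`, as an endomorphism of the model space. -/
def fwd (q₀ q : M) : E →L[ℝ] E := tmap (E := E) (E' := E) (extChartAt 𝓘(ℝ, E) q₀) q

/-- The tangent map of the inverse of the preferred chart around `q₀`, as an endomorphism of the
model space. -/
def bwd (q₀ : M) (z : E) : E →L[ℝ] E := tmap (E := E) (E' := E) (extChartAt 𝓘(ℝ, E) q₀).symm z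

variable [IsManifold 𝓘(ℝ, E) ∞ M] [IsManifold 𝓘(ℝ, E') ∞ M'] [IsManifold 𝓘(ℝ, E'') ∞ M'']

theorem mdifferentiableAt_chart {q₀ q : M} (hq : q ∈ (extChartAt 𝓘(ℝ, E) q₀).source) :
    MDifferentiableAt 𝓘(ℝ, E) 𝓘(ℝ, E) (extChartAt 𝓘(ℝ, E) q₀) q :=
  mdifferentiableAt_extChartAt (by rwa [extChartAt_source] at hq)

theorem contMDiffAt_chart_symm {q₀ : M} {z : E} (hz : z ∈ (extChartAt 𝓘(ℝ, E) q₀).target) :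
    ContMDiffAt 𝓘(ℝ, E) 𝓘(ℝ, E) ∞ (extChartAt 𝓘(ℝ, E) q₀).symm z :=
  (contMDiffOn_extChartAt_symm q₀).contMDiffAt
    ((isOpen_extChartAt_target q₀).mem_nhds hz)

theorem mdifferentiableAt_chart_symm {q₀ : M} {z : E}
    (hz : z ∈ (extChartAt 𝓘(ℝ, E) q₀).target) :
    MDifferentiableAt 𝓘(ℝ, E) 𝓘(ℝ, E) (extChartAt 𝓘(ℝ, E) q₀).symm z :=
  (contMDiffAt_chart_symm hz).mdifferentiableAt (by simp)

theorem contMDiffAt_chart {q₀ q : M} (hq : q ∈ (extChartAt 𝓘(ℝ, E) q₀).source) :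
    ContMDiffAt 𝓘(ℝ, E) 𝓘(ℝ, E) ∞ (extChartAt 𝓘(ℝ, E) q₀) q :=
  contMDiffAt_extChartAt' (by rwa [extChartAt_source] at hq)

theorem fwd_comp_bwd {q₀ q : M} (hq : q ∈ (extChartAt 𝓘(ℝ, E) q₀).source) :
    fwd (E := E) q₀ q ∘L bwd q₀ (extChartAt 𝓘(ℝ, E) q₀ q) = ContinuousLinearMap.id ℝ E := by
  have ht := (extChartAt 𝓘(ℝ, E) q₀).map_source hq
  have h := tmap_comp (E := E) (E' := E) (E'' := E) (x := extChartAt 𝓘(ℝ, E) q₀ q)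
    (f := (extChartAt 𝓘(ℝ, E) q₀).symm) (g := extChartAt 𝓘(ℝ, E) q₀)
    (by rw [(extChartAt 𝓘(ℝ, E) q₀).left_inv hq]; exact mdifferentiableAt_chart hq)
    (mdifferentiableAt_chart_symm ht)
  rw [(extChartAt 𝓘(ℝ, E) q₀).left_inv hq] at h
  unfold fwd bwd
  rw [← h, tmap_eq_fderiv]
  have : (fun y => extChartAt 𝓘(ℝ, E) q₀ ((extChartAt 𝓘(ℝ, E) q₀).symm y)) =ᶠ[𝓝
      (extChartAt 𝓘(ℝ, E) q₀ q)] id := by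
    filter_upwards [(isOpen_extChartAt_target q₀).mem_nhds ht] with y hy
    exact (extChartAt 𝓘(ℝ, E) q₀).right_inv hy
  rw [this.fderiv_eq, fderiv_id]

theorem bwd_comp_fwd {q₀ q : M} (hq : q ∈ (extChartAt 𝓘(ℝ, E) q₀).source) :
    bwd q₀ (extChartAt 𝓘(ℝ, E) q₀ q) ∘L fwd (E := E) q₀ q = ContinuousLinearMap.id ℝ E := by
  have ht := (extChartAt 𝓘(ℝ, E) q₀).map_source hq
  have h := tmap_comp (E := E) (E' := E) (E'' := E) (x := q)
    (f := extChartAt 𝓘(ℝ, E) q₀) (g := (extChartAt 𝓘(ℝ, E) q₀).symm)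
    (mdifferentiableAt_chart_symm ht) (mdifferentiableAt_chart hq)
  unfold fwd bwd
  rw [← h]
  have : (fun y => (extChartAt 𝓘(ℝ, E) q₀).symm (extChartAt 𝓘(ℝ, E) q₀ y)) =ᶠ[𝓝 q] id := by
    filter_upwards [(isOpen_extChartAt_source q₀).mem_nhds hq] with y hy
    exact (extChartAt 𝓘(ℝ, E) q₀).left_inv hy
  rw [tmap_congr this]
  exact mfderiv_id

theorem fwd_bwd {q₀ q : M} (hq : q ∈ (extChartAt 𝓘(ℝ, E) q₀).source) (u : E) :
    fwd (E := E) q₀ q (bwd q₀ (extChartAt 𝓘(ℝ, E) q₀ q) u) = u :=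
  DFunLike.congr_fun (fwd_comp_bwd hq) u

theorem bwd_fwd {q₀ q : M} (hq : q ∈ (extChartAt 𝓘(ℝ, E) q₀).source) (u : E) :
    bwd q₀ (extChartAt 𝓘(ℝ, E) q₀ q) (fwd (E := E) q₀ q u) = u :=
  DFunLike.congr_fun (bwd_comp_fwd hq) u

/-- The tangent space at `q` is trivialised by the preferred chart around `q` itself, so this chart
has identity tangent map at its centre. Formulas at a point, written in its own charts, therefore
carry no transition matrices. -/
theorem fwd_self (q : M) : fwd (E := E) q q = ContinuousLinearMap.id ℝ E :=
  mfderiv_extChartAt_self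

theorem bwd_self (q : M) :
    bwd (E := E) q (extChartAt 𝓘(ℝ, E) q q) = ContinuousLinearMap.id ℝ E := by
  have h := fwd_comp_bwd (E := E) (mem_extChartAt_source (I := 𝓘(ℝ, E)) q)
  rwa [fwd_self, ContinuousLinearMap.id_comp] at h

/-- The tangent map of `f` in charts is the derivative of the expression of `f` in charts. -/
theorem fwd_tmap_bwd {f : M → M'} {x₀ x : M} {q₀ : M'}
    (hf : MDifferentiableAt 𝓘(ℝ, E) 𝓘(ℝ, E') f x)
    (hx : x ∈ (extChartAt 𝓘(ℝ, E) x₀).source) (hq : f x ∈ (extChartAt 𝓘(ℝ, E') q₀).source) :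
    (fwd (E := E') q₀ (f x)) ∘L (tmap (E := E) (E' := E') f x) ∘L
        (bwd (E := E) x₀ (extChartAt 𝓘(ℝ, E) x₀ x)) =
      fderiv ℝ (fun y => extChartAt 𝓘(ℝ, E') q₀ (f ((extChartAt 𝓘(ℝ, E) x₀).symm y)))
        (extChartAt 𝓘(ℝ, E) x₀ x) := by
  have ht := (extChartAt 𝓘(ℝ, E) x₀).map_source hx
  have hl := (extChartAt 𝓘(ℝ, E) x₀).left_inv hx
  rw [← tmap_eq_fderiv]
  have h1 := tmap_comp (E := E) (E' := E) (E'' := E') (x := extChartAt 𝓘(ℝ, E) x₀ x)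
    (f := (extChartAt 𝓘(ℝ, E) x₀).symm) (g := fun y => extChartAt 𝓘(ℝ, E') q₀ (f y))
    (by rw [hl]; exact (mdifferentiableAt_chart hq).comp x hf)
    (mdifferentiableAt_chart_symm ht)
  rw [h1, hl, tmap_comp (E := E) (E' := E') (E'' := E') (mdifferentiableAt_chart hq) hf]
  rfl

/-- The velocity of a curve in a chart. -/
theorem fwd_tmap_curve {c : ℝ → M} {t : ℝ} {q₀ : M}
    (hc : MDifferentiableAt 𝓘(ℝ, ℝ) 𝓘(ℝ, E) c t) (hq : c t ∈ (extChartAt 𝓘(ℝ, E) q₀).source) :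
    fwd (E := E) q₀ (c t) (tmap (E := ℝ) (E' := E) c t 1) =
      deriv (fun r => extChartAt 𝓘(ℝ, E) q₀ (c r)) t := by
  rw [← fderiv_apply_one_eq_deriv, ← tmap_eq_fderiv,
    tmap_comp (E := ℝ) (E' := E) (E'' := E) (mdifferentiableAt_chart hq) hc]
  rfl

end TangentMaps

/-! ### The first variation in coordinates -/

section Calculus

variable {n : ℕ} {E : Type*} [NormedAddCommGroup E] [NormedSpace ℝ E]

local notation "𝔼" => EuclideanSpace ℝ (Fin n)

/-- The element `e^i ⊗ c` of `Hom(ℝⁿ, E)`. -/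
def dualTensor (i : Fin n) : E →L[ℝ] (𝔼 →L[ℝ] E) :=
  ContinuousLinearMap.smulRightL ℝ 𝔼 E (EuclideanSpace.proj i : 𝔼 →L[ℝ] ℝ)

@[simp]
theorem dualTensor_apply (i : Fin n) (c : E) :
    dualTensor i c = (EuclideanSpace.proj i : 𝔼 →L[ℝ] ℝ).smulRight c := rfl

theorem sum_coord_smul_stdVec (w : 𝔼) : ∑ i : Fin n, w i • stdVec i = w := by
  ext j
  simp [Finset.sum_apply, Pi.single_apply]

theorem sum_dualTensor (T : 𝔼 →L[ℝ] E) : ∑ i : Fin n, dualTensor i (T (stdVec i)) = T := by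
  ext w
  conv_rhs => rw [← sum_coord_smul_stdVec w, map_sum]
  simp

/-- The coordinates `(y, σ, ∂σ/∂y)` of the `1`-jet at `y` of the family `σ(ε, ·)`. -/
def jetCoord (σ : ℝ × 𝔼 → E) (p : ℝ × 𝔼) : (𝔼 × E) × (𝔼 →L[ℝ] E) :=
  ((p.2, σ p), (fderiv ℝ σ p) ∘L (ContinuousLinearMap.inr ℝ ℝ 𝔼))

theorem contDiffAt_jetCoord {σ : ℝ × 𝔼 → E} {p : ℝ × 𝔼} (hσ : ContDiffAt ℝ ∞ σ p) :
    ContDiffAt ℝ ∞ (jetCoord σ) p := by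
  refine (contDiffAt_snd.prodMk hσ).prodMk ?_
  exact (hσ.fderiv_right (m := ∞) (by simp)).clm_comp contDiffAt_const

/-- Symmetry of the second derivative exchanges `∂/∂ε` and `∂/∂y`, which makes the velocity of the
jet slot the `y`-derivative of the variation field. The base coordinate does not move, whence the
zero. -/
theorem hasDerivAt_jetCoord {σ : ℝ × 𝔼 → E} {y₀ : 𝔼} (hσ : ContDiffAt ℝ ∞ σ (0, y₀)) :
    HasDerivAt (fun ε : ℝ => jetCoord σ (ε, y₀))
      ((0, fderiv ℝ σ (0, y₀) (1, 0)), fderiv ℝ (fun y => fderiv ℝ σ (0, y) (1, 0)) y₀) 0 := by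
  have hline : HasDerivAt (fun ε : ℝ => (ε, y₀)) ((1 : ℝ), (0 : 𝔼)) 0 :=
    (hasDerivAt_id (0 : ℝ)).prodMk (hasDerivAt_const (0 : ℝ) y₀)
  have h1 : HasFDerivAt σ (fderiv ℝ σ (0, y₀)) (0, y₀) :=
    (hσ.differentiableAt (by simp)).hasFDerivAt
  have h2 : HasFDerivAt (fderiv ℝ σ) (fderiv ℝ (fderiv ℝ σ) (0, y₀)) (0, y₀) :=
    ((hσ.fderiv_right (m := ∞) (by simp)).differentiableAt (by simp)).hasFDerivAt
  have h3 : HasFDerivAt (fun y : 𝔼 => ((0 : ℝ), y)) (ContinuousLinearMap.inr ℝ ℝ 𝔼) y₀ :=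
    (ContinuousLinearMap.inr ℝ ℝ 𝔼).hasFDerivAt
  have hsymm : IsSymmSndFDerivAt ℝ σ (0, y₀) :=
    hσ.isSymmSndFDerivAt (by simpa using ENat.LEInfty.out)
  have hD : fderiv ℝ (fun y => fderiv ℝ σ (0, y) (1, 0)) y₀ =
      (fderiv ℝ (fderiv ℝ σ) (0, y₀) (1, 0)) ∘L (ContinuousLinearMap.inr ℝ ℝ 𝔼) := by
    have h4 := (h2.comp y₀ h3).clm_apply (hasFDerivAt_const ((1 : ℝ), (0 : 𝔼)) y₀)
    have h5 := h4.fderiv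
    simp only [Function.comp_def] at h5
    rw [h5]
    ext h
    simp [hsymm.eq (0, h) (1, 0)]
  rw [hD]
  refine ((hasDerivAt_const (0 : ℝ) y₀).prodMk ?_).prodMk ?_
  · exact h1.comp_hasDerivAt (0 : ℝ) hline
  · have h6 : HasDerivAt (fun ε : ℝ => fderiv ℝ σ (ε, y₀))
        (fderiv ℝ (fderiv ℝ σ) (0, y₀) (1, 0)) 0 := h2.comp_hasDerivAt (0 : ℝ) hline
    have h7 := h6.clm_comp (hasDerivAt_const (0 : ℝ) (ContinuousLinearMap.inr ℝ ℝ 𝔼))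
    simpa using h7

/-- Product rule with the argument frozen at `c y₀` in the first term. The Euler–Lagrange form uses
a vector with constant components whereas the momentum field contains the true variation; the second
term measures the difference. -/
theorem fderiv_clm_const_sub {X : Type*} [NormedAddCommGroup X] [NormedSpace ℝ X]
    {g : 𝔼 → X →L[ℝ] ℝ} {c : 𝔼 → X} {y₀ : 𝔼} (hg : DifferentiableAt ℝ g y₀)
    (hc : DifferentiableAt ℝ c y₀) (h : 𝔼) :
    fderiv ℝ (fun y => g y (c y)) y₀ h =
      fderiv ℝ (fun y => g y (c y₀)) y₀ h + g y₀ (fderiv ℝ c y₀ h) := by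
  rw [fderiv_clm_apply hg hc, fderiv_clm_apply hg (differentiableAt_const _)]
  simp [add_comm]

/-- The first variation formula in coordinates. -/
theorem hasDerivAt_lagrangian_coord {Λ : (𝔼 × E) × (𝔼 →L[ℝ] E) → ℝ} {σ : ℝ × 𝔼 → E} {ρ : 𝔼 → ℝ}
    {y₀ : 𝔼} (hΛ : ContDiffAt ℝ ∞ Λ (jetCoord σ (0, y₀))) (hσ : ContDiffAt ℝ ∞ σ (0, y₀))
    (hρ : DifferentiableAt ℝ ρ y₀) (hρ0 : ρ y₀ ≠ 0) :
    HasDerivAt (fun ε : ℝ => Λ (jetCoord σ (ε, y₀)))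
      (fderiv ℝ Λ (jetCoord σ (0, y₀)) ((0, fderiv ℝ σ (0, y₀) (1, 0)), 0) -
        (∑ i : Fin n, fderiv ℝ (fun y => ρ y * fderiv ℝ Λ (jetCoord σ (0, y))
          (0, dualTensor i (fderiv ℝ σ (0, y₀) (1, 0)))) y₀ (stdVec i)) / ρ y₀ +
        (∑ i : Fin n, fderiv ℝ (fun y => ρ y * fderiv ℝ Λ (jetCoord σ (0, y))
          (0, dualTensor i (fderiv ℝ σ (0, y) (1, 0)))) y₀ (stdVec i)) / ρ y₀) 0 := by
  set δ : 𝔼 → E := fun y => fderiv ℝ σ (0, y) (1, 0) with hδ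
  have hin : ContDiffAt ℝ ∞ (fun y : 𝔼 => ((0 : ℝ), y)) y₀ := contDiffAt_const.prodMk contDiffAt_id
  have hJ : ContDiffAt ℝ ∞ (fun y => jetCoord σ (0, y)) y₀ :=
    (contDiffAt_jetCoord hσ).comp y₀ hin
  have hg : DifferentiableAt ℝ (fun y => ρ y • fderiv ℝ Λ (jetCoord σ (0, y))) y₀ :=
    hρ.smul (((hΛ.fderiv_right (m := ∞) (by simp)).comp y₀ hJ).differentiableAt (by simp))
  have hδd : DifferentiableAt ℝ δ y₀ :=
    ((((hσ.fderiv_right (m := ∞) (by simp)).comp y₀ hin).clm_apply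
      contDiffAt_const).differentiableAt (by simp) :)
  -- The divergence with the true variation exceeds the one with the variation frozen at `y₀` by a
  -- term in `∂ᵢδ`. Summed over `i` and divided by the density, these terms are the derivative of
  -- `Λ` in the jet slot.
  have key : ∀ i : Fin n,
      fderiv ℝ (fun y => ρ y * fderiv ℝ Λ (jetCoord σ (0, y)) (0, dualTensor i (δ y))) y₀
          (stdVec i) =
        fderiv ℝ (fun y => ρ y * fderiv ℝ Λ (jetCoord σ (0, y)) (0, dualTensor i (δ y₀))) y₀
          (stdVec i) +
        ρ y₀ * fderiv ℝ Λ (jetCoord σ (0, y₀))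
          (0, dualTensor i (fderiv ℝ δ y₀ (stdVec i))) := by
    intro i
    have hc : HasFDerivAt (fun y => ((0, dualTensor i (δ y)) : (𝔼 × E) × (𝔼 →L[ℝ] E)))
        ((ContinuousLinearMap.inr ℝ (𝔼 × E) (𝔼 →L[ℝ] E)) ∘L (dualTensor i) ∘L (fderiv ℝ δ y₀)) y₀ :=
      ((ContinuousLinearMap.inr ℝ (𝔼 × E) (𝔼 →L[ℝ] E)) ∘L (dualTensor i)).hasFDerivAt.comp y₀
        hδd.hasFDerivAt
    have h := fderiv_clm_const_sub hg hc.differentiableAt (stdVec i)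
    rw [hc.fderiv] at h
    exact h
  have hsum : (∑ i : Fin n, fderiv ℝ (fun y => ρ y * fderiv ℝ Λ (jetCoord σ (0, y))
          (0, dualTensor i (δ y))) y₀ (stdVec i)) / ρ y₀ =
      (∑ i : Fin n, fderiv ℝ (fun y => ρ y * fderiv ℝ Λ (jetCoord σ (0, y))
          (0, dualTensor i (δ y₀))) y₀ (stdVec i)) / ρ y₀ +
        fderiv ℝ Λ (jetCoord σ (0, y₀)) (0, fderiv ℝ δ y₀) := by
    simp_rw [key]
    rw [Finset.sum_add_distrib, add_div, ← Finset.mul_sum, mul_div_cancel_left₀ _ hρ0]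
    congr 1
    conv_rhs => rw [← sum_dualTensor (fderiv ℝ δ y₀)]
    have : ((0, ∑ i, dualTensor i (fderiv ℝ δ y₀ (stdVec i))) : (𝔼 × E) × (𝔼 →L[ℝ] E)) =
        ∑ i, (0, dualTensor i (fderiv ℝ δ y₀ (stdVec i))) := by
      rw [← Prod.mk_zero_zero]
      simp [Prod.ext_iff, Prod.fst_sum, Prod.snd_sum]
    rw [this, map_sum]
  rw [hsum]
  have hmain := (hΛ.differentiableAt (by simp)).hasFDerivAt.comp_hasDerivAt (0 : ℝ)
    (hasDerivAt_jetCoord hσ)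
  have hsplit : (((0, δ y₀), fderiv ℝ δ y₀) : (𝔼 × E) × (𝔼 →L[ℝ] E)) =
      ((0, δ y₀), 0) + (0, fderiv ℝ δ y₀) := by simp
  change HasDerivAt _ (fderiv ℝ Λ (jetCoord σ (0, y₀)) ((0, δ y₀), fderiv ℝ δ y₀)) 0 at hmain
  rw [hsplit, map_add] at hmain
  rw [← add_assoc, sub_add_cancel]
  exact hmain

end Calculus

/-! ### Lagrangians and families of maps in charts -/

section LagrangianCharts

variable {n : ℕ} {N : Type*} [TopologicalSpace N] [ChartedSpace (EuclideanSpace ℝ (Fin n)) N]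
  {E : Type*} [NormedAddCommGroup E] [NormedSpace ℝ E]
  {M : Type*} [TopologicalSpace M] [ChartedSpace E M]

local notation "𝔼" => EuclideanSpace ℝ (Fin n)

/-- The value of `L` on a jet given as a map between the model spaces. -/
def lagVal (L : Lagrangian n N E M) (x : N) (q : M) (j : 𝔼 →L[ℝ] E) : ℝ := L x q j

/-- The value of `F` on a jet and a vector given in the model spaces. -/
def forceVal (F : Force n N E M) (x : N) (q : M) (j : 𝔼 →L[ℝ] E) : E →L[ℝ] ℝ := F x q j

/-- The expression of `L` in the charts around `x₀` and `q₀`. -/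
def coordLag (L : Lagrangian n N E M) (x₀ : N) (q₀ : M) (p : (𝔼 × E) × (𝔼 →L[ℝ] E)) : ℝ :=
  lagVal L ((extChartAt (𝓡 n) x₀).symm p.1.1) ((extChartAt 𝓘(ℝ, E) q₀).symm p.1.2)
    ((bwd (E := E) q₀ p.1.2) ∘L p.2 ∘L (fwd (E := 𝔼) x₀ ((extChartAt (𝓡 n) x₀).symm p.1.1)))

/-- The expression of `F` in the charts around `x₀` and `q₀`. -/
def coordForce (F : Force n N E M) (x₀ : N) (q₀ : M) (p : (𝔼 × E) × (𝔼 →L[ℝ] E)) : E →L[ℝ] ℝ :=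
  (forceVal F ((extChartAt (𝓡 n) x₀).symm p.1.1) ((extChartAt 𝓘(ℝ, E) q₀).symm p.1.2)
    ((bwd (E := E) q₀ p.1.2) ∘L p.2 ∘L
      (fwd (E := 𝔼) x₀ ((extChartAt (𝓡 n) x₀).symm p.1.1)))) ∘L (bwd (E := E) q₀ p.1.2)

theorem isOpen_jetChart (x₀ : N) (q₀ : M) :
    IsOpen (((extChartAt (𝓡 n) x₀).target ×ˢ (extChartAt 𝓘(ℝ, E) q₀).target) ×ˢ
      (univ : Set (𝔼 →L[ℝ] E))) :=
  ((isOpen_extChartAt_target x₀).prod (isOpen_extChartAt_target q₀)).prod isOpen_univ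

theorem SmoothLagrangian.contDiffAt {L : Lagrangian n N E M} (hL : SmoothLagrangian L)
    {x₀ : N} {q₀ : M} {p : (𝔼 × E) × (𝔼 →L[ℝ] E)} (h1 : p.1.1 ∈ (extChartAt (𝓡 n) x₀).target)
    (h2 : p.1.2 ∈ (extChartAt 𝓘(ℝ, E) q₀).target) : ContDiffAt ℝ ∞ (coordLag L x₀ q₀) p :=
  (hL x₀ q₀).contDiffAt ((isOpen_jetChart x₀ q₀).mem_nhds ⟨⟨h1, h2⟩, mem_univ _⟩)

theorem SmoothForce.contDiffAt {F : Force n N E M} (hF : SmoothForce F)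
    {x₀ : N} {q₀ : M} {p : (𝔼 × E) × (𝔼 →L[ℝ] E)} (h1 : p.1.1 ∈ (extChartAt (𝓡 n) x₀).target)
    (h2 : p.1.2 ∈ (extChartAt 𝓘(ℝ, E) q₀).target) : ContDiffAt ℝ ∞ (coordForce F x₀ q₀) p :=
  (hF x₀ q₀).contDiffAt ((isOpen_jetChart x₀ q₀).mem_nhds ⟨⟨h1, h2⟩, mem_univ _⟩)

/-- The fibre derivative, with tangent spaces identified with the model spaces. -/
def fiberVal (L : Lagrangian n N E M) (x : N) (q : M) (j : 𝔼 →L[ℝ] E) (c : E) : 𝔼 :=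
  fiberDeriv L x q j c

theorem fiberVal_eq (L : Lagrangian n N E M) (x : N) (q : M) (j : 𝔼 →L[ℝ] E) (c : E) :
    fiberVal L x q j c =
      ∑ i : Fin n, (deriv (fun ε : ℝ => lagVal L x q (j + ε • dualTensor i c)) 0) • stdVec i :=
  rfl

theorem mdifferentiableAt_of_family {S : ℝ → N → M} {ε : ℝ} {x : N}
    (hS : ContMDiffAt (𝓘(ℝ, ℝ).prod (𝓡 n)) 𝓘(ℝ, E) ∞ (fun p : ℝ × N => S p.1 p.2) (ε, x)) :
    MDifferentiableAt (𝓡 n) 𝓘(ℝ, E) (S ε) x := by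
  have h1 : ContMDiffAt (𝓡 n) (𝓘(ℝ, ℝ).prod (𝓡 n)) ∞ (fun x' : N => (ε, x')) x :=
    contMDiffAt_const.prodMk contMDiffAt_id
  exact (ContMDiffAt.comp x hS h1).mdifferentiableAt (by simp)

theorem mdifferentiableAt_curve_of_family {S : ℝ → N → M} {ε : ℝ} {x : N}
    (hS : ContMDiffAt (𝓘(ℝ, ℝ).prod (𝓡 n)) 𝓘(ℝ, E) ∞ (fun p : ℝ × N => S p.1 p.2) (ε, x)) :
    MDifferentiableAt 𝓘(ℝ, ℝ) 𝓘(ℝ, E) (fun t => S t x) ε := by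
  have h1 : ContMDiffAt 𝓘(ℝ, ℝ) (𝓘(ℝ, ℝ).prod (𝓡 n)) ∞ (fun t : ℝ => (t, x)) ε :=
    contMDiffAt_id.prodMk contMDiffAt_const
  exact (ContMDiffAt.comp ε hS h1).mdifferentiableAt (by simp)

variable [IsManifold (𝓡 n) ∞ N] [IsManifold 𝓘(ℝ, E) ∞ M]

theorem bwd_comp_comp_fwd {x₀ x : N} {q₀ q : M} (hx : x ∈ (extChartAt (𝓡 n) x₀).source)
    (hq : q ∈ (extChartAt 𝓘(ℝ, E) q₀).source) (j : 𝔼 →L[ℝ] E) :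
    (bwd (E := E) q₀ (extChartAt 𝓘(ℝ, E) q₀ q)) ∘L
      ((fwd (E := E) q₀ q) ∘L j ∘L (bwd (E := 𝔼) x₀ (extChartAt (𝓡 n) x₀ x))) ∘L
      (fwd (E := 𝔼) x₀ x) = j := by
  ext w
  simp only [ContinuousLinearMap.comp_apply, bwd_fwd hx, bwd_fwd hq]

theorem lagVal_eq_coordLag (L : Lagrangian n N E M) {x₀ x : N} {q₀ q : M}
    (hx : x ∈ (extChartAt (𝓡 n) x₀).source) (hq : q ∈ (extChartAt 𝓘(ℝ, E) q₀).source)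
    (j : 𝔼 →L[ℝ] E) :
    lagVal L x q j = coordLag L x₀ q₀ ((extChartAt (𝓡 n) x₀ x, extChartAt 𝓘(ℝ, E) q₀ q),
      (fwd (E := E) q₀ q) ∘L j ∘L (bwd (E := 𝔼) x₀ (extChartAt (𝓡 n) x₀ x))) := by
  simp only [coordLag]
  rw [(extChartAt (𝓡 n) x₀).left_inv hx, (extChartAt 𝓘(ℝ, E) q₀).left_inv hq,
    bwd_comp_comp_fwd hx hq]

theorem forceVal_eq_coordForce (F : Force n N E M) {x₀ x : N} {q₀ q : M}
    (hx : x ∈ (extChartAt (𝓡 n) x₀).source) (hq : q ∈ (extChartAt 𝓘(ℝ, E) q₀).source)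
    (j : 𝔼 →L[ℝ] E) (u : E) :
    forceVal F x q j u = coordForce F x₀ q₀ ((extChartAt (𝓡 n) x₀ x, extChartAt 𝓘(ℝ, E) q₀ q),
      (fwd (E := E) q₀ q) ∘L j ∘L (bwd (E := 𝔼) x₀ (extChartAt (𝓡 n) x₀ x)))
        (fwd (E := E) q₀ q u) := by
  simp only [coordForce]
  rw [(extChartAt (𝓡 n) x₀).left_inv hx, (extChartAt 𝓘(ℝ, E) q₀).left_inv hq,
    bwd_comp_comp_fwd hx hq, ContinuousLinearMap.comp_apply, bwd_fwd hq]

/-- `fiberDeriv` is assembled from the standard basis of the tangent space and its dual. The chart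
acts on vectors by `fwd` and on covectors through `bwd`, inverse to each other, so contracting the
two (`h4`) leaves the covector `e^i` of the chart. -/
theorem fwd_fiberVal {L : Lagrangian n N E M} (hL : SmoothLagrangian L) {x₀ x : N} {q₀ q : M}
    (hx : x ∈ (extChartAt (𝓡 n) x₀).source) (hq : q ∈ (extChartAt 𝓘(ℝ, E) q₀).source)
    (j : 𝔼 →L[ℝ] E) (c : E) (i : Fin n) :
    fwd (E := 𝔼) x₀ x (fiberVal L x q j c) i =
      fderiv ℝ (coordLag L x₀ q₀) ((extChartAt (𝓡 n) x₀ x, extChartAt 𝓘(ℝ, E) q₀ q),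
      (fwd (E := E) q₀ q) ∘L j ∘L (bwd (E := 𝔼) x₀ (extChartAt (𝓡 n) x₀ x)))
        (0, dualTensor i (fwd (E := E) q₀ q c)) := by
  set y := extChartAt (𝓡 n) x₀ x with hy
  set z := extChartAt 𝓘(ℝ, E) q₀ q with hz
  set J := (fwd (E := E) q₀ q) ∘L j ∘L (bwd (E := 𝔼) x₀ y) with hJ
  set D := fderiv ℝ (coordLag L x₀ q₀) ((y, z), J) with hD
  have hΛ : HasFDerivAt (coordLag L x₀ q₀) D ((y, z), J) :=
    ((hL.contDiffAt ((extChartAt (𝓡 n) x₀).map_source hx)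
      ((extChartAt 𝓘(ℝ, E) q₀).map_source hq)).differentiableAt (by simp)).hasFDerivAt
  have hd : ∀ k : Fin n, deriv (fun ε : ℝ => lagVal L x q (j + ε • dualTensor k c)) 0 =
      D (0, (dualTensor k (fwd (E := E) q₀ q c)) ∘L (bwd (E := 𝔼) x₀ y)) := by
    intro k
    have h1 : ∀ ε : ℝ, lagVal L x q (j + ε • dualTensor k c) = coordLag L x₀ q₀
        (((y, z), J) + ε • (0, (dualTensor k (fwd (E := E) q₀ q c)) ∘L (bwd (E := 𝔼) x₀ y))) := by
      intro ε
      rw [lagVal_eq_coordLag L hx hq]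
      congr 1
      simp only [Prod.smul_mk, smul_zero, Prod.mk_add_mk, add_zero]
      congr 1
      ext w
      simp [hJ, hy]
    simp_rw [h1]
    have hl : HasDerivAt (fun ε : ℝ => (((y, z), J) + ε •
        (0, (dualTensor k (fwd (E := E) q₀ q c)) ∘L (bwd (E := 𝔼) x₀ y)) :
          (𝔼 × E) × (𝔼 →L[ℝ] E)))
        (0, (dualTensor k (fwd (E := E) q₀ q c)) ∘L (bwd (E := 𝔼) x₀ y)) 0 := by
      simpa using ((hasDerivAt_id (0 : ℝ)).smul_const
        ((0, (dualTensor k (fwd (E := E) q₀ q c)) ∘L (bwd (E := 𝔼) x₀ y)) :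
          (𝔼 × E) × (𝔼 →L[ℝ] E))).const_add ((y, z), J)
    exact (HasFDerivAt.comp_hasDerivAt (0 : ℝ) (by simpa using hΛ) hl).deriv
  rw [fiberVal_eq]
  simp_rw [hd, map_sum, map_smul]
  have h2 : ∀ (w : Fin n → 𝔼), (∑ k, w k) i = ∑ k, w k i := fun w => by simp
  rw [h2]
  simp only [PiLp.smul_apply, smul_eq_mul]
  have h3 : ∀ k, D (0, (dualTensor k (fwd (E := E) q₀ q c)) ∘L (bwd (E := 𝔼) x₀ y)) *
      (fwd (E := 𝔼) x₀ x (stdVec k)) i = (D ∘L ContinuousLinearMap.inr ℝ _ _)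
        ((fwd (E := 𝔼) x₀ x (stdVec k)) i •
          ((dualTensor k (fwd (E := E) q₀ q c)) ∘L (bwd (E := 𝔼) x₀ y))) := by
    intro k
    rw [map_smul, smul_eq_mul, mul_comm]
    rfl
  simp_rw [h3]
  rw [← map_sum]
  have h4 : ∑ k, (fwd (E := 𝔼) x₀ x (stdVec k)) i •
      ((dualTensor k (fwd (E := E) q₀ q c)) ∘L (bwd (E := 𝔼) x₀ y)) =
      dualTensor i (fwd (E := E) q₀ q c) := by
    ext w
    simp only [sum_apply, smul_apply, ContinuousLinearMap.comp_apply,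
      dualTensor_apply, ContinuousLinearMap.smulRight_apply, smul_smul]
    rw [← Finset.sum_smul]
    congr 1
    have h5 : fwd (E := 𝔼) x₀ x (bwd (E := 𝔼) x₀ y w) = w := fwd_bwd hx w
    conv_rhs => rw [← h5, ← sum_coord_smul_stdVec (bwd (E := 𝔼) x₀ y w), map_sum]
    simp [mul_comm]
  rw [h4]
  rfl

/-- The expression in charts of a one-parameter family of maps. -/
def coordFam (S : ℝ → N → M) (x₀ : N) (q₀ : M) (p : ℝ × 𝔼) : E :=
  extChartAt 𝓘(ℝ, E) q₀ (S p.1 ((extChartAt (𝓡 n) x₀).symm p.2))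

theorem contDiffAt_coordFam {S : ℝ → N → M} {ε : ℝ} {x₀ x : N} {q₀ : M}
    (hS : ContMDiffAt (𝓘(ℝ, ℝ).prod (𝓡 n)) 𝓘(ℝ, E) ∞ (fun p : ℝ × N => S p.1 p.2) (ε, x))
    (hx : x ∈ (extChartAt (𝓡 n) x₀).source) (hq : S ε x ∈ (extChartAt 𝓘(ℝ, E) q₀).source) :
    ContDiffAt ℝ ∞ (coordFam (n := n) (E := E) S x₀ q₀) (ε, extChartAt (𝓡 n) x₀ x) := by
  rw [← contMDiffAt_iff_contDiffAt]
  have h1 : ContMDiffAt 𝓘(ℝ, ℝ × 𝔼) (𝓘(ℝ, ℝ).prod (𝓡 n)) ∞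
      (fun p : ℝ × 𝔼 => (p.1, (extChartAt (𝓡 n) x₀).symm p.2)) (ε, extChartAt (𝓡 n) x₀ x) := by
    refine ContMDiffAt.prodMk contDiffAt_fst.contMDiffAt ?_
    exact ContMDiffAt.comp (I' := 𝓡 n) (ε, extChartAt (𝓡 n) x₀ x)
      (contMDiffAt_chart_symm ((extChartAt (𝓡 n) x₀).map_source hx)) contDiffAt_snd.contMDiffAt
  have hl := (extChartAt (𝓡 n) x₀).left_inv hx
  have h2 := ContMDiffAt.comp (ε, extChartAt (𝓡 n) x₀ x) (by rw [hl]; exact hS) h1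
  refine ContMDiffAt.comp (I' := 𝓘(ℝ, E)) (ε, extChartAt (𝓡 n) x₀ x) ?_ h2
  exact contMDiffAt_chart (by change S ε _ ∈ _; rw [hl]; exact hq)

/-- The `1`-jets of a family of maps in charts. -/
theorem jetCoord_coordFam {S : ℝ → N → M} {ε : ℝ} {x₀ x : N} {q₀ : M}
    (hS : ContMDiffAt (𝓘(ℝ, ℝ).prod (𝓡 n)) 𝓘(ℝ, E) ∞ (fun p : ℝ × N => S p.1 p.2) (ε, x))
    (hx : x ∈ (extChartAt (𝓡 n) x₀).source) (hq : S ε x ∈ (extChartAt 𝓘(ℝ, E) q₀).source) :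
    jetCoord (coordFam (n := n) (E := E) S x₀ q₀) (ε, extChartAt (𝓡 n) x₀ x) =
      ((extChartAt (𝓡 n) x₀ x, extChartAt 𝓘(ℝ, E) q₀ (S ε x)),
        (fwd (E := E) q₀ (S ε x)) ∘L (tmap (E := 𝔼) (E' := E) (S ε) x) ∘L
          (bwd (E := 𝔼) x₀ (extChartAt (𝓡 n) x₀ x))) := by
  have hd := (contDiffAt_coordFam (E := E) hS hx hq).differentiableAt (by simp)
  rw [fwd_tmap_bwd (mdifferentiableAt_of_family hS) hx hq]
  simp only [jetCoord]
  congr 1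
  · simp only [coordFam, (extChartAt (𝓡 n) x₀).left_inv hx]
  · have h3 : HasFDerivAt (fun y : 𝔼 => (ε, y)) (ContinuousLinearMap.inr ℝ ℝ 𝔼)
        (extChartAt (𝓡 n) x₀ x) := by
      have := (hasFDerivAt_const (𝕜 := ℝ) ε (extChartAt (𝓡 n) x₀ x)).prodMk
        (hasFDerivAt_id (𝕜 := ℝ) (extChartAt (𝓡 n) x₀ x))
      exact this
    exact (hd.hasFDerivAt.comp _ h3).fderiv.symm

/-- The variation field `δs` of a family, with tangent spaces identified with the model space. -/
def variation (S : ℝ → N → M) (x : N) : E := tmap (E := ℝ) (E' := E) (fun ε => S ε x) 0 1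

theorem fwd_variation {S : ℝ → N → M} {x₀ x : N} {q₀ : M}
    (hS : ContMDiffAt (𝓘(ℝ, ℝ).prod (𝓡 n)) 𝓘(ℝ, E) ∞ (fun p : ℝ × N => S p.1 p.2) (0, x))
    (hx : x ∈ (extChartAt (𝓡 n) x₀).source) (hq : S 0 x ∈ (extChartAt 𝓘(ℝ, E) q₀).source) :
    fwd (E := E) q₀ (S 0 x) (variation (E := E) S x) =
      fderiv ℝ (coordFam (n := n) (E := E) S x₀ q₀) (0, extChartAt (𝓡 n) x₀ x) (1, 0) := by
  have hd := (contDiffAt_coordFam (E := E) hS hx hq).differentiableAt (by simp)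
  have hline : HasDerivAt (fun ε : ℝ => (ε, extChartAt (𝓡 n) x₀ x)) ((1 : ℝ), (0 : 𝔼)) 0 :=
    (hasDerivAt_id (0 : ℝ)).prodMk (hasDerivAt_const (0 : ℝ) _)
  have h := (hd.hasFDerivAt.comp_hasDerivAt (0 : ℝ) hline).deriv
  rw [← h]
  have := fwd_tmap_curve (E := E) (q₀ := q₀) (mdifferentiableAt_curve_of_family hS) hq
  refine this.trans ?_
  congr 1
  funext r
  simp only [coordFam, Function.comp, (extChartAt (𝓡 n) x₀).left_inv hx]

/-- The Lagrangian along a family of maps in charts. -/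
theorem lagVal_family (L : Lagrangian n N E M) {S : ℝ → N → M} {ε : ℝ} {x₀ x : N} {q₀ : M}
    (hS : ContMDiffAt (𝓘(ℝ, ℝ).prod (𝓡 n)) 𝓘(ℝ, E) ∞ (fun p : ℝ × N => S p.1 p.2) (ε, x))
    (hx : x ∈ (extChartAt (𝓡 n) x₀).source) (hq : S ε x ∈ (extChartAt 𝓘(ℝ, E) q₀).source) :
    lagVal L x (S ε x) (tmap (E := 𝔼) (E' := E) (S ε) x) =
      coordLag L x₀ q₀ (jetCoord (coordFam (n := n) (E := E) S x₀ q₀) (ε, extChartAt (𝓡 n) x₀ x)) := by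
  rw [lagVal_eq_coordLag L hx hq, jetCoord_coordFam hS hx hq]

/-- The fibre derivative along a family of maps in charts. -/
theorem fwd_fiberVal_family {L : Lagrangian n N E M} (hL : SmoothLagrangian L) {S : ℝ → N → M}
    {ε : ℝ} {x₀ x : N} {q₀ : M}
    (hS : ContMDiffAt (𝓘(ℝ, ℝ).prod (𝓡 n)) 𝓘(ℝ, E) ∞ (fun p : ℝ × N => S p.1 p.2) (ε, x))
    (hx : x ∈ (extChartAt (𝓡 n) x₀).source) (hq : S ε x ∈ (extChartAt 𝓘(ℝ, E) q₀).source)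
    (c : E) (i : Fin n) :
    fwd (E := 𝔼) x₀ x (fiberVal L x (S ε x) (tmap (E := 𝔼) (E' := E) (S ε) x) c) i =
      fderiv ℝ (coordLag L x₀ q₀)
        (jetCoord (coordFam (n := n) (E := E) S x₀ q₀) (ε, extChartAt (𝓡 n) x₀ x))
        (0, dualTensor i (fwd (E := E) q₀ (S ε x) c)) := by
  rw [fwd_fiberVal hL hx hq, jetCoord_coordFam hS hx hq]

end LagrangianCharts

/-! ### Volume densities -/

section Density

variable {n : ℕ} {N : Type*} [TopologicalSpace N] [ChartedSpace (EuclideanSpace ℝ (Fin n)) N]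

local notation "𝔼" => EuclideanSpace ℝ (Fin n)

/-- The component of the volume form at `x` in the standard basis of the model space. -/
def stdDensity (v : VolumeForm n N) (x : N) : ℝ := v.form x (fun i => tanVec x i)

/-- The density of the volume form in the chart around `x₀`. -/
def density (v : VolumeForm n N) (x₀ : N) (y : 𝔼) : ℝ := formDensity v.form x₀ y

/-- A form of top degree is a multiple of the determinant in the standard basis. -/
theorem alternating_comp_det (f : 𝔼 [⋀^Fin n]→L[ℝ] ℝ) (T : 𝔼 →L[ℝ] 𝔼) :
    f (fun i => T (stdVec i)) = f (fun i => stdVec i) * LinearMap.det (T : 𝔼 →ₗ[ℝ] 𝔼) := by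
  have he : ∀ i, (EuclideanSpace.basisFun (Fin n) ℝ).toBasis i = stdVec i := fun i => by simp
  have h := AlternatingMap.eq_smul_basis_det (EuclideanSpace.basisFun (Fin n) ℝ).toBasis
    f.toAlternatingMap
  have h1 := DFunLike.congr_fun h (fun i => T (stdVec i))
  have h2 := Module.Basis.det_comp (EuclideanSpace.basisFun (Fin n) ℝ).toBasis
    (T : 𝔼 →ₗ[ℝ] 𝔼) (EuclideanSpace.basisFun (Fin n) ℝ).toBasis
  rw [Module.Basis.det_self, mul_one] at h2
  rw [← h2]
  refine h1.trans ?_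
  have h3 : (⇑(EuclideanSpace.basisFun (Fin n) ℝ).toBasis) = fun i => stdVec i := funext he
  rw [AlternatingMap.smul_apply, h3]
  rfl

theorem density_eq (v : VolumeForm n N) (x₀ : N) (y : 𝔼) :
    density v x₀ y = stdDensity v ((extChartAt (𝓡 n) x₀).symm y) *
      LinearMap.det (bwd (E := 𝔼) x₀ y : 𝔼 →ₗ[ℝ] 𝔼) :=
  alternating_comp_det (v.form ((extChartAt (𝓡 n) x₀).symm y)) (bwd (E := 𝔼) x₀ y)

/-- An alternating form of top degree that vanishes on one basis is zero. -/
theorem stdDensity_ne_zero (v : VolumeForm n N) (x : N) : stdDensity v x ≠ 0 := by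
  intro h
  refine v.ne_zero x ?_
  have h3 : (⇑(EuclideanSpace.basisFun (Fin n) ℝ).toBasis) = fun i => stdVec i :=
    funext fun i => by simp
  have key : ∀ f : 𝔼 [⋀^Fin n]→L[ℝ] ℝ, f (fun i => stdVec i) = 0 → f = 0 := by
    intro f hf
    have h1 := (AlternatingMap.map_basis_eq_zero_iff
      (EuclideanSpace.basisFun (Fin n) ℝ).toBasis f.toAlternatingMap).1 (by rw [h3]; exact hf)
    exact ContinuousAlternatingMap.toAlternatingMap_injective h1
  exact key _ h

variable [IsManifold (𝓡 n) ∞ N]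

theorem det_bwd_ne_zero {x₀ : N} {y : 𝔼} (hy : y ∈ (extChartAt (𝓡 n) x₀).target) :
    LinearMap.det (bwd (E := 𝔼) x₀ y : 𝔼 →ₗ[ℝ] 𝔼) ≠ 0 := by
  have h := fwd_comp_bwd (E := 𝔼) ((extChartAt (𝓡 n) x₀).map_target hy)
  rw [(extChartAt (𝓡 n) x₀).right_inv hy] at h
  have h1 : LinearMap.det ((fwd (E := 𝔼) x₀ ((extChartAt (𝓡 n) x₀).symm y) : 𝔼 →ₗ[ℝ] 𝔼) ∘ₗ
      (bwd (E := 𝔼) x₀ y : 𝔼 →ₗ[ℝ] 𝔼)) = 1 := by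
    rw [← ContinuousLinearMap.toLinearMap_comp, h]
    exact LinearMap.det_id
  rw [LinearMap.det_comp] at h1
  exact right_ne_zero_of_mul_eq_one h1

theorem density_ne_zero (v : VolumeForm n N) {x₀ : N} {y : 𝔼}
    (hy : y ∈ (extChartAt (𝓡 n) x₀).target) : density v x₀ y ≠ 0 := by
  rw [density_eq]
  exact mul_ne_zero (stdDensity_ne_zero v _) (det_bwd_ne_zero hy)

theorem contDiffAt_density (v : VolumeForm n N) {x₀ : N} {y : 𝔼}
    (hy : y ∈ (extChartAt (𝓡 n) x₀).target) : ContDiffAt ℝ ∞ (density v x₀) y :=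
  (v.smooth x₀).contDiffAt ((isOpen_extChartAt_target x₀).mem_nhds hy)

/-- The expression in the chart around `x₀` of a vector field. -/
def coordVF (X : N → 𝔼) (x₀ : N) (y : 𝔼) : 𝔼 :=
  fwd (E := 𝔼) x₀ ((extChartAt (𝓡 n) x₀).symm y) (X ((extChartAt (𝓡 n) x₀).symm y))

/-- The expression in the chart around `x₀` of the divergence. -/
def divCoord (v : VolumeForm n N) (X : N → 𝔼) (x₀ : N) (y : 𝔼) : ℝ :=
  (∑ i : Fin n, fderiv ℝ (fun y => density v x₀ y * coordVF X x₀ y i) y (stdVec i)) /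
    density v x₀ y

/-- The divergence of a vector field with values in the model space. -/
def divVal (v : VolumeForm n N) (X : N → 𝔼) (x : N) : ℝ := divergence v X x

theorem divVal_eq (v : VolumeForm n N) (X : N → 𝔼) (x : N) :
    divVal v X x = divCoord v X x (extChartAt (𝓡 n) x x) := rfl

end Density

/-! ### The first variation formula -/

section FirstVariation

variable {n : ℕ} {N : Type*} [TopologicalSpace N] [ChartedSpace (EuclideanSpace ℝ (Fin n)) N]
  {E : Type*} [NormedAddCommGroup E] [NormedSpace ℝ E]
  {M : Type*} [TopologicalSpace M] [ChartedSpace E M]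

local notation "𝔼" => EuclideanSpace ℝ (Fin n)

/-- The Euler–Lagrange form, with tangent spaces identified with the model space. -/
def elVal (v : VolumeForm n N) (L : Lagrangian n N E M) (s : N → M) (x : N) (u : E) : ℝ :=
  eulerLagrange v L s x u

/-- A family `S ε` of maps is smooth near `(ε, x)`. -/
def SmoothFamilyNear (S : ℝ → N → M) (ε : ℝ) (x : N) : Prop :=
  ∀ᶠ p in 𝓝 (ε, x), ContMDiffAt (𝓘(ℝ, ℝ).prod (𝓡 n)) 𝓘(ℝ, E) ∞ (fun p : ℝ × N => S p.1 p.2) p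

/-- The vector field `∂L/∂j¹s (δs)` of a family. -/
def momentumField (L : Lagrangian n N E M) (S : ℝ → N → M) (x : N) : 𝔼 :=
  fiberVal L x (S 0 x) (tmap (E := 𝔼) (E' := E) (S 0) x) (variation (E := E) S x)

theorem SmoothFamilyNear.eventually_slice {S : ℝ → N → M} {x : N}
    (hS : SmoothFamilyNear (n := n) (E := E) S 0 x) :
    ∀ᶠ x' in 𝓝 x, ContMDiffAt (𝓘(ℝ, ℝ).prod (𝓡 n)) 𝓘(ℝ, E) ∞
      (fun p : ℝ × N => S p.1 p.2) (0, x') :=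
  (Continuous.prodMk_right (0 : ℝ)).continuousAt.eventually hS

theorem ContMDiffAt.continuousAt_slice {S : ℝ → N → M} {x : N}
    (hS : ContMDiffAt (𝓘(ℝ, ℝ).prod (𝓡 n)) 𝓘(ℝ, E) ∞ (fun p : ℝ × N => S p.1 p.2) (0, x)) :
    ContinuousAt (S 0) x :=
  ContinuousAt.comp (f := fun x' : N => ((0 : ℝ), x')) (x := x) hS.continuousAt
    (Continuous.prodMk_right (0 : ℝ)).continuousAt

variable [IsManifold (𝓡 n) ∞ N] [IsManifold 𝓘(ℝ, E) ∞ M]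

theorem eventually_chart_symm {x₀ x : N} (hx : x ∈ (extChartAt (𝓡 n) x₀).source) {p : N → Prop}
    (h : ∀ᶠ x' in 𝓝 x, p x') :
    ∀ᶠ y in 𝓝 (extChartAt (𝓡 n) x₀ x), y ∈ (extChartAt (𝓡 n) x₀).target ∧
      p ((extChartAt (𝓡 n) x₀).symm y) := by
  refine ((isOpen_extChartAt_target x₀).eventually_mem
    ((extChartAt (𝓡 n) x₀).map_source hx)).and ?_
  have h1 : ContinuousAt (extChartAt (𝓡 n) x₀).symm (extChartAt (𝓡 n) x₀ x) :=
    continuousAt_extChartAt_symm' hx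
  refine h1.eventually ?_
  rwa [(extChartAt (𝓡 n) x₀).left_inv hx]

theorem baseDeriv_eq {L : Lagrangian n N E M} (hL : SmoothLagrangian L) (x : N) (q : M)
    (j : 𝔼 →L[ℝ] E) (u : E) :
    (baseDeriv L x q j u : ℝ) = fderiv ℝ (coordLag L x q)
      ((extChartAt (𝓡 n) x x, extChartAt 𝓘(ℝ, E) q q), j) ((0, u), 0) := by
  have h0 : (baseDeriv L x q j u : ℝ) = deriv (fun ε : ℝ => lagVal L x
      ((extChartAt 𝓘(ℝ, E) q).symm (extChartAt 𝓘(ℝ, E) q q + ε • fwd (E := E) q q u))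
      ((bwd (E := E) q (extChartAt 𝓘(ℝ, E) q q + ε • fwd (E := E) q q u)) ∘L
        (fwd (E := E) q q) ∘L j)) 0 := rfl
  rw [h0]
  have h1 : ∀ ε : ℝ, lagVal L x
      ((extChartAt 𝓘(ℝ, E) q).symm (extChartAt 𝓘(ℝ, E) q q + ε • fwd (E := E) q q u))
      ((bwd (E := E) q (extChartAt 𝓘(ℝ, E) q q + ε • fwd (E := E) q q u)) ∘L
        (fwd (E := E) q q) ∘L j) =
      coordLag L x q (((extChartAt (𝓡 n) x x, extChartAt 𝓘(ℝ, E) q q), j) +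
        ε • ((0, u), 0)) := by
    intro ε
    simp only [coordLag, Prod.smul_mk, smul_zero, Prod.mk_add_mk, add_zero]
    rw [extChartAt_to_inv, fwd_self, fwd_self, ContinuousLinearMap.comp_id,
      ContinuousLinearMap.id_comp, ContinuousLinearMap.id_apply]
  simp_rw [h1]
  have hΛ := ((hL.contDiffAt (p := ((extChartAt (𝓡 n) x x, extChartAt 𝓘(ℝ, E) q q), j))
    (mem_extChartAt_target (I := 𝓡 n) x)
    (mem_extChartAt_target (I := 𝓘(ℝ, E)) q)).differentiableAt (by simp)).hasFDerivAt
  have hl : HasDerivAt (fun ε : ℝ => (((extChartAt (𝓡 n) x x, extChartAt 𝓘(ℝ, E) q q), j) +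
      ε • ((0, u), 0) : (𝔼 × E) × (𝔼 →L[ℝ] E))) ((0, u), 0) 0 := by
    simpa using ((hasDerivAt_id (0 : ℝ)).smul_const
      (((0, u), 0) : (𝔼 × E) × (𝔼 →L[ℝ] E))).const_add
        ((extChartAt (𝓡 n) x x, extChartAt 𝓘(ℝ, E) q q), j)
  exact (HasFDerivAt.comp_hasDerivAt (0 : ℝ) (by simpa using hΛ) hl).deriv

/-- The expression in charts of the vector field `∂L/∂j¹s (c)`. -/
theorem coordVF_fiberVal {L : Lagrangian n N E M} (hL : SmoothLagrangian L) {S : ℝ → N → M}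
    {x₀ x : N} {q₀ : M} (hS : SmoothFamilyNear (n := n) (E := E) S 0 x)
    (hx : x ∈ (extChartAt (𝓡 n) x₀).source) (hq : S 0 x ∈ (extChartAt 𝓘(ℝ, E) q₀).source)
    (c : N → E) :
    ∀ᶠ y in 𝓝 (extChartAt (𝓡 n) x₀ x), ∀ i,
      coordVF (fun x' => fiberVal L x' (S 0 x') (tmap (E := 𝔼) (E' := E) (S 0) x') (c x')) x₀ y i =
      fderiv ℝ (coordLag L x₀ q₀) (jetCoord (coordFam (n := n) (E := E) S x₀ q₀) (0, y))
        (0, dualTensor i (fwd (E := E) q₀ (S 0 ((extChartAt (𝓡 n) x₀).symm y))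
          (c ((extChartAt (𝓡 n) x₀).symm y)))) := by
  have hc := (ContMDiffAt.continuousAt_slice hS.self_of_nhds).eventually
    ((isOpen_extChartAt_source q₀).mem_nhds hq)
  filter_upwards [eventually_chart_symm hx (hS.eventually_slice.and hc)] with y hy i
  have h := fwd_fiberVal_family hL hy.2.1 ((extChartAt (𝓡 n) x₀).map_target hy.1) hy.2.2
    (c ((extChartAt (𝓡 n) x₀).symm y)) i
  rw [(extChartAt (𝓡 n) x₀).right_inv hy.1] at h
  exact h

theorem coordVF_momentumField {L : Lagrangian n N E M} (hL : SmoothLagrangian L) {S : ℝ → N → M}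
    {x₀ x : N} {q₀ : M} (hS : SmoothFamilyNear (n := n) (E := E) S 0 x)
    (hx : x ∈ (extChartAt (𝓡 n) x₀).source) (hq : S 0 x ∈ (extChartAt 𝓘(ℝ, E) q₀).source) :
    ∀ᶠ y in 𝓝 (extChartAt (𝓡 n) x₀ x), ∀ i, coordVF (momentumField L S) x₀ y i =
      fderiv ℝ (coordLag L x₀ q₀) (jetCoord (coordFam (n := n) (E := E) S x₀ q₀) (0, y))
        (0, dualTensor i (fderiv ℝ (coordFam (n := n) (E := E) S x₀ q₀) (0, y) (1, 0))) := by
  have hc := (ContMDiffAt.continuousAt_slice hS.self_of_nhds).eventually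
    ((isOpen_extChartAt_source q₀).mem_nhds hq)
  filter_upwards [coordVF_fiberVal hL hS hx hq (variation (E := E) S),
    eventually_chart_symm hx (hS.eventually_slice.and hc)] with y hy hy' i
  have h := fwd_variation (E := E) hy'.2.1 ((extChartAt (𝓡 n) x₀).map_target hy'.1) hy'.2.2
  rw [(extChartAt (𝓡 n) x₀).right_inv hy'.1] at h
  rw [← h]
  exact hy i

/-- The first variation formula: `d/dε L(j¹S_ε) = ⟨EL(L)(j²s), δs⟩ + div (∂L/∂j¹s (δs))`. -/
theorem hasDerivAt_lagVal (v : VolumeForm n N) {L : Lagrangian n N E M} (hL : SmoothLagrangian L)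
    {S : ℝ → N → M} {x : N} (hS : SmoothFamilyNear (n := n) (E := E) S 0 x) :
    HasDerivAt (fun ε => lagVal L x (S ε x) (tmap (E := 𝔼) (E' := E) (S ε) x))
      (elVal v L (S 0) x (variation (E := E) S x) + divVal v (momentumField L S) x) 0 := by
  have hxs := mem_extChartAt_source (I := 𝓡 n) x
  have hqs := mem_extChartAt_source (I := 𝓘(ℝ, E)) (S 0 x)
  have hS0 := hS.self_of_nhds
  set y₀ := extChartAt (𝓡 n) x x with hy₀
  set σ := coordFam (n := n) (E := E) S x (S 0 x) with hσ
  set Λ := coordLag L x (S 0 x) with hΛ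
  have hcoord := hasDerivAt_lagrangian_coord (Λ := Λ) (σ := σ) (ρ := density v x) (y₀ := y₀)
    (hL.contDiffAt (mem_extChartAt_target (I := 𝓡 n) x)
      (by
        simp only [jetCoord, hσ, coordFam, hy₀, extChartAt_to_inv]
        exact mem_extChartAt_target (I := 𝓘(ℝ, E)) (S 0 x)))
    (contDiffAt_coordFam hS0 hxs hqs)
    ((contDiffAt_density v (mem_extChartAt_target (I := 𝓡 n) x)).differentiableAt (by simp))
    (density_ne_zero v (mem_extChartAt_target (I := 𝓡 n) x))
  have hvar : variation (E := E) S x = fderiv ℝ σ (0, y₀) (1, 0) := by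
    rw [← fwd_variation (E := E) hS0 hxs hqs, fwd_self]
    rfl
  have hjet : jetCoord σ (0, y₀) =
      ((y₀, extChartAt 𝓘(ℝ, E) (S 0 x) (S 0 x)), tmap (E := 𝔼) (E' := E) (S 0) x) := by
    rw [jetCoord_coordFam hS0 hxs hqs, fwd_self, ← hy₀, bwd_self]
    rfl
  have hbase : (baseDeriv L x (S 0 x) (tmap (E := 𝔼) (E' := E) (S 0) x)
      (variation (E := E) S x) : ℝ) =
      fderiv ℝ Λ (jetCoord σ (0, y₀)) ((0, fderiv ℝ σ (0, y₀) (1, 0)), 0) := by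
    refine (baseDeriv_eq hL x (S 0 x) (tmap (E := 𝔼) (E' := E) (S 0) x)
      (variation (E := E) S x)).trans ?_
    rw [hjet, hvar]
  -- The field of constant components is a `bwd`, which `fwd` undoes along `S 0`. What remains is
  -- the variation frozen at `y₀`, so this is the divergence occurring in the Euler–Lagrange form.
  have hdiv1 : divVal v (fun x' => fiberVal L x' (S 0 x') (tmap (E := 𝔼) (E' := E) (S 0) x')
      (bwd (E := E) (S 0 x) (extChartAt 𝓘(ℝ, E) (S 0 x) (S 0 x'))
        (fwd (E := E) (S 0 x) (S 0 x) (variation (E := E) S x)))) x =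
      (∑ i : Fin n, fderiv ℝ (fun y => density v x y * fderiv ℝ Λ (jetCoord σ (0, y))
          (0, dualTensor i (fderiv ℝ σ (0, y₀) (1, 0)))) y₀ (stdVec i)) / density v x y₀ := by
    rw [divVal_eq, divCoord]
    congr 1
    refine Finset.sum_congr rfl fun i _ => ?_
    congr 1
    refine Filter.EventuallyEq.fderiv_eq ?_
    have hc := (ContMDiffAt.continuousAt_slice hS0).eventually
      ((isOpen_extChartAt_source (S 0 x)).mem_nhds hqs)
    filter_upwards [coordVF_fiberVal hL hS hxs hqs (fun x' =>
      (bwd (E := E) (S 0 x) (extChartAt 𝓘(ℝ, E) (S 0 x) (S 0 x'))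
        (fwd (E := E) (S 0 x) (S 0 x) (variation (E := E) S x)))),
      eventually_chart_symm hxs hc] with y hy hy'
    rw [hy i, fwd_bwd hy'.2, fwd_self, ContinuousLinearMap.id_apply, hvar]
  have hdiv2 : divVal v (momentumField L S) x =
      (∑ i : Fin n, fderiv ℝ (fun y => density v x y * fderiv ℝ Λ (jetCoord σ (0, y))
          (0, dualTensor i (fderiv ℝ σ (0, y) (1, 0)))) y₀ (stdVec i)) / density v x y₀ := by
    rw [divVal_eq, divCoord]
    congr 1
    refine Finset.sum_congr rfl fun i _ => ?_
    congr 1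
    refine Filter.EventuallyEq.fderiv_eq ?_
    filter_upwards [coordVF_momentumField hL hS hxs hqs] with y hy
    rw [hy i]
  rw [← hbase, ← hdiv1, ← hdiv2] at hcoord
  refine HasDerivAt.congr_of_eventuallyEq hcoord ?_
  have hev : ∀ᶠ ε in 𝓝 (0 : ℝ), ContMDiffAt (𝓘(ℝ, ℝ).prod (𝓡 n)) 𝓘(ℝ, E) ∞
      (fun p : ℝ × N => S p.1 p.2) (ε, x) ∧ S ε x ∈ (extChartAt 𝓘(ℝ, E) (S 0 x)).source := by
    have h1 : ContinuousAt (fun ε : ℝ => (ε, x)) 0 := (Continuous.prodMk_left x).continuousAt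
    refine (h1.eventually hS).and ?_
    have h2 : ContinuousAt (fun ε : ℝ => S ε x) 0 :=
      ContinuousAt.comp (f := fun ε : ℝ => (ε, x)) hS0.continuousAt h1
    exact h2.eventually ((isOpen_extChartAt_source (S 0 x)).mem_nhds hqs)
  filter_upwards [hev] with ε hε
  exact lagVal_family L hε.1 hxs hε.2

end FirstVariation

/-! ### Divergences under changes of coordinates -/

section Piola

variable {n : ℕ}

local notation "𝔼" => EuclideanSpace ℝ (Fin n)

/-- By the Leibniz formula the determinant is a polynomial in the matrix entries. -/
theorem differentiable_det :
    Differentiable ℝ (fun T : 𝔼 →L[ℝ] 𝔼 => LinearMap.det (T : 𝔼 →ₗ[ℝ] 𝔼)) := by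
  have h : ∀ T : 𝔼 →L[ℝ] 𝔼, LinearMap.det (T : 𝔼 →ₗ[ℝ] 𝔼) =
      ∑ σ : Equiv.Perm (Fin n), (Equiv.Perm.sign σ : ℝ) * ∏ i, (T (stdVec i)) (σ i) := by
    intro T
    rw [← LinearMap.det_toMatrix (EuclideanSpace.basisFun (Fin n) ℝ).toBasis, Matrix.det_apply']
    simp [LinearMap.toMatrix_apply]
  simp_rw [h]
  have h2 : ∀ i j : Fin n, Differentiable ℝ (fun T : 𝔼 →L[ℝ] 𝔼 => (T (stdVec i)) j) := fun i j =>
    ((EuclideanSpace.proj j : 𝔼 →L[ℝ] ℝ) ∘L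
      (ContinuousLinearMap.apply ℝ 𝔼 (stdVec i))).differentiable
  fun_prop

/-- From the expansion `det (1 + t H) = 1 + t tr H + t² p(t)` with `p` a polynomial. -/
theorem hasDerivAt_det_one_add (H : 𝔼 →L[ℝ] 𝔼) :
    HasDerivAt (fun t : ℝ => LinearMap.det ((1 + t • H : 𝔼 →L[ℝ] 𝔼) : 𝔼 →ₗ[ℝ] 𝔼))
      (LinearMap.trace ℝ 𝔼 (H : 𝔼 →ₗ[ℝ] 𝔼)) 0 := by
  set b := (EuclideanSpace.basisFun (Fin n) ℝ).toBasis
  have h : ∀ t : ℝ, LinearMap.det ((1 + t • H : 𝔼 →L[ℝ] 𝔼) : 𝔼 →ₗ[ℝ] 𝔼) =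
      (1 + t • LinearMap.toMatrix b b (H : 𝔼 →ₗ[ℝ] 𝔼)).det := by
    intro t
    rw [← LinearMap.det_toMatrix b]
    congr 1
    rw [ContinuousLinearMap.toLinearMap_add, ContinuousLinearMap.toLinearMap_smul, map_add,
      map_smul]
    congr 1
    exact LinearMap.toMatrix_one b
  simp_rw [h]
  rw [funext fun t => Matrix.det_one_add_smul t (LinearMap.toMatrix b b (H : 𝔼 →ₗ[ℝ] 𝔼))]
  rw [LinearMap.trace_eq_matrix_trace ℝ b]
  have h1 := ((hasDerivAt_id (0 : ℝ)).const_mul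
    (Matrix.trace (LinearMap.toMatrix b b (H : 𝔼 →ₗ[ℝ] 𝔼)))).const_add 1
  have h2 := fun p : Polynomial ℝ => (p.hasDerivAt 0).mul (hasDerivAt_pow 2 (0 : ℝ))
  exact (h1.add (h2 _)).congr_deriv (by simp)

/-- Jacobi's formula, reduced to the identity matrix by the factorisation `A + t H = A (1 + t B H)`.
-/
theorem fderiv_det_apply {A B : 𝔼 →L[ℝ] 𝔼} (hAB : A ∘L B = ContinuousLinearMap.id ℝ 𝔼)
    (H : 𝔼 →L[ℝ] 𝔼) :
    fderiv ℝ (fun T : 𝔼 →L[ℝ] 𝔼 => LinearMap.det (T : 𝔼 →ₗ[ℝ] 𝔼)) A H =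
      LinearMap.det (A : 𝔼 →ₗ[ℝ] 𝔼) * LinearMap.trace ℝ 𝔼 ((B ∘L H : 𝔼 →L[ℝ] 𝔼) : 𝔼 →ₗ[ℝ] 𝔼) := by
  have hl : HasDerivAt (fun t : ℝ => A + t • H) H 0 := by
    simpa using ((hasDerivAt_id (0 : ℝ)).smul_const H).const_add A
  have hf : HasFDerivAt (fun T : 𝔼 →L[ℝ] 𝔼 => LinearMap.det (T : 𝔼 →ₗ[ℝ] 𝔼))
      (fderiv ℝ (fun T : 𝔼 →L[ℝ] 𝔼 => LinearMap.det (T : 𝔼 →ₗ[ℝ] 𝔼)) A) (A + (0 : ℝ) • H) := by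
    have e : A + (0 : ℝ) • H = A := (congrArg (A + ·) (zero_smul ℝ H)).trans (add_zero A)
    rw [e]
    exact (differentiable_det A).hasFDerivAt
  have h1 : HasDerivAt (fun t : ℝ => LinearMap.det ((A + t • H : 𝔼 →L[ℝ] 𝔼) : 𝔼 →ₗ[ℝ] 𝔼))
      (fderiv ℝ (fun T : 𝔼 →L[ℝ] 𝔼 => LinearMap.det (T : 𝔼 →ₗ[ℝ] 𝔼)) A H) 0 :=
    HasFDerivAt.comp_hasDerivAt (f := fun t : ℝ => A + t • H) (0 : ℝ) hf hl
  have h2 := (hasDerivAt_det_one_add (B ∘L H)).const_mul (LinearMap.det (A : 𝔼 →ₗ[ℝ] 𝔼))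
  refine h1.unique (h2.congr_of_eventuallyEq (Filter.Eventually.of_forall fun t => ?_))
  simp only
  rw [← LinearMap.det_comp, ← ContinuousLinearMap.toLinearMap_comp]
  congr 2
  ext1 w
  have h3 : A (B (H w)) = H w := DFunLike.congr_fun hAB (H w)
  simp [h3]

theorem sum_fderiv_coord {Y : 𝔼 → 𝔼} {y : 𝔼} (hY : DifferentiableAt ℝ Y y) :
    ∑ i : Fin n, fderiv ℝ (fun y' => Y y' i) y (stdVec i) =
      LinearMap.trace ℝ 𝔼 (fderiv ℝ Y y : 𝔼 →ₗ[ℝ] 𝔼) := by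
  rw [LinearMap.trace_eq_matrix_trace ℝ (EuclideanSpace.basisFun (Fin n) ℝ).toBasis, Matrix.trace]
  refine Finset.sum_congr rfl fun i _ => ?_
  have h : HasFDerivAt (fun y' => Y y' i)
      ((EuclideanSpace.proj i : 𝔼 →L[ℝ] ℝ) ∘L (fderiv ℝ Y y)) y :=
    (EuclideanSpace.proj i : 𝔼 →L[ℝ] ℝ).hasFDerivAt.comp y hY.hasFDerivAt
  rw [h.fderiv]
  simp [LinearMap.toMatrix_apply, Matrix.diag]

/-- The Piola identity: if `Dτ (Y) = det (Dτ) Y₀ ∘ τ` then `div Y = det (Dτ) (div Y₀) ∘ τ`. -/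
theorem trace_fderiv_piola {τ Y Y₀ : 𝔼 → 𝔼} {y : 𝔼} {B : 𝔼 →L[ℝ] 𝔼} (hτ : ContDiffAt ℝ ∞ τ y)
    (hAB : (fderiv ℝ τ y) ∘L B = ContinuousLinearMap.id ℝ 𝔼)
    (hBA : B ∘L (fderiv ℝ τ y) = ContinuousLinearMap.id ℝ 𝔼)
    (hY : DifferentiableAt ℝ Y y) (hY₀ : DifferentiableAt ℝ Y₀ (τ y))
    (h : ∀ᶠ y' in 𝓝 y, LinearMap.det (fderiv ℝ τ y' : 𝔼 →ₗ[ℝ] 𝔼) • Y₀ (τ y') =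
      fderiv ℝ τ y' (Y y')) :
    LinearMap.trace ℝ 𝔼 (fderiv ℝ Y y : 𝔼 →ₗ[ℝ] 𝔼) =
      LinearMap.det (fderiv ℝ τ y : 𝔼 →ₗ[ℝ] 𝔼) *
        LinearMap.trace ℝ 𝔼 (fderiv ℝ Y₀ (τ y) : 𝔼 →ₗ[ℝ] 𝔼) := by
  set A := fderiv ℝ τ y with hA
  set D2 := fderiv ℝ (fderiv ℝ τ) y with hD2
  have hsymm : IsSymmSndFDerivAt ℝ τ y := hτ.isSymmSndFDerivAt (by simpa using ENat.LEInfty.out)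
  have hDτ : HasFDerivAt (fderiv ℝ τ) D2 y :=
    ((hτ.fderiv_right (m := ∞) (by simp)).differentiableAt (by simp)).hasFDerivAt
  have hτ' : HasFDerivAt τ A y := (hτ.differentiableAt (by simp)).hasFDerivAt
  have hdet : HasFDerivAt (fun y' => LinearMap.det (fderiv ℝ τ y' : 𝔼 →ₗ[ℝ] 𝔼))
      ((fderiv ℝ (fun T : 𝔼 →L[ℝ] 𝔼 => LinearMap.det (T : 𝔼 →ₗ[ℝ] 𝔼)) A) ∘L D2) y :=
    (differentiable_det A).hasFDerivAt.comp y hDτ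
  have hleft := hdet.smul (hY₀.hasFDerivAt.comp y hτ')
  have hright := hDτ.clm_apply hY.hasFDerivAt
  -- Differentiating `h` in two ways gives a relation between `DY`, `DY₀`, `D det` and `D²τ`.
  have heq := hleft.unique (hright.congr_of_eventuallyEq h)
  have hBA' : ∀ w, B (A w) = w := fun w => DFunLike.congr_fun hBA w
  set d := LinearMap.det (A : 𝔼 →ₗ[ℝ] 𝔼) with hd
  have hYy : d • B (Y₀ (τ y)) = Y y := by
    rw [← map_smul, h.self_of_nhds, hBA']
  -- The relation is solved for `DY` with `B`. Symmetry of `D²τ` puts `Y y` in its first slot, so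
  -- that the last term becomes `B` composed with a fixed endomorphism.
  have hpt : fderiv ℝ Y y = (d • (B ∘L (fderiv ℝ Y₀ (τ y)) ∘L A)) +
      ((fderiv ℝ (fun T : 𝔼 →L[ℝ] 𝔼 => LinearMap.det (T : 𝔼 →ₗ[ℝ] 𝔼)) A) ∘L D2).smulRight
        (B (Y₀ (τ y))) - (B ∘L (D2 (Y y))) := by
    ext1 w
    have h1 := congrArg B (DFunLike.congr_fun heq w)
    have h2 := hsymm.eq w (Y y)
    simp only [add_apply, smul_apply, ContinuousLinearMap.comp_apply,
      ContinuousLinearMap.smulRight_apply, map_add, map_smul, ContinuousLinearMap.flip_apply,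
      Function.comp_apply, sub_apply] at h1 ⊢
    rw [← hD2] at h2
    rw [← h2, h1, ← hA, hBA']
    abel
  have ht1 : LinearMap.trace ℝ 𝔼 ((B ∘L (fderiv ℝ Y₀ (τ y)) ∘L A : 𝔼 →L[ℝ] 𝔼) : 𝔼 →ₗ[ℝ] 𝔼) =
      LinearMap.trace ℝ 𝔼 (fderiv ℝ Y₀ (τ y) : 𝔼 →ₗ[ℝ] 𝔼) := by
    rw [ContinuousLinearMap.toLinearMap_comp, LinearMap.trace_comp_comm',
      ← ContinuousLinearMap.toLinearMap_comp, ContinuousLinearMap.comp_assoc, hAB,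
      ContinuousLinearMap.comp_id]
  have ht2 : ∀ (f : 𝔼 →L[ℝ] ℝ) (w : 𝔼),
      LinearMap.trace ℝ 𝔼 ((f.smulRight w : 𝔼 →L[ℝ] 𝔼) : 𝔼 →ₗ[ℝ] 𝔼) = f w := fun f w =>
    LinearMap.trace_smulRight (f : 𝔼 →ₗ[ℝ] ℝ) w
  rw [hpt, ContinuousLinearMap.toLinearMap_sub, ContinuousLinearMap.toLinearMap_add,
    ContinuousLinearMap.toLinearMap_smul, map_sub, map_add, map_smul, ht1, ht2,
    ContinuousLinearMap.comp_apply, fderiv_det_apply hAB, ← hd]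
  -- By Jacobi's formula the trace of the rank-one term is `d` times `tr (B ∘ D²τ(B Y₀))`. Since `d
  -- • B Y₀ = Y y`, it cancels the trace of the second-derivative term.
  have h5 : d * LinearMap.trace ℝ 𝔼 ((B ∘L D2 (B (Y₀ (τ y))) : 𝔼 →L[ℝ] 𝔼) : 𝔼 →ₗ[ℝ] 𝔼) =
      LinearMap.trace ℝ 𝔼 ((B ∘L D2 (Y y) : 𝔼 →L[ℝ] 𝔼) : 𝔼 →ₗ[ℝ] 𝔼) := by
    rw [← hYy, map_smul, ContinuousLinearMap.comp_smul, ContinuousLinearMap.toLinearMap_smul,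
      map_smul, smul_eq_mul]
  rw [h5, add_sub_cancel_right, smul_eq_mul]

end Piola

/-! ### The divergence in an arbitrary chart. -/

section DivergenceCharts

variable {n : ℕ} {N : Type*} [TopologicalSpace N] [ChartedSpace (EuclideanSpace ℝ (Fin n)) N]
  [IsManifold (𝓡 n) ∞ N]

local notation "𝔼" => EuclideanSpace ℝ (Fin n)

/-- The change of coordinates from the chart around `x₁` to the chart around `x₀`. -/
def transition (x₁ x₀ : N) (y : 𝔼) : 𝔼 :=
  extChartAt (𝓡 n) x₀ ((extChartAt (𝓡 n) x₁).symm y)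

theorem contDiffAt_transition {x₁ x₀ x : N} (h1 : x ∈ (extChartAt (𝓡 n) x₁).source)
    (h0 : x ∈ (extChartAt (𝓡 n) x₀).source) :
    ContDiffAt ℝ ∞ (transition (n := n) x₁ x₀) (extChartAt (𝓡 n) x₁ x) := by
  rw [← contMDiffAt_iff_contDiffAt]
  refine ContMDiffAt.comp (I' := 𝓡 n) (extChartAt (𝓡 n) x₁ x) ?_
    (contMDiffAt_chart_symm ((extChartAt (𝓡 n) x₁).map_source h1))
  rw [(extChartAt (𝓡 n) x₁).left_inv h1]
  exact contMDiffAt_chart h0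

theorem fderiv_transition {x₁ x₀ x : N} (h1 : x ∈ (extChartAt (𝓡 n) x₁).source)
    (h0 : x ∈ (extChartAt (𝓡 n) x₀).source) :
    fderiv ℝ (transition (n := n) x₁ x₀) (extChartAt (𝓡 n) x₁ x) =
      (fwd (E := 𝔼) x₀ x) ∘L (bwd (E := 𝔼) x₁ (extChartAt (𝓡 n) x₁ x)) := by
  have h := fwd_tmap_bwd (E := 𝔼) (E' := 𝔼) (f := (id : N → N)) (q₀ := x₀) (x₀ := x₁) (x := x)
    mdifferentiableAt_id h1 h0
  have hid : tmap (E := 𝔼) (E' := 𝔼) (id : N → N) x = ContinuousLinearMap.id ℝ 𝔼 := mfderiv_id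
  rw [hid, ContinuousLinearMap.id_comp] at h
  exact h.symm

/-- Both densities are the component of the form at `x` in the standard basis, times the determinant
of an inverse chart; the chain rule compares the two inverse charts. -/
theorem density_transition (v : VolumeForm n N) {x₁ x₀ x : N}
    (h1 : x ∈ (extChartAt (𝓡 n) x₁).source) (h0 : x ∈ (extChartAt (𝓡 n) x₀).source) :
    density v x₁ (extChartAt (𝓡 n) x₁ x) = density v x₀ (extChartAt (𝓡 n) x₀ x) *
      LinearMap.det (fderiv ℝ (transition (n := n) x₁ x₀) (extChartAt (𝓡 n) x₁ x) :
        𝔼 →ₗ[ℝ] 𝔼) := by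
  rw [density_eq, density_eq, (extChartAt (𝓡 n) x₁).left_inv h1,
    (extChartAt (𝓡 n) x₀).left_inv h0, mul_assoc, ← LinearMap.det_comp,
    ← ContinuousLinearMap.toLinearMap_comp, fderiv_transition h1 h0,
    ← ContinuousLinearMap.comp_assoc, bwd_comp_fwd h0, ContinuousLinearMap.id_comp]

/-- Smoothness of a vector field at `x`, in all charts around `x`. -/
def SmoothVFAt (X : N → 𝔼) (x : N) : Prop :=
  ∀ x₀ : N, x ∈ (extChartAt (𝓡 n) x₀).source →
    ContDiffAt ℝ ∞ (coordVF (n := n) X x₀) (extChartAt (𝓡 n) x₀ x)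

/-- The divergence can be computed in any chart. -/
theorem divVal_eq_divCoord (v : VolumeForm n N) {X : N → 𝔼} {x₀ x : N} (hX : SmoothVFAt X x)
    (h0 : x ∈ (extChartAt (𝓡 n) x₀).source) :
    divVal v X x = divCoord v X x₀ (extChartAt (𝓡 n) x₀ x) := by
  have h1 := mem_extChartAt_source (I := 𝓡 n) x
  have hρ : ∀ z : N, x ∈ (extChartAt (𝓡 n) z).source →
      DifferentiableAt ℝ (fun y => density v z y • coordVF (n := n) X z y)
        (extChartAt (𝓡 n) z x) := fun z hz =>
    ((contDiffAt_density v ((extChartAt (𝓡 n) z).map_source hz)).smul (hX z hz)).differentiableAt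
      (by simp)
  have hτx : transition (n := n) x x₀ (extChartAt (𝓡 n) x x) = extChartAt (𝓡 n) x₀ x := by
    rw [transition, extChartAt_to_inv]
  -- Hypothesis of the Piola identity for the fields density times `X`: the transition map
  -- transports the components of `X` by its derivative, and the densities differ by its
  -- determinant.
  have hev : ∀ᶠ y' in 𝓝 (extChartAt (𝓡 n) x x),
      LinearMap.det (fderiv ℝ (transition (n := n) x x₀) y' : 𝔼 →ₗ[ℝ] 𝔼) •
        (density v x₀ (transition x x₀ y') • coordVF (n := n) X x₀ (transition x x₀ y')) =
      fderiv ℝ (transition (n := n) x x₀) y' (density v x y' • coordVF (n := n) X x y') := by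
    filter_upwards [eventually_chart_symm h1 ((isOpen_extChartAt_source x₀).eventually_mem h0)]
      with y hy
    have hs := (extChartAt (𝓡 n) x).map_target hy.1
    have hd := density_transition v hs hy.2
    have hf := fderiv_transition hs hy.2
    rw [(extChartAt (𝓡 n) x).right_inv hy.1] at hd hf
    rw [map_smul, hd, smul_smul, mul_comm (LinearMap.det _)]
    congr 1
    rw [hf, ContinuousLinearMap.comp_apply]
    simp only [coordVF, transition]
    have := bwd_fwd hs (X ((extChartAt (𝓡 n) x).symm y))
    rw [(extChartAt (𝓡 n) x).right_inv hy.1] at this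
    rw [this, (extChartAt (𝓡 n) x₀).left_inv hy.2]
  have hp := trace_fderiv_piola (Y := fun y => density v x y • coordVF (n := n) X x y)
    (Y₀ := fun y => density v x₀ y • coordVF (n := n) X x₀ y)
    (B := (fwd (E := 𝔼) x x) ∘L (bwd (E := 𝔼) x₀ (extChartAt (𝓡 n) x₀ x)))
    (contDiffAt_transition h1 h0)
    (by
      rw [fderiv_transition h1 h0, bwd_self, fwd_self, ContinuousLinearMap.comp_id,
        ContinuousLinearMap.id_comp, fwd_comp_bwd h0])
    (by
      rw [fderiv_transition h1 h0, bwd_self, fwd_self, ContinuousLinearMap.comp_id,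
        ContinuousLinearMap.id_comp, bwd_comp_fwd h0])
    (hρ x h1) (by rw [hτx]; exact hρ x₀ h0) hev
  rw [← sum_fderiv_coord (hρ x h1), hτx, ← sum_fderiv_coord (hρ x₀ h0)] at hp
  rw [divVal_eq, divCoord, divCoord]
  have hd0 := density_ne_zero v ((extChartAt (𝓡 n) x₀).map_source h0)
  have hd1 := density_ne_zero v ((extChartAt (𝓡 n) x).map_source h1)
  rw [div_eq_div_iff hd1 hd0, density_transition v h1 h0]
  simp only [PiLp.smul_apply, smul_eq_mul] at hp
  rw [hp]
  ring

end DivergenceCharts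

/-! ### The measure of a volume form -/

section VolumeMeasure

variable {n : ℕ} {N : Type*} [TopologicalSpace N] [ChartedSpace (EuclideanSpace ℝ (Fin n)) N]
  [IsManifold (𝓡 n) ∞ N] [MeasurableSpace N] [BorelSpace N]

local notation "𝔼" => EuclideanSpace ℝ (Fin n)

theorem measurableSet_chart_source (x₀ : N) : MeasurableSet (extChartAt (𝓡 n) x₀).source :=
  (isOpen_extChartAt_source x₀).measurableSet

theorem measurableSet_chart_target (x₀ : N) : MeasurableSet (extChartAt (𝓡 n) x₀).target :=
  (isOpen_extChartAt_target x₀).measurableSet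

theorem continuousOn_density (v : VolumeForm n N) (x₀ : N) :
    ContinuousOn (density v x₀) (extChartAt (𝓡 n) x₀).target := fun _ hy =>
  (contDiffAt_density v hy).continuousAt.continuousWithinAt

theorem aemeasurable_density (v : VolumeForm n N) (x₀ : N) :
    AEMeasurable (fun y => ENNReal.ofReal |density v x₀ y|)
      (volume.restrict (extChartAt (𝓡 n) x₀).target) :=
  (((continuousOn_density v x₀).abs).aemeasurable (measurableSet_chart_target x₀)).ennreal_ofReal

theorem aemeasurable_chart_symm (x₀ : N) :
    AEMeasurable (extChartAt (𝓡 n) x₀).symm (volume.restrict (extChartAt (𝓡 n) x₀).target) :=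
  (continuousOn_extChartAt_symm x₀).aemeasurable (measurableSet_chart_target x₀)

/-- The inverse chart is known to be continuous only on its target, so measurability is obtained on
that subtype and carried back to the model space. -/
theorem measurableSet_chart_preimage (x₀ : N) {B : Set N} (hB : MeasurableSet B) :
    MeasurableSet ((extChartAt (𝓡 n) x₀).symm ⁻¹' B ∩ (extChartAt (𝓡 n) x₀).target) := by
  have h : Measurable ((extChartAt (𝓡 n) x₀).target.domRestrict (extChartAt (𝓡 n) x₀).symm) :=
    (continuousOn_extChartAt_symm x₀).domRestrict.measurable
  have h1 := (measurableSet_chart_target x₀).subtype_image (h hB)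
  convert h1 using 1
  ext y
  simp only [mem_inter_iff, mem_preimage, mem_image, Subtype.exists]
  constructor
  · rintro ⟨h1, h2⟩
    exact ⟨y, h2, h1, rfl⟩
  · rintro ⟨z, hz, h2, rfl⟩
    exact ⟨h2, hz⟩

theorem chartMeasure_apply (v : VolumeForm n N) (x₀ : N) {B : Set N} (hB : MeasurableSet B) :
    chartMeasure v x₀ B =
      ∫⁻ y in (extChartAt (𝓡 n) x₀).symm ⁻¹' B ∩ (extChartAt (𝓡 n) x₀).target,
        ENNReal.ofReal |density v x₀ y| := by
  rw [chartMeasure, Measure.map_apply_of_aemeasurable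
    ((aemeasurable_chart_symm x₀).mono_ac (withDensity_absolutelyContinuous _ _)) hB,
    withDensity_apply', Measure.restrict_restrict' (measurableSet_chart_target x₀)]
  rfl

theorem chartMeasure_inter_source (v : VolumeForm n N) (x₀ : N) {B : Set N}
    (hB : MeasurableSet B) :
    chartMeasure v x₀ (B ∩ (extChartAt (𝓡 n) x₀).source) = chartMeasure v x₀ B := by
  rw [chartMeasure_apply v x₀ hB,
    chartMeasure_apply v x₀ (hB.inter (measurableSet_chart_source x₀))]
  congr 2
  ext y
  simp only [mem_inter_iff, mem_preimage]
  exact ⟨fun h => ⟨h.1.1, h.2⟩, fun h => ⟨⟨h.1, (extChartAt (𝓡 n) x₀).map_target h.2⟩, h.2⟩⟩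

/-- Change of variables along the transition map: the absolute value of its Jacobian determinant is
the ratio of the absolute densities. -/
theorem chartMeasure_overlap (v : VolumeForm n N) {x₀ x₁ : N} {B : Set N} (hB : MeasurableSet B)
    (h0 : B ⊆ (extChartAt (𝓡 n) x₀).source) (h1 : B ⊆ (extChartAt (𝓡 n) x₁).source) :
    chartMeasure v x₁ B = chartMeasure v x₀ B := by
  rw [chartMeasure_apply v x₀ hB, chartMeasure_apply v x₁ hB]
  set s := (extChartAt (𝓡 n) x₁).symm ⁻¹' B ∩ (extChartAt (𝓡 n) x₁).target with hs
  have himg : (extChartAt (𝓡 n) x₀).symm ⁻¹' B ∩ (extChartAt (𝓡 n) x₀).target =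
      transition (n := n) x₁ x₀ '' s := by
    ext z
    constructor
    · rintro ⟨hz, hzt⟩
      have hx1 := h1 hz
      refine ⟨extChartAt (𝓡 n) x₁ ((extChartAt (𝓡 n) x₀).symm z), ⟨?_, ?_⟩, ?_⟩
      · simpa only [mem_preimage, (extChartAt (𝓡 n) x₁).left_inv hx1] using hz
      · exact (extChartAt (𝓡 n) x₁).map_source hx1
      · rw [transition, (extChartAt (𝓡 n) x₁).left_inv hx1, (extChartAt (𝓡 n) x₀).right_inv hzt]
    · rintro ⟨y, ⟨hy, hyt⟩, rfl⟩
      have hx0 := h0 hy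
      refine ⟨?_, (extChartAt (𝓡 n) x₀).map_source hx0⟩
      simpa only [mem_preimage, transition, (extChartAt (𝓡 n) x₀).left_inv hx0] using hy
  have hinj : InjOn (transition (n := n) x₁ x₀) s := by
    rintro y ⟨hy, hyt⟩ z ⟨hz, hzt⟩ hyz
    have := (extChartAt (𝓡 n) x₀).injOn (h0 hy) (h0 hz) hyz
    rw [← (extChartAt (𝓡 n) x₁).right_inv hyt, this, (extChartAt (𝓡 n) x₁).right_inv hzt]
  have hd : ∀ y ∈ s, HasFDerivWithinAt (transition (n := n) x₁ x₀)
      (fderiv ℝ (transition (n := n) x₁ x₀) y) s y := by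
    rintro y ⟨hy, hyt⟩
    have h := contDiffAt_transition (h1 hy) (h0 hy)
    rw [(extChartAt (𝓡 n) x₁).right_inv hyt] at h
    exact (h.differentiableAt (by simp)).hasFDerivAt.hasFDerivWithinAt
  have hsm : MeasurableSet s := measurableSet_chart_preimage x₁ hB
  rw [himg, lintegral_image_eq_lintegral_abs_det_fderiv_mul volume hsm hd hinj]
  refine setLIntegral_congr_fun hsm ?_
  rintro y ⟨hy, hyt⟩
  have h := density_transition v (h1 hy) (h0 hy)
  rw [(extChartAt (𝓡 n) x₁).right_inv hyt] at h
  simp only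
  rw [h, abs_mul, mul_comm, ENNReal.ofReal_mul (abs_nonneg _)]
  rfl

theorem chartMeasure_restrict_le (v : VolumeForm n N) (x₀ x : N) :
    (chartMeasure v x).restrict (extChartAt (𝓡 n) x₀).source ≤ chartMeasure v x₀ := by
  refine Measure.le_iff.2 fun B hB => ?_
  have hB0 := hB.inter (measurableSet_chart_source (n := n) x₀)
  rw [Measure.restrict_apply hB, ← chartMeasure_inter_source v x hB0,
    chartMeasure_overlap v (x₀ := x₀) (hB0.inter (measurableSet_chart_source x))
      (fun _ h => h.1.2) (fun _ h => h.2)]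
  exact measure_mono fun _ h => h.1.1

/-- A supremum of measures can exceed each of them. Here every chart measure is at most
`chartMeasure v x₀` inside the chart domain and at most `volMeasure v` outside it (`hub`), so the
supremum adds nothing inside the domain. -/
theorem volMeasure_restrict (v : VolumeForm n N) (x₀ : N) :
    (volMeasure v).restrict (extChartAt (𝓡 n) x₀).source = chartMeasure v x₀ := by
  have hm := measurableSet_chart_source (n := n) x₀
  have hle : ∀ x, chartMeasure v x ≤ volMeasure v := fun x => le_iSup (chartMeasure v) x
  have hub : volMeasure v ≤
      chartMeasure v x₀ + (volMeasure v).restrict (extChartAt (𝓡 n) x₀).sourceᶜ := by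
    refine iSup_le fun x => ?_
    rw [← Measure.restrict_add_restrict_compl (μ := chartMeasure v x) hm]
    exact add_le_add (chartMeasure_restrict_le v x₀ x) (Measure.restrict_mono subset_rfl (hle x))
  refine le_antisymm (Measure.le_iff.2 fun B hB => ?_) (Measure.le_iff.2 fun B hB => ?_)
  · rw [Measure.restrict_apply hB]
    refine (hub _).trans ?_
    rw [Measure.add_apply, Measure.restrict_apply (hB.inter hm)]
    have : B ∩ (extChartAt (𝓡 n) x₀).source ∩ (extChartAt (𝓡 n) x₀).sourceᶜ = ∅ := by
      ext x
      simp
    rw [this, measure_empty, add_zero]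
    exact measure_mono inter_subset_left
  · rw [Measure.restrict_apply hB, ← chartMeasure_inter_source v x₀ hB]
    exact hle x₀ _

theorem integral_volMeasure_eq (v : VolumeForm n N) (x₀ : N) {g : N → ℝ}
    (hg : AEStronglyMeasurable g (volMeasure v))
    (hs : ∀ x ∉ (extChartAt (𝓡 n) x₀).source, g x = 0) :
    ∫ x, g x ∂(volMeasure v) = ∫ y in (extChartAt (𝓡 n) x₀).target,
      |density v x₀ y| * g ((extChartAt (𝓡 n) x₀).symm y) := by
  rw [← setIntegral_eq_integral_of_forall_compl_eq_zero hs, volMeasure_restrict]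
  have hg' : AEStronglyMeasurable g (chartMeasure v x₀) := by
    rw [← volMeasure_restrict]
    exact hg.restrict
  rw [chartMeasure] at hg' ⊢
  rw [integral_map ((aemeasurable_chart_symm x₀).mono_ac (withDensity_absolutelyContinuous _ _))
    hg']
  refine (integral_withDensity_eq_integral_toReal_smul₀ (aemeasurable_density v x₀)
    (by simp) _).trans ?_
  simp [ENNReal.toReal_ofReal]

/-- A small closed ball around the coordinates of the point lies in the chart target, and the
continuous density is integrable on it. Local finiteness is what makes continuous functions
integrable on compact sets. -/
instance isLocallyFiniteMeasure_volMeasure (v : VolumeForm n N) :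
    IsLocallyFiniteMeasure (volMeasure v) := by
  refine ⟨fun x₀ => ?_⟩
  have ht := (isOpen_extChartAt_target (I := 𝓡 n) x₀).mem_nhds (mem_extChartAt_target x₀)
  obtain ⟨r, hr, hball⟩ := Metric.nhds_basis_closedBall.mem_iff.1 ht
  set C := Metric.closedBall (extChartAt (𝓡 n) x₀ x₀) r with hC
  have hCc : IsCompact C := isCompact_closedBall _ _
  set U := (extChartAt (𝓡 n) x₀).source ∩ extChartAt (𝓡 n) x₀ ⁻¹' (interior C) with hU
  have hUo : IsOpen U :=
    (continuousOn_extChartAt x₀).isOpen_inter_preimage (isOpen_extChartAt_source x₀)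
      isOpen_interior
  have hx₀U : x₀ ∈ U := by
    refine ⟨mem_extChartAt_source x₀, mem_interior_iff_mem_nhds.2 (Metric.closedBall_mem_nhds _ hr)⟩
  refine ⟨U, hUo.mem_nhds hx₀U, ?_⟩
  have h1 : volMeasure v U = chartMeasure v x₀ U := by
    rw [← volMeasure_restrict, Measure.restrict_apply hUo.measurableSet]
    congr 1
    exact (inter_eq_left.2 fun _ h => h.1).symm
  rw [h1, chartMeasure_apply v x₀ hUo.measurableSet]
  have hint : IntegrableOn (fun y => |density v x₀ y|) C :=
    ((continuousOn_density v x₀).abs.mono hball).integrableOn_compact hCc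
  refine (lintegral_mono_set (t := C) ?_).trans_lt (hint.lintegral_lt_top)
  rintro y ⟨hy, hyt⟩
  have := interior_subset hy.2
  rwa [(extChartAt (𝓡 n) x₀).right_inv hyt] at this

/-- The density vanishes nowhere, so a null open set would have a null nonempty open image under
Lebesgue measure. This lets integrals detect a nonnegative continuous function that is positive at
one point. -/
instance isOpenPosMeasure_volMeasure (v : VolumeForm n N) :
    (volMeasure v).IsOpenPosMeasure := by
  refine ⟨fun U hUo ⟨x, hx⟩ h0 => ?_⟩
  have h1 : chartMeasure v x U = 0 := le_antisymm
    ((le_iSup (chartMeasure v) x U).trans h0.le) bot_le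
  have hm := measurableSet_chart_preimage (n := n) x hUo.measurableSet
  rw [chartMeasure_apply v x hUo.measurableSet, setLIntegral_eq_zero_iff' hm
    ((aemeasurable_density v x).mono_measure (Measure.restrict_mono inter_subset_right le_rfl))]
    at h1
  have hopen : IsOpen ((extChartAt (𝓡 n) x).symm ⁻¹' U ∩ (extChartAt (𝓡 n) x).target) := by
    rw [inter_comm]
    exact (continuousOn_extChartAt_symm x).isOpen_inter_preimage (isOpen_extChartAt_target x) hUo
  have hne : ((extChartAt (𝓡 n) x).symm ⁻¹' U ∩ (extChartAt (𝓡 n) x).target).Nonempty :=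
    ⟨extChartAt (𝓡 n) x x, by simpa using hx, mem_extChartAt_target x⟩
  refine hopen.measure_ne_zero volume hne ?_
  refine measure_mono_null (fun y hy => ?_) h1
  simp only [mem_ofPred_eq, mem_compl_iff, not_forall]
  refine ⟨hy, ?_⟩
  simpa using density_ne_zero v hy.2

end VolumeMeasure

/-! ### The divergence theorem -/

section DivergenceTheorem

variable {n : ℕ} {N : Type*} [TopologicalSpace N] [ChartedSpace (EuclideanSpace ℝ (Fin n)) N]
  [IsManifold (𝓡 n) ∞ N]

local notation "𝔼" => EuclideanSpace ℝ (Fin n)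

theorem contDiffAt_divCoord (v : VolumeForm n N) {X : N → 𝔼} {x₀ : N} {y : 𝔼}
    (hy : y ∈ (extChartAt (𝓡 n) x₀).target) (hX : ContDiffAt ℝ ∞ (coordVF (n := n) X x₀) y) :
    ContDiffAt ℝ ∞ (divCoord v X x₀) y := by
  refine ContDiffAt.div (ContDiffAt.sum fun i _ => ?_) (contDiffAt_density v hy)
    (density_ne_zero v hy)
  have h1 : ContDiffAt ℝ ∞ (fun y' => density v x₀ y' * coordVF (n := n) X x₀ y' i) y :=
    (contDiffAt_density v hy).mul (contDiffAt_euclidean.1 hX i)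
  exact (h1.fderiv_right (m := ∞) (by simp)).clm_apply contDiffAt_const

/-- `divVal` uses a different chart at every point, so even continuity requires independence of the
chart: near `x` all values are computed in the chart around `x`. -/
theorem continuousAt_divVal (v : VolumeForm n N) {X : N → 𝔼} {x : N}
    (hX : ∀ᶠ x' in 𝓝 x, SmoothVFAt X x') : ContinuousAt (divVal v X) x := by
  have hxs := mem_extChartAt_source (I := 𝓡 n) x
  have h1 : ContinuousAt (fun x' => divCoord v X x (extChartAt (𝓡 n) x x')) x :=
    ContinuousAt.comp (f := extChartAt (𝓡 n) x) (g := divCoord v X x)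
      (contDiffAt_divCoord v (mem_extChartAt_target x)
        (hX.self_of_nhds x hxs)).continuousAt (continuousAt_extChartAt x)
  refine h1.congr ?_
  filter_upwards [hX, (isOpen_extChartAt_source (I := 𝓡 n) x).mem_nhds hxs] with x' h h'
  exact (divVal_eq_divCoord v h h').symm

/-- The divergence is a differential operator, hence local; its support is confined to that of the
field. -/
theorem divVal_eq_zero (v : VolumeForm n N) {X : N → 𝔼} {x : N} (hX : ∀ᶠ x' in 𝓝 x, X x' = 0) :
    divVal v X x = 0 := by
  rw [divVal_eq, divCoord]
  have h : ∀ i : Fin n, fderiv ℝ (fun y => density v x y * coordVF X x y i)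
      (extChartAt (𝓡 n) x x) = 0 := by
    intro i
    have h1 : (fun y => density v x y * coordVF X x y i) =ᶠ[𝓝 (extChartAt (𝓡 n) x x)]
        fun _ => 0 := by
      filter_upwards [eventually_chart_symm (mem_extChartAt_source (I := 𝓡 n) x) hX] with y hy
      simp only [coordVF]
      rw [hy.2, map_zero, PiLp.zero_apply, mul_zero]
    rw [h1.fderiv_eq, fderiv_fun_const]
    rfl
  simp only [h, zero_apply, Finset.sum_const_zero, zero_div]

theorem SmoothVFAt.smul {X : N → 𝔼} {x : N} (hX : SmoothVFAt X x) {f : N → ℝ}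
    (hf : ContMDiffAt (𝓡 n) 𝓘(ℝ, ℝ) ∞ f x) : SmoothVFAt (fun x' => f x' • X x') x := by
  intro x₀ hx
  have h1 : ContDiffAt ℝ ∞ (fun y => f ((extChartAt (𝓡 n) x₀).symm y)) (extChartAt (𝓡 n) x₀ x) := by
    rw [← contMDiffAt_iff_contDiffAt]
    refine ContMDiffAt.comp (I' := 𝓡 n) (extChartAt (𝓡 n) x₀ x) ?_
      (contMDiffAt_chart_symm ((extChartAt (𝓡 n) x₀).map_source hx))
    rwa [(extChartAt (𝓡 n) x₀).left_inv hx]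
  have h2 := h1.smul (hX x₀ hx)
  refine h2.congr_of_eventuallyEq (Filter.Eventually.of_forall fun y => ?_)
  simp [coordVF]

theorem divVal_sum (v : VolumeForm n N) {ι : Type*} (t : Finset ι) {X : ι → N → 𝔼} {x : N}
    (hX : ∀ k ∈ t, SmoothVFAt (X k) x) :
    divVal v (fun x' => ∑ k ∈ t, X k x') x = ∑ k ∈ t, divVal v (X k) x := by
  have hxs := mem_extChartAt_source (I := 𝓡 n) x
  simp only [divVal_eq, divCoord]
  rw [← Finset.sum_div, Finset.sum_comm]
  congr 1
  refine Finset.sum_congr rfl fun i _ => ?_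
  have h1 : (fun y => density v x y * coordVF (fun x' => ∑ k ∈ t, X k x') x y i) =
      fun y => ∑ k ∈ t, density v x y * coordVF (X k) x y i := by
    funext y
    rw [← Finset.mul_sum]
    simp [coordVF, map_sum]
  rw [h1, fderiv_fun_sum, sum_apply]
  intro k hk
  exact ((contDiffAt_density v (mem_extChartAt_target x)).mul
    (contDiffAt_euclidean.1 (hX k hk x hxs) i)).differentiableAt (by simp)

/-- Integration by parts against the constant function `1`. -/
theorem integral_fderiv_eq_zero {h : 𝔼 → ℝ} (hh : ContDiff ℝ ∞ h) (hc : HasCompactSupport h)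
    (w : 𝔼) : ∫ y, fderiv ℝ h y w = 0 := by
  have hcont : Continuous (fun y => fderiv ℝ h y w) :=
    (hh.continuous_fderiv (by simp)).clm_apply continuous_const
  have hint : Integrable (fun y => fderiv ℝ h y w) :=
    hcont.integrable_of_hasCompactSupport (hc.fderiv_apply ℝ w)
  have h1 := integral_mul_fderiv_eq_neg_fderiv_mul_of_integrable (μ := volume) (𝕜 := ℝ)
    (f := fun _ : 𝔼 => (1 : ℝ)) (g := h) (v := w) (by simp)
    (by simpa using hint) (by simpa using hh.continuous.integrable_of_hasCompactSupport hc)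
    (fun _ _ => differentiableAt_const _) (fun y _ => hh.differentiable (by simp) y)
  simpa using h1

variable [MeasurableSpace N] [BorelSpace N] [T2Space N]

/-- In a single chart the measure contributes `|ϱ|` and the divergence `1/ϱ`. Their quotient is a
locally constant sign, and a sum of partial derivatives of compactly supported functions is left. -/
theorem integral_divVal_chart (v : VolumeForm n N) {X : N → 𝔼} {x₀ : N}
    (hX : ∀ x, SmoothVFAt X x) {C : Set N} (hC : IsCompact C)
    (hCs : C ⊆ (extChartAt (𝓡 n) x₀).source) (hXC : ∀ x ∉ C, X x = 0) :
    ∫ x, divVal v X x ∂(volMeasure v) = 0 := by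
  classical
  have hdC : ∀ x ∉ C, divVal v X x = 0 := fun x hx =>
    divVal_eq_zero v (by filter_upwards [hC.isClosed.isOpen_compl.mem_nhds hx] with x' using hXC x')
  have hcont : Continuous (divVal v X) := continuous_iff_continuousAt.2 fun x =>
    continuousAt_divVal v (Filter.Eventually.of_forall hX)
  rw [integral_volMeasure_eq v x₀ hcont.aestronglyMeasurable fun x hx =>
    hdC x fun h => hx (hCs h)]
  set T := (extChartAt (𝓡 n) x₀).target with hT
  have hTo : IsOpen T := isOpen_extChartAt_target x₀
  set C' := extChartAt (𝓡 n) x₀ '' C with hC'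
  have hC'c : IsCompact C' := hC.image_of_continuousOn ((continuousOn_extChartAt x₀).mono hCs)
  have hXT : ∀ y ∈ T, ContDiffAt ℝ ∞ (coordVF (n := n) X x₀) y := by
    intro y hy
    have := hX _ x₀ ((extChartAt (𝓡 n) x₀).map_target hy)
    rwa [(extChartAt (𝓡 n) x₀).right_inv hy] at this
  -- Extension by zero beyond the chart target. It is smooth because the support lies in the compact
  -- image of `C`, and the absolute value does no harm because the density has no zeros in the
  -- target.
  set h : Fin n → 𝔼 → ℝ := fun i y =>
    if y ∈ T then |density v x₀ y| * coordVF X x₀ y i else 0 with hh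
  have h_zero : ∀ i, ∀ y ∉ C', h i y = 0 := by
    intro i y hy
    simp only [hh]
    split_ifs with hyT
    · have : (extChartAt (𝓡 n) x₀).symm y ∉ C := fun hc =>
        hy ⟨_, hc, (extChartAt (𝓡 n) x₀).right_inv hyT⟩
      simp only [coordVF]
      rw [hXC _ this, map_zero, PiLp.zero_apply, mul_zero]
    · rfl
  have h_loc : ∀ i, ∀ y ∈ T, h i =ᶠ[𝓝 y] fun y' => |density v x₀ y'| * coordVF X x₀ y' i := by
    intro i y hy
    filter_upwards [hTo.mem_nhds hy] with y' hy'
    simp [hh, hy']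
  have h_off : ∀ i, ∀ y ∉ T, h i =ᶠ[𝓝 y] fun _ => 0 := by
    intro i y hy
    have hyC : y ∉ C' := by
      rintro ⟨x, hx, rfl⟩
      exact hy ((extChartAt (𝓡 n) x₀).map_source (hCs hx))
    filter_upwards [hC'c.isClosed.isOpen_compl.mem_nhds hyC] with y' hy'
    exact h_zero i y' hy'
  have h_smooth : ∀ i, ContDiff ℝ ∞ (h i) := by
    intro i
    refine contDiff_iff_contDiffAt.2 fun y => ?_
    by_cases hy : y ∈ T
    · refine ContDiffAt.congr_of_eventuallyEq ?_ (h_loc i y hy)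
      exact ((contDiffAt_abs (density_ne_zero v hy)).comp y (contDiffAt_density v hy)).mul
        (contDiffAt_euclidean.1 (hXT y hy) i)
    · exact contDiffAt_const.congr_of_eventuallyEq (h_off i y hy)
  have h_supp : ∀ i, HasCompactSupport (h i) := fun i => HasCompactSupport.intro hC'c (h_zero i)
  have h_fd : ∀ i, ∀ y ∈ T, fderiv ℝ (h i) y (stdVec i) = |density v x₀ y| / density v x₀ y *
      fderiv ℝ (fun y => density v x₀ y * coordVF X x₀ y i) y (stdVec i) := by
    intro i y hy
    have hne := density_ne_zero v hy
    -- The density keeps its sign near `y`, so `|ϱ|/ϱ` can be frozen there before differentiating.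
    have hsgn : h i =ᶠ[𝓝 y] fun y' => (|density v x₀ y| / density v x₀ y) *
        (density v x₀ y' * coordVF X x₀ y' i) := by
      have hca := (contDiffAt_density v hy).continuousAt
      rcases lt_or_gt_of_ne hne with hlt | hgt
      · filter_upwards [h_loc i y hy, hca.eventually (gt_mem_nhds hlt)] with y' h1 h2
        rw [h1, abs_of_neg h2, abs_of_neg hlt, neg_div, div_self hne]
        ring
      · filter_upwards [h_loc i y hy, hca.eventually (lt_mem_nhds hgt)] with y' h1 h2
        rw [h1, abs_of_pos h2, abs_of_pos hgt, div_self hne]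
        ring
    rw [hsgn.fderiv_eq, fderiv_const_mul]
    · rfl
    · exact ((contDiffAt_density v hy).mul
        (contDiffAt_euclidean.1 (hXT y hy) i)).differentiableAt (by simp)
  have hint : ∀ y ∈ T, |density v x₀ y| * divVal v X ((extChartAt (𝓡 n) x₀).symm y) =
      ∑ i, fderiv ℝ (h i) y (stdVec i) := by
    intro y hy
    rw [divVal_eq_divCoord v (hX _) ((extChartAt (𝓡 n) x₀).map_target hy),
      (extChartAt (𝓡 n) x₀).right_inv hy, divCoord,
      Finset.sum_congr rfl fun i _ => h_fd i y hy, ← Finset.mul_sum]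
    ring
  rw [setIntegral_congr_fun hTo.measurableSet hint,
    setIntegral_eq_integral_of_forall_compl_eq_zero, integral_finsetSum]
  · exact Finset.sum_eq_zero fun i _ => integral_fderiv_eq_zero (h_smooth i) (h_supp i) _
  · intro i _
    exact (((h_smooth i).continuous_fderiv (by simp)).clm_apply
      continuous_const).integrable_of_hasCompactSupport ((h_supp i).fderiv_apply ℝ _)
  · intro y hy
    refine Finset.sum_eq_zero fun i _ => ?_
    rw [(h_off i y hy).fderiv_eq, fderiv_fun_const]
    rfl

variable [SecondCountableTopology N]

theorem continuous_divVal (v : VolumeForm n N) {X : N → 𝔼} (hX : ∀ x, SmoothVFAt X x) :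
    Continuous (divVal v X) :=
  continuous_iff_continuousAt.2 fun _ => continuousAt_divVal v (Filter.Eventually.of_forall hX)

/-- The divergence theorem for vector fields with compact support. -/
theorem integral_divVal_eq_zero (v : VolumeForm n N) {X : N → 𝔼} (hX : ∀ x, SmoothVFAt X x)
    {K : Set N} (hK : IsCompact K) (hXK : ∀ x ∉ K, X x = 0) :
    ∫ x, divVal v X x ∂(volMeasure v) = 0 := by
  classical
  have : LocallyCompactSpace N := ChartedSpace.locallyCompactSpace 𝔼 N
  -- A partition of unity on `K` subordinate to chart domains writes `X` as a sum of fields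
  -- supported in single charts. Only finitely many of its functions meet `K`, and off `K` both
  -- sides vanish.
  obtain ⟨f, hf⟩ := SmoothPartitionOfUnity.exists_isSubordinate_chartAt_source_of_isClosed
    (𝓡 n) hK.isClosed
  have hfin : {k | (Function.support (f k) ∩ K).Nonempty}.Finite :=
    f.locallyFinite.finite_nonempty_inter_compact hK
  set t := hfin.toFinset with ht
  have hsum : X = fun x => ∑ k ∈ t, f k x • X x := by
    funext x
    by_cases hx : x ∈ K
    · have h1 := f.sum_eq_one hx
      rw [finsum_eq_sum_of_support_subset (s := t)] at h1
      · rw [← Finset.sum_smul, h1, one_smul]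
      · intro k hk
        simp only [ht, Finite.coe_toFinset]
        exact ⟨x, hk, hx⟩
    · simp [hXK x hx]
  have hsm : ∀ k x, SmoothVFAt (fun x' => f k x' • X x') x := fun k x =>
    (hX x).smul ((f k).contMDiff x)
  have hzero : ∀ k, ∀ x ∉ tsupport (f k) ∩ K, f k x • X x = 0 := by
    intro k x hx
    by_cases hxK : x ∈ K
    · have : x ∉ tsupport (f k) := fun h => hx ⟨h, hxK⟩
      rw [image_eq_zero_of_notMem_tsupport this, zero_smul]
    · rw [hXK x hxK, smul_zero]
  have hcomp : ∀ k, IsCompact (tsupport (f k) ∩ K) := fun k =>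
    hK.inter_left (isClosed_tsupport _)
  have hdiv : divVal v X = fun x => ∑ k ∈ t, divVal v (fun x' => f k x' • X x') x := by
    funext x
    conv_lhs => rw [hsum]
    exact divVal_sum v t fun k _ => hsm k x
  rw [hdiv, integral_finsetSum]
  · refine Finset.sum_eq_zero fun k _ => ?_
    refine integral_divVal_chart v (x₀ := (k : N)) (hsm k) (hcomp k) ?_ (hzero k)
    rw [extChartAt_source]
    exact inter_subset_left.trans (hf k)
  · intro k _
    refine (continuous_divVal v (hsm k)).integrable_of_hasCompactSupport
      (HasCompactSupport.intro (hcomp k) fun x hx => divVal_eq_zero v ?_)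
    filter_upwards [(hcomp k).isClosed.isOpen_compl.mem_nhds hx] with x' hx'
    exact hzero k x' hx'

end DivergenceTheorem

/-! ### Linearity of the Euler–Lagrange form -/

section EulerLagrangeLinear

variable {n : ℕ} {N : Type*} [TopologicalSpace N] [ChartedSpace (EuclideanSpace ℝ (Fin n)) N]
  {E : Type*} [NormedAddCommGroup E] [NormedSpace ℝ E]
  {M : Type*} [TopologicalSpace M] [ChartedSpace E M]
  [IsManifold (𝓡 n) ∞ N] [IsManifold 𝓘(ℝ, E) ∞ M]

local notation "𝔼" => EuclideanSpace ℝ (Fin n)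

theorem smoothFamilyNear_const {s : N → M} (hs : ContMDiff (𝓡 n) 𝓘(ℝ, E) ∞ s) (x : N) :
    SmoothFamilyNear (n := n) (E := E) (fun _ : ℝ => s) 0 x :=
  Filter.Eventually.of_forall fun p => (hs.comp contMDiff_snd) p

/-- `deriv` and `divergence` are not formally linear in the vector. In charts, however, `u` enters
only through a constant argument fed to fields of linear forms that do not involve `u` and are
differentiable at the point. -/
theorem elVal_linear (v : VolumeForm n N) {L : Lagrangian n N E M} (hL : SmoothLagrangian L)
    {s : N → M} (hs : ContMDiff (𝓡 n) 𝓘(ℝ, E) ∞ s) (x : N) :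
    ∃ ℓ : E →ₗ[ℝ] ℝ, ∀ u, elVal v L s x u = ℓ u := by
  have hxs := mem_extChartAt_source (I := 𝓡 n) x
  have hqs := mem_extChartAt_source (I := 𝓘(ℝ, E)) (s x)
  have hS := smoothFamilyNear_const (E := E) hs x
  set S : ℝ → N → M := fun _ => s with hSdef
  set y₀ := extChartAt (𝓡 n) x x with hy₀
  set σ := coordFam (n := n) (E := E) S x (s x) with hσ
  set Λ := coordLag L x (s x) with hΛ
  have hσd : ContDiffAt ℝ ∞ σ (0, y₀) := contDiffAt_coordFam hS.self_of_nhds hxs hqs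
  have hΛd : ContDiffAt ℝ ∞ Λ (jetCoord σ (0, y₀)) :=
    hL.contDiffAt (mem_extChartAt_target (I := 𝓡 n) x) (by
      simp only [jetCoord, hσ, coordFam, hy₀, extChartAt_to_inv, hSdef]
      exact mem_extChartAt_target (I := 𝓘(ℝ, E)) (s x))
  set T : 𝔼 → ((𝔼 × E) × (𝔼 →L[ℝ] E)) →L[ℝ] ℝ :=
    fun y => density v x y • fderiv ℝ Λ (jetCoord σ (0, y)) with hT
  have hTd : DifferentiableAt ℝ T y₀ := by
    have hρ : DifferentiableAt ℝ (density v x) y₀ :=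
      (contDiffAt_density v (mem_extChartAt_target (I := 𝓡 n) x)).differentiableAt (by simp)
    have hJ : ContDiffAt ℝ ∞ (fun y => jetCoord σ (0, y)) y₀ :=
      (contDiffAt_jetCoord hσd).comp y₀ (contDiffAt_const.prodMk contDiffAt_id)
    exact hρ.smul (((hΛd.fderiv_right (m := ∞) (by simp)).comp y₀ hJ).differentiableAt (by simp))
  refine ⟨((fderiv ℝ Λ ((y₀, extChartAt 𝓘(ℝ, E) (s x) (s x)), tmap (E := 𝔼) (E' := E) s x)) ∘L
    (ContinuousLinearMap.inl ℝ (𝔼 × E) (𝔼 →L[ℝ] E)) ∘L (ContinuousLinearMap.inr ℝ 𝔼 E) -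
    (density v x y₀)⁻¹ • ∑ i : Fin n, (fderiv ℝ T y₀ (stdVec i)) ∘L
      (ContinuousLinearMap.inr ℝ (𝔼 × E) (𝔼 →L[ℝ] E)) ∘L (dualTensor i) : E →L[ℝ] ℝ), fun u => ?_⟩
  have h1 : elVal v L s x u = baseDeriv L x (s x) (tmap (E := 𝔼) (E' := E) s x) u -
      divVal v (fun x' => fiberVal L x' (S 0 x') (tmap (E := 𝔼) (E' := E) (S 0) x')
        (bwd (E := E) (s x) (extChartAt 𝓘(ℝ, E) (s x) (S 0 x')) (fwd (E := E) (s x) (s x) u))) x :=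
    rfl
  have h2 : (baseDeriv L x (s x) (tmap (E := 𝔼) (E' := E) s x) u : ℝ) = fderiv ℝ Λ
      ((y₀, extChartAt 𝓘(ℝ, E) (s x) (s x)), tmap (E := 𝔼) (E' := E) s x) ((0, u), 0) :=
    baseDeriv_eq hL x (s x) (tmap (E := 𝔼) (E' := E) s x) u
  rw [h1, h2, divVal_eq, divCoord, ← hy₀]
  have h3 : ∀ i : Fin n, fderiv ℝ (fun y => density v x y * coordVF (fun x' => fiberVal L x' (S 0 x')
      (tmap (E := 𝔼) (E' := E) (S 0) x') (bwd (E := E) (s x) (extChartAt 𝓘(ℝ, E) (s x) (S 0 x'))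
        (fwd (E := E) (s x) (s x) u))) x y i) y₀ (stdVec i) =
      fderiv ℝ T y₀ (stdVec i) (0, dualTensor i u) := by
    intro i
    have h4 : (fun y => density v x y * coordVF (fun x' => fiberVal L x' (S 0 x')
      (tmap (E := 𝔼) (E' := E) (S 0) x') (bwd (E := E) (s x) (extChartAt 𝓘(ℝ, E) (s x) (S 0 x'))
        (fwd (E := E) (s x) (s x) u))) x y i) =ᶠ[𝓝 y₀] fun y => T y (0, dualTensor i u) := by
      have hc := (ContMDiffAt.continuousAt_slice hS.self_of_nhds).eventually
        ((isOpen_extChartAt_source (s x)).mem_nhds hqs)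
      filter_upwards [coordVF_fiberVal hL hS hxs hqs (fun x' =>
        (bwd (E := E) (s x) (extChartAt 𝓘(ℝ, E) (s x) (S 0 x'))
          (fwd (E := E) (s x) (s x) u))), eventually_chart_symm hxs hc] with y hy hy'
      rw [hy i, fwd_bwd hy'.2, fwd_self, ContinuousLinearMap.id_apply]
      rfl
    rw [h4.fderiv_eq, fderiv_clm_apply hTd (differentiableAt_const _)]
    simp
  rw [Finset.sum_congr rfl fun i _ => h3 i, div_eq_inv_mul]
  simp

theorem elVal_add (v : VolumeForm n N) {L : Lagrangian n N E M} (hL : SmoothLagrangian L)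
    {s : N → M} (hs : ContMDiff (𝓡 n) 𝓘(ℝ, E) ∞ s) (x : N) (u w : E) :
    elVal v L s x (u + w) = elVal v L s x u + elVal v L s x w := by
  obtain ⟨ℓ, hℓ⟩ := elVal_linear v hL hs x
  simp only [hℓ, map_add]

theorem elVal_smul (v : VolumeForm n N) {L : Lagrangian n N E M} (hL : SmoothLagrangian L)
    {s : N → M} (hs : ContMDiff (𝓡 n) 𝓘(ℝ, E) ∞ s) (x : N) (c : ℝ) (u : E) :
    elVal v L s x (c • u) = c * elVal v L s x u := by
  obtain ⟨ℓ, hℓ⟩ := elVal_linear v hL hs x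
  simp only [hℓ, map_smul, smul_eq_mul]

end EulerLagrangeLinear

/-! ### Lagrangians along smooth families of maps -/

section Families

variable {n : ℕ} {N : Type*} [TopologicalSpace N] [ChartedSpace (EuclideanSpace ℝ (Fin n)) N]
  {E : Type*} [NormedAddCommGroup E] [NormedSpace ℝ E]
  {M : Type*} [TopologicalSpace M] [ChartedSpace E M]
  [IsManifold (𝓡 n) ∞ N] [IsManifold 𝓘(ℝ, E) ∞ M]

local notation "𝔼" => EuclideanSpace ℝ (Fin n)

/-- The Lagrangian along a family of maps. -/
def lagFam (L : Lagrangian n N E M) (S : ℝ → N → M) (p : ℝ × N) : ℝ :=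
  lagVal L p.2 (S p.1 p.2) (tmap (E := 𝔼) (E' := E) (S p.1) p.2)

/-- The expression in charts of the Lagrangian along a family of maps. -/
def coordLagFam (L : Lagrangian n N E M) (S : ℝ → N → M) (x₀ : N) (q₀ : M) (p : ℝ × 𝔼) : ℝ :=
  coordLag L x₀ q₀ (jetCoord (coordFam (n := n) (E := E) S x₀ q₀) p)

theorem contDiffAt_coordLagFam {L : Lagrangian n N E M} (hL : SmoothLagrangian L)
    {S : ℝ → N → M}
    (hS : ContMDiff (𝓘(ℝ, ℝ).prod (𝓡 n)) 𝓘(ℝ, E) ∞ (fun p : ℝ × N => S p.1 p.2))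
    {x₀ : N} {q₀ : M} {ε : ℝ} {x : N}
    (hx : x ∈ (extChartAt (𝓡 n) x₀).source) (hq : S ε x ∈ (extChartAt 𝓘(ℝ, E) q₀).source) :
    ContDiffAt ℝ ∞ (coordLagFam L S x₀ q₀) (ε, extChartAt (𝓡 n) x₀ x) := by
  refine ContDiffAt.comp (ε, extChartAt (𝓡 n) x₀ x) (hL.contDiffAt ?_ ?_)
    (contDiffAt_jetCoord (contDiffAt_coordFam (hS _) hx hq))
  · rw [jetCoord_coordFam (hS _) hx hq]
    exact (extChartAt (𝓡 n) x₀).map_source hx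
  · rw [jetCoord_coordFam (hS _) hx hq]
    exact (extChartAt 𝓘(ℝ, E) q₀).map_source hq

theorem eventually_mem_charts {S : ℝ → N → M}
    (hS : ContMDiff (𝓘(ℝ, ℝ).prod (𝓡 n)) 𝓘(ℝ, E) ∞ (fun p : ℝ × N => S p.1 p.2)) (ε : ℝ) (x : N) :
    ∀ᶠ p : ℝ × N in 𝓝 (ε, x), p.2 ∈ (extChartAt (𝓡 n) x).source ∧
      S p.1 p.2 ∈ (extChartAt 𝓘(ℝ, E) (S ε x)).source :=
  (continuousAt_snd.eventually
    ((isOpen_extChartAt_source (I := 𝓡 n) x).mem_nhds (mem_extChartAt_source x))).and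
  ((hS (ε, x)).continuousAt.eventually
    ((isOpen_extChartAt_source (I := 𝓘(ℝ, E)) (S ε x)).mem_nhds (mem_extChartAt_source (S ε x))))

theorem continuousAt_chart_prod (ε : ℝ) (x : N) :
    ContinuousAt (fun p : ℝ × N => (p.1, extChartAt (𝓡 n) x p.2)) (ε, x) :=
  continuousAt_fst.prodMk
    (ContinuousAt.comp (f := Prod.snd) (x := (ε, x)) (continuousAt_extChartAt x) continuousAt_snd)

theorem continuous_lagFam {L : Lagrangian n N E M} (hL : SmoothLagrangian L) {S : ℝ → N → M}
    (hS : ContMDiff (𝓘(ℝ, ℝ).prod (𝓡 n)) 𝓘(ℝ, E) ∞ (fun p : ℝ × N => S p.1 p.2)) :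
    Continuous (lagFam L S) := by
  refine continuous_iff_continuousAt.2 fun ⟨ε, x⟩ => ?_
  have h1 := ContinuousAt.comp (f := fun p : ℝ × N => (p.1, extChartAt (𝓡 n) x p.2)) (x := (ε, x))
    (contDiffAt_coordLagFam hL hS (mem_extChartAt_source x)
      (mem_extChartAt_source (S ε x))).continuousAt (continuousAt_chart_prod ε x)
  refine h1.congr ?_
  filter_upwards [eventually_mem_charts hS ε x] with p hp
  exact (lagVal_family L (hS _) hp.1 hp.2).symm

theorem hasDerivAt_lagFam {L : Lagrangian n N E M} (hL : SmoothLagrangian L) {S : ℝ → N → M}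
    (hS : ContMDiff (𝓘(ℝ, ℝ).prod (𝓡 n)) 𝓘(ℝ, E) ∞ (fun p : ℝ × N => S p.1 p.2))
    {x₀ : N} {q₀ : M} {ε : ℝ} {x : N}
    (hx : x ∈ (extChartAt (𝓡 n) x₀).source) (hq : S ε x ∈ (extChartAt 𝓘(ℝ, E) q₀).source) :
    HasDerivAt (fun t => lagFam L S (t, x))
      (fderiv ℝ (coordLagFam L S x₀ q₀) (ε, extChartAt (𝓡 n) x₀ x) (1, 0)) ε := by
  have hline : HasDerivAt (fun t : ℝ => (t, extChartAt (𝓡 n) x₀ x)) ((1 : ℝ), (0 : 𝔼)) ε :=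
    (hasDerivAt_id ε).prodMk (hasDerivAt_const ε _)
  have h1 := ((contDiffAt_coordLagFam hL hS hx hq).differentiableAt
    (by simp)).hasFDerivAt.comp_hasDerivAt ε hline
  refine h1.congr_of_eventuallyEq ?_
  have h2 : ContinuousAt (fun t : ℝ => S t x) ε :=
    ContinuousAt.comp (f := fun t : ℝ => (t, x)) (hS (ε, x)).continuousAt
      (Continuous.prodMk_left x).continuousAt
  filter_upwards [h2.eventually ((isOpen_extChartAt_source (I := 𝓘(ℝ, E)) q₀).mem_nhds hq)]
    with t ht
  exact lagVal_family L (hS _) hx ht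

/-- Joint continuity in `(ε, x)` supplies the uniform bound on compact sets needed for
differentiation under the integral. -/
theorem continuous_deriv_lagFam {L : Lagrangian n N E M} (hL : SmoothLagrangian L) {S : ℝ → N → M}
    (hS : ContMDiff (𝓘(ℝ, ℝ).prod (𝓡 n)) 𝓘(ℝ, E) ∞ (fun p : ℝ × N => S p.1 p.2)) :
    Continuous (fun p : ℝ × N => deriv (fun t => lagFam L S (t, p.2)) p.1) := by
  refine continuous_iff_continuousAt.2 fun ⟨ε, x⟩ => ?_
  have h0 : ContinuousAt (fun p => fderiv ℝ (coordLagFam L S x (S ε x)) p (1, 0))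
      (ε, extChartAt (𝓡 n) x x) :=
    (((contDiffAt_coordLagFam hL hS (mem_extChartAt_source x)
      (mem_extChartAt_source (S ε x))).fderiv_right (m := ∞) (by simp)).clm_apply
        contDiffAt_const).continuousAt
  have h1 := ContinuousAt.comp (f := fun p : ℝ × N => (p.1, extChartAt (𝓡 n) x p.2)) (x := (ε, x))
    h0 (continuousAt_chart_prod ε x)
  refine h1.congr ?_
  filter_upwards [eventually_mem_charts hS ε x] with p hp
  exact (hasDerivAt_lagFam hL hS hp.1 hp.2).deriv.symm

theorem smoothVFAt_momentumField {L : Lagrangian n N E M} (hL : SmoothLagrangian L)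
    {S : ℝ → N → M}
    (hS : ContMDiff (𝓘(ℝ, ℝ).prod (𝓡 n)) 𝓘(ℝ, E) ∞ (fun p : ℝ × N => S p.1 p.2)) (x : N) :
    SmoothVFAt (momentumField L S) x := by
  intro x₀ hx
  have hq := mem_extChartAt_source (I := 𝓘(ℝ, E)) (S 0 x)
  refine contDiffAt_euclidean.2 fun i => ?_
  have hσ := contDiffAt_coordFam (hS (0, x)) hx hq
  have hin : ContDiffAt ℝ ∞ (fun y : 𝔼 => ((0 : ℝ), y)) (extChartAt (𝓡 n) x₀ x) :=
    contDiffAt_const.prodMk contDiffAt_id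
  have hΛ : ContDiffAt ℝ ∞ (coordLag L x₀ (S 0 x))
      (jetCoord (coordFam (n := n) (E := E) S x₀ (S 0 x)) (0, extChartAt (𝓡 n) x₀ x)) := by
    rw [jetCoord_coordFam (hS (0, x)) hx hq]
    exact hL.contDiffAt ((extChartAt (𝓡 n) x₀).map_source hx)
      ((extChartAt 𝓘(ℝ, E) (S 0 x)).map_source hq)
  have h1 := (hΛ.fderiv_right (m := ∞) (by simp)).comp (extChartAt (𝓡 n) x₀ x)
    ((contDiffAt_jetCoord hσ).comp (extChartAt (𝓡 n) x₀ x) hin)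
  have h2 : ContDiffAt ℝ ∞
      (fun y => fderiv ℝ (coordFam (n := n) (E := E) S x₀ (S 0 x)) (0, y) (1, 0))
      (extChartAt (𝓡 n) x₀ x) :=
    ((hσ.fderiv_right (m := ∞) (by simp)).comp (extChartAt (𝓡 n) x₀ x) hin).clm_apply
      contDiffAt_const
  have h3 : ContDiffAt ℝ ∞ (fun y => ((0, dualTensor i
      (fderiv ℝ (coordFam (n := n) (E := E) S x₀ (S 0 x)) (0, y) (1, 0))) :
        (𝔼 × E) × (𝔼 →L[ℝ] E))) (extChartAt (𝓡 n) x₀ x) :=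
    contDiffAt_const.prodMk
      ((dualTensor i : E →L[ℝ] (𝔼 →L[ℝ] E)).contDiff.contDiffAt.comp (extChartAt (𝓡 n) x₀ x) h2)
  refine (h1.clm_apply h3).congr_of_eventuallyEq ?_
  filter_upwards [coordVF_momentumField hL (Filter.Eventually.of_forall hS) hx hq] with y hy
  exact hy i

/-- The power of the force along a family of maps. -/
theorem continuous_forceVal {F : Force n N E M} (hF : SmoothForce F) {S : ℝ → N → M}
    (hS : ContMDiff (𝓘(ℝ, ℝ).prod (𝓡 n)) 𝓘(ℝ, E) ∞ (fun p : ℝ × N => S p.1 p.2)) :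
    Continuous (fun x => forceVal F x (S 0 x) (tmap (E := 𝔼) (E' := E) (S 0) x)
      (variation (E := E) S x)) := by
  refine continuous_iff_continuousAt.2 fun x => ?_
  have hx := mem_extChartAt_source (I := 𝓡 n) x
  have hq := mem_extChartAt_source (I := 𝓘(ℝ, E)) (S 0 x)
  have hσ := contDiffAt_coordFam (hS (0, x)) hx hq
  have hin : ContDiffAt ℝ ∞ (fun y : 𝔼 => ((0 : ℝ), y)) (extChartAt (𝓡 n) x x) :=
    contDiffAt_const.prodMk contDiffAt_id
  have hΦ : ContDiffAt ℝ ∞ (coordForce F x (S 0 x))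
      (jetCoord (coordFam (n := n) (E := E) S x (S 0 x)) (0, extChartAt (𝓡 n) x x)) := by
    rw [jetCoord_coordFam (hS (0, x)) hx hq]
    exact hF.contDiffAt ((extChartAt (𝓡 n) x).map_source hx)
      ((extChartAt 𝓘(ℝ, E) (S 0 x)).map_source hq)
  have h1 := hΦ.comp (extChartAt (𝓡 n) x x)
    ((contDiffAt_jetCoord hσ).comp (extChartAt (𝓡 n) x x) hin)
  have h2 : ContDiffAt ℝ ∞
      (fun y => fderiv ℝ (coordFam (n := n) (E := E) S x (S 0 x)) (0, y) (1, 0))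
      (extChartAt (𝓡 n) x x) :=
    ((hσ.fderiv_right (m := ∞) (by simp)).comp (extChartAt (𝓡 n) x x) hin).clm_apply
      contDiffAt_const
  have h3 := ContinuousAt.comp (f := extChartAt (𝓡 n) x) (x := x)
    (h1.clm_apply h2).continuousAt (continuousAt_extChartAt x)
  refine h3.congr ?_
  have hev := (Continuous.prodMk_right (0 : ℝ)).continuousAt.eventually
    (eventually_mem_charts hS 0 x)
  filter_upwards [hev] with x' hx'
  rw [forceVal_eq_coordForce F hx'.1 hx'.2, fwd_variation (hS _) hx'.1 hx'.2,
    ← jetCoord_coordFam (hS _) hx'.1 hx'.2]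
  rfl

end Families

/-! ### Critical maps and the Euler–Lagrange equations -/

section Critical

variable {n : ℕ} {N : Type*} [TopologicalSpace N] [ChartedSpace (EuclideanSpace ℝ (Fin n)) N]
  {E : Type*} [NormedAddCommGroup E] [NormedSpace ℝ E]
  {M : Type*} [TopologicalSpace M] [ChartedSpace E M]

local notation "𝔼" => EuclideanSpace ℝ (Fin n)

theorem variation_eq_zero {S : ℝ → N → M} {x : N} (h : ∀ ε, S ε x = S 0 x) :
    variation (E := E) S x = 0 := by
  have : (fun ε => S ε x) = fun _ => S 0 x := funext h
  rw [variation, this, tmap_const]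
  rfl

theorem fiberVal_zero (L : Lagrangian n N E M) (x : N) (q : M) (j : 𝔼 →L[ℝ] E) :
    fiberVal L x q j 0 = 0 := by
  rw [fiberVal_eq]
  simp

variable [IsManifold (𝓡 n) ∞ N] [IsManifold 𝓘(ℝ, E) ∞ M]

/-- The bump variations of `s` in the direction `u` around `x₀`. -/
theorem exists_bump_variation {s : N → M} (hs : ContMDiff (𝓡 n) 𝓘(ℝ, E) ∞ s) (x₀ : N) (u : E) :
    ∃ V ∈ 𝓝 x₀, (∀ x ∈ V, s x ∈ (extChartAt 𝓘(ℝ, E) (s x₀)).source) ∧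
      ∀ χ : N → ℝ, ContMDiff (𝓡 n) 𝓘(ℝ, ℝ) ∞ χ → (∀ x, 0 ≤ χ x) → (∀ x, χ x ≤ 1) →
      tsupport χ ⊆ V → ∃ S : ℝ → N → M,
        ContMDiff (𝓘(ℝ, ℝ).prod (𝓡 n)) 𝓘(ℝ, E) ∞ (fun p : ℝ × N => S p.1 p.2) ∧ S 0 = s ∧
        (∀ ε, ∀ x ∉ tsupport χ, S ε x = s x) ∧
        ∀ x, variation (E := E) S x =
          χ x • bwd (E := E) (s x₀) (extChartAt 𝓘(ℝ, E) (s x₀) (s x)) u := by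
  classical
  set φ := extChartAt 𝓘(ℝ, E) (s x₀) with hφ
  have hqs : s x₀ ∈ φ.source := mem_extChartAt_source (s x₀)
  have hsrc : IsOpen φ.source := isOpen_extChartAt_source (s x₀)
  have htgt : IsOpen φ.target := isOpen_extChartAt_target (s x₀)
  have hcont : ContinuousAt (fun p : ℝ × N => φ (s p.2) + p.1 • u) (0, x₀) := by
    have h1 : ContinuousAt (fun p : ℝ × N => φ (s p.2)) (0, x₀) :=
      ContinuousAt.comp (f := fun p : ℝ × N => s p.2) (x := ((0 : ℝ), x₀))
        (continuousAt_extChartAt (s x₀))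
        (ContinuousAt.comp (f := Prod.snd) (x := ((0 : ℝ), x₀)) hs.continuous.continuousAt
          continuousAt_snd)
    exact h1.add (continuousAt_fst.smul continuousAt_const)
  have hev : ∀ᶠ p : ℝ × N in 𝓝 (0, x₀), φ (s p.2) + p.1 • u ∈ φ.target := by
    refine hcont.eventually (htgt.mem_nhds ?_)
    simpa using φ.map_source hqs
  rw [nhds_prod_eq, Filter.eventually_prod_iff] at hev
  -- A product neighbourhood: for displacements of size at most `r` and base points in a fixed
  -- neighbourhood of `x₀`, the straight line in the direction `u` stays in the chart target.
  obtain ⟨pa, hpa, pb, hpb, hab⟩ := hev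
  obtain ⟨r, hr, hball⟩ := Metric.nhds_basis_closedBall.mem_iff.1 hpa
  refine ⟨{x | pb x} ∩ s ⁻¹' φ.source,
    Filter.inter_mem hpb (hs.continuous.continuousAt (hsrc.mem_nhds hqs)), fun x hx => hx.2, ?_⟩
  intro χ hχ hχ0 hχ1 hχV
  -- `IsCritical` tests families defined for every real `ε`. The function `r sin (ε / r)` has
  -- derivative `1` at `0` and stays in `[-r, r]`, so the displaced point never leaves the chart.
  set θ : ℝ → N → ℝ := fun ε x => r * Real.sin (ε / r) * χ x with hθ
  have hθr : ∀ ε x, pa (θ ε x) := by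
    intro ε x
    apply hball
    rw [Metric.mem_closedBall, Real.dist_eq, sub_zero, hθ]
    simp only
    rw [abs_mul, abs_mul, abs_of_pos hr, abs_of_nonneg (hχ0 x)]
    calc r * |Real.sin (ε / r)| * χ x ≤ r * 1 * 1 := by
          gcongr
          · exact hχ0 x
          · exact Real.abs_sin_le_one _
          · exact hχ1 x
      _ = r := by ring
  have hmem : ∀ ε x, s x ∈ φ.source → φ (s x) + θ ε x • u ∈ φ.target := by
    intro ε x hx
    by_cases hxs : x ∈ tsupport χ
    · exact hab (hθr ε x) (hχV hxs).1
    · have : θ ε x = 0 := by simp [hθ, image_eq_zero_of_notMem_tsupport hxs]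
      rw [this, zero_smul, add_zero]
      exact φ.map_source hx
  -- The two branches agree off `tsupport χ`, where `θ` vanishes; on `tsupport χ` the first branch
  -- applies, which makes the family globally smooth.
  set S : ℝ → N → M := fun ε x =>
    if s x ∈ φ.source then φ.symm (φ (s x) + θ ε x • u) else s x with hS
  have hS_off : ∀ ε, ∀ x, θ ε x = 0 → S ε x = s x := by
    intro ε x hx
    simp only [hS]
    split_ifs with h
    · rw [hx, zero_smul, add_zero, φ.left_inv h]
    · rfl
  have hχ_off : ∀ ε, ∀ x ∉ tsupport χ, θ ε x = 0 := by
    intro ε x hx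
    simp [hθ, image_eq_zero_of_notMem_tsupport hx]
  refine ⟨S, ?_, ?_, fun ε x hx => hS_off ε x (hχ_off ε x hx), ?_⟩
  · rintro ⟨ε, x⟩
    by_cases hx : x ∈ tsupport χ
    · have hxs : s x ∈ φ.source := (hχV hx).2
      have hloc : (fun p : ℝ × N => S p.1 p.2) =ᶠ[𝓝 (ε, x)]
          fun p => φ.symm (φ (s p.2) + θ p.1 p.2 • u) := by
        have h1 : ContinuousAt (fun p : ℝ × N => s p.2) (ε, x) :=
          (hs.continuous.comp continuous_snd).continuousAt
        filter_upwards [h1.eventually (hsrc.eventually_mem hxs)] with p hp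
        simp only [hS, if_pos hp]
      refine ContMDiffAt.congr_of_eventuallyEq ?_ hloc
      have hθs : ContMDiff (𝓘(ℝ, ℝ).prod (𝓡 n)) 𝓘(ℝ, ℝ) ∞ (fun p : ℝ × N => θ p.1 p.2) := by
        have h1 : ContDiff ℝ ∞ (fun ε : ℝ => r * Real.sin (ε / r)) :=
          contDiff_const.mul (Real.contDiff_sin.comp (contDiff_id.div_const r))
        exact (h1.contMDiff.comp contMDiff_fst).mul (hχ.comp contMDiff_snd)
      have h2 : ContMDiffAt (𝓘(ℝ, ℝ).prod (𝓡 n)) 𝓘(ℝ, E) ∞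
          (fun p : ℝ × N => φ (s p.2) + θ p.1 p.2 • u) (ε, x) := by
        refine ContMDiffAt.add ?_ ((hθs (ε, x)).smul contMDiffAt_const)
        exact ContMDiffAt.comp (I' := 𝓘(ℝ, E)) (ε, x) (contMDiffAt_chart hxs)
          ((hs.comp contMDiff_snd) (ε, x))
      exact ContMDiffAt.comp (I' := 𝓘(ℝ, E)) (ε, x)
        (contMDiffAt_chart_symm (hmem ε x hxs)) h2
    · have hloc : (fun p : ℝ × N => S p.1 p.2) =ᶠ[𝓝 (ε, x)] fun p => s p.2 := by
        have h1 : ∀ᶠ p : ℝ × N in 𝓝 (ε, x), p.2 ∉ tsupport χ :=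
          (continuousAt_snd (p := (ε, x))).eventually
            ((isClosed_tsupport χ).isOpen_compl.eventually_mem hx)
        filter_upwards [h1] with p hp
        exact hS_off _ _ (hχ_off _ _ hp)
      exact ((hs.comp contMDiff_snd) (ε, x)).congr_of_eventuallyEq hloc
  · funext x
    exact hS_off 0 x (by simp [hθ])
  · intro x
    by_cases hx : x ∈ tsupport χ
    · have hxs : s x ∈ φ.source := (hχV hx).2
      have hcurve : (fun ε => S ε x) = fun ε => φ.symm (φ (s x) + θ ε x • u) := by
        funext ε
        simp only [hS, if_pos hxs]
      have hder : HasDerivAt (fun ε => φ (s x) + θ ε x • u) (χ x • u) 0 := by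
        have h1 : HasDerivAt (fun ε : ℝ => r * Real.sin (ε / r) * χ x) (χ x) 0 := by
          have h2 := (((hasDerivAt_id (0 : ℝ)).div_const r).sin.const_mul r).mul_const (χ x)
          refine h2.congr_deriv ?_
          simp [hr.ne']
        exact (h1.smul_const u).const_add (φ (s x))
      have h0 : φ (s x) + θ 0 x • u = φ (s x) := by simp [hθ]
      rw [variation, hcurve, tmap_comp (E := ℝ) (E' := E) (E'' := E)
        (f := fun ε => φ (s x) + θ ε x • u)
        (mdifferentiableAt_chart_symm (hmem 0 x hxs)) hder.differentiableAt.mdifferentiableAt,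
        ContinuousLinearMap.comp_apply, tmap_eq_fderiv, fderiv_apply_one_eq_deriv, hder.deriv, h0,
        map_smul]
      rfl
    · rw [image_eq_zero_of_notMem_tsupport hx, zero_smul]
      refine variation_eq_zero fun ε => ?_
      rw [hS_off ε x (hχ_off ε x hx), hS_off 0 x (hχ_off 0 x hx)]

variable [MeasurableSpace N] [BorelSpace N] [T2Space N] [SecondCountableTopology N]

/-- The first variation of the action and of the work of the force. -/
theorem first_variation (v : VolumeForm n N) {L : Lagrangian n N E M} (hL : SmoothLagrangian L)
    {F : Force n N E M} (hF : SmoothForce F) {S : ℝ → N → M}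
    (hS : ContMDiff (𝓘(ℝ, ℝ).prod (𝓡 n)) 𝓘(ℝ, E) ∞ (fun p : ℝ × N => S p.1 p.2))
    {K : Set N} (hK : IsCompact K) (hSK : ∀ ε, ∀ x ∉ K, S ε x = S 0 x) :
    Continuous (fun x => elVal v L (S 0) x (variation (E := E) S x) +
      forceVal F x (S 0 x) (tmap (E := 𝔼) (E' := E) (S 0) x) (variation (E := E) S x)) ∧
    ∃ δ : ℝ, HasDerivAt (fun ε => ∫ x in K, lagFam L S (ε, x) ∂(volMeasure v)) δ 0 ∧
      δ + ∫ x in K, forceVal F x (S 0 x) (tmap (E := 𝔼) (E' := E) (S 0) x)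
        (variation (E := E) S x) ∂(volMeasure v) =
      ∫ x in K, (elVal v L (S 0) x (variation (E := E) S x) +
        forceVal F x (S 0 x) (tmap (E := 𝔼) (E' := E) (S 0) x) (variation (E := E) S x))
        ∂(volMeasure v) := by
  have hc := continuous_lagFam hL hS
  have hc' := continuous_deriv_lagFam hL hS
  have hd : ∀ ε x, HasDerivAt (fun t => lagFam L S (t, x))
      (deriv (fun t => lagFam L S (t, x)) ε) ε := fun ε x =>
    (hasDerivAt_lagFam hL hS (mem_extChartAt_source x)
      (mem_extChartAt_source (S ε x))).differentiableAt.hasDerivAt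
  have hvf := smoothVFAt_momentumField hL hS
  have hdivc := continuous_divVal v hvf
  have hFc := continuous_forceVal hF hS
  -- The first variation formula read backwards. It also yields continuity of the Euler–Lagrange
  -- form along a variation field, both terms on the right being continuous.
  have hel : ∀ x, elVal v L (S 0) x (variation (E := E) S x) =
      deriv (fun t => lagFam L S (t, x)) 0 - divVal v (momentumField L S) x := by
    intro x
    have h := (hasDerivAt_lagVal v hL (x := x) (Filter.Eventually.of_forall hS)).deriv
    exact eq_sub_of_add_eq h.symm
  have hc0 : Continuous (fun x => deriv (fun t => lagFam L S (t, x)) 0) :=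
    hc'.comp (Continuous.prodMk_right (0 : ℝ))
  refine ⟨by simp_rw [hel]; exact (hc0.sub hdivc).add hFc,
    ∫ x in K, deriv (fun t => lagFam L S (t, x)) 0 ∂(volMeasure v), ?_, ?_⟩
  -- A bound for the `ε`-derivative on the compact set `[-1, 1] × K` serves as the dominating
  -- constant, integrable because `K` has finite measure.
  · obtain ⟨C, hC⟩ := (isCompact_Icc (a := (-1 : ℝ)) (b := 1)).prod hK |>.exists_bound_of_continuousOn
      hc'.continuousOn
    refine (hasDerivAt_integral_of_dominated_loc_of_deriv_le (μ := (volMeasure v).restrict K)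
      (F := fun ε x => lagFam L S (ε, x))
      (F' := fun ε x => deriv (fun t => lagFam L S (t, x)) ε) (bound := fun _ => C)
      (s := Icc (-1 : ℝ) 1) (Icc_mem_nhds (by norm_num) (by norm_num)) ?_ ?_ ?_ ?_ ?_ ?_).2
    · exact Filter.Eventually.of_forall fun ε =>
        (hc.comp (Continuous.prodMk_right ε)).aestronglyMeasurable
    · exact (hc.comp (Continuous.prodMk_right (0 : ℝ))).continuousOn.integrableOn_compact hK
    · exact hc0.aestronglyMeasurable
    · filter_upwards [ae_restrict_mem hK.measurableSet] with x hx ε hε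
      exact hC (ε, x) ⟨hε, hx⟩
    · exact integrableOn_const hK.measure_lt_top.ne
    · exact Filter.Eventually.of_forall fun x ε _ => hd ε x
  -- Off `K` the family is constant in `ε`, so the variation and with it the momentum field vanish;
  -- the divergence theorem removes the boundary term.
  · have hdiv0 : ∫ x in K, divVal v (momentumField L S) x ∂(volMeasure v) = 0 := by
      have hz : ∀ x ∉ K, momentumField L S x = 0 := fun x hx => by
        rw [momentumField, variation_eq_zero fun ε => hSK ε x hx, fiberVal_zero]
      rw [setIntegral_eq_integral_of_forall_compl_eq_zero, integral_divVal_eq_zero v hvf hK hz]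
      intro x hx
      refine divVal_eq_zero v ?_
      filter_upwards [hK.isClosed.isOpen_compl.mem_nhds hx] with x' hx' using hz x' hx'
    have hi0 := hc0.continuousOn.integrableOn_compact (μ := volMeasure v) hK
    have hi1 := hdivc.continuousOn.integrableOn_compact (μ := volMeasure v) hK
    have hi2 := hFc.continuousOn.integrableOn_compact (μ := volMeasure v) hK
    simp_rw [hel]
    have hi3 : IntegrableOn (fun x => deriv (fun t => lagFam L S (t, x)) 0 -
        divVal v (momentumField L S) x) K (volMeasure v) := hi0.sub hi1
    rw [integral_add hi3 hi2, integral_sub hi0 hi1, hdiv0, sub_zero]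

/-- A map is critical if and only if it satisfies the Euler–Lagrange equations with forces. -/
theorem isCritical_iff (v : VolumeForm n N) {L : Lagrangian n N E M} (hL : SmoothLagrangian L)
    {F : Force n N E M} (hF : SmoothForce F) {s : N → M} (hs : ContMDiff (𝓡 n) 𝓘(ℝ, E) ∞ s) :
    IsCritical v L F s ↔ ∀ (x : N) (u : E),
      elVal v L s x u + forceVal F x (s x) (tmap (E := 𝔼) (E' := E) s x) u = 0 := by
  constructor
  · intro hcrit
    -- One inequality suffices: the left-hand side changes sign with `u`.
    have hle : ∀ (x₀ : N) (u : E),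
        elVal v L s x₀ u + forceVal F x₀ (s x₀) (tmap (E := 𝔼) (E' := E) s x₀) u ≤ 0 := by
      intro x₀ u
      by_contra! hpos
      -- Continuity of the pairing is available only along variation fields of families. A first
      -- bump variation therefore extends `u` to such a field, and `e` is its continuous pairing.
      obtain ⟨V, hV, -, hvar⟩ := exists_bump_variation (E := E) hs x₀ u
      obtain ⟨f, -, hfV⟩ := (SmoothBumpFunction.nhds_basis_tsupport (I := 𝓡 n) x₀).mem_iff.1 hV
      obtain ⟨S, hS, hS0, hSK, hSv⟩ := hvar f f.contMDiff (fun x => f.nonneg) (fun x => f.le_one) hfV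
      subst hS0
      set e : N → ℝ := fun x => elVal v L (S 0) x (variation (E := E) S x) +
        forceVal F x (S 0 x) (tmap (E := 𝔼) (E' := E) (S 0) x) (variation (E := E) S x) with he
      have hec : Continuous e := (first_variation v hL hF hS f.hasCompactSupport.isCompact hSK).1
      have hex₀ : 0 < e x₀ := by
        have : variation (E := E) S x₀ = u := by
          rw [hSv, f.eq_one, one_smul, bwd_self]
          rfl
        simp only [he, this]
        exact hpos
      have hW : ∀ᶠ x in 𝓝 x₀, x ∈ V ∧ f x = 1 ∧ 0 < e x :=
        Filter.Eventually.and hV (f.eventuallyEq_one.and (hec.continuousAt.eventually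
          (lt_mem_nhds hex₀)))
      -- A second bump, supported where the first equals `1` and `e` is positive. There its
      -- variation is `g` times the first one, so the first variation is `∫ g e > 0`, against
      -- criticality.
      obtain ⟨g, -, hgW⟩ := (SmoothBumpFunction.nhds_basis_tsupport (I := 𝓡 n) x₀).mem_iff.1 hW
      obtain ⟨T, hT, hT0, hTK, hTv⟩ := hvar g g.contMDiff (fun x => g.nonneg) (fun x => g.le_one)
        fun x hx => (hgW hx).1
      have hK : IsCompact (tsupport g) := g.hasCompactSupport.isCompact
      have hTK' : ∀ ε, ∀ x ∉ tsupport g, T ε x = T 0 x := fun ε x hx => by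
        rw [hTK ε x hx, hT0]
      obtain ⟨hcT, δ, hδ, hδ'⟩ := first_variation v hL hF hT hK hTK'
      obtain ⟨δ₂, hδ₂, hδ₂'⟩ := hcrit T (tsupport g) hT hT0 hK hTK
      have hδδ : δ = δ₂ := hδ.unique hδ₂
      have hzero : δ + ∫ x in tsupport g, forceVal F x (T 0 x) (tmap (E := 𝔼) (E' := E) (T 0) x)
        (variation (E := E) T x) ∂(volMeasure v) = 0 := by rw [hδδ]; exact hδ₂'
      rw [hδ'] at hzero
      rw [hT0] at hcT hzero
      have hge : ∀ x, elVal v L (S 0) x (variation (E := E) T x) +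
          forceVal F x (S 0 x) (tmap (E := 𝔼) (E' := E) (S 0) x) (variation (E := E) T x) =
          g x * e x := by
        intro x
        by_cases hx : x ∈ tsupport g
        · have hf1 : f x = 1 := (hgW hx).2.1
          have : variation (E := E) T x = g x • variation (E := E) S x := by
            rw [hTv, hSv, hf1, one_smul]
          rw [this, elVal_smul v hL hs, map_smul, he, smul_eq_mul]
          ring
        · rw [hTv, image_eq_zero_of_notMem_tsupport hx, zero_smul, map_zero, zero_mul, add_zero]
          have := elVal_smul v hL hs x 0 (0 : E)
          rwa [zero_smul, zero_mul] at this
      simp_rw [hge] at hcT hzero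
      have hoff : ∀ x ∉ tsupport g, g x * e x = 0 := fun x hx => by
        rw [image_eq_zero_of_notMem_tsupport hx, zero_mul]
      rw [setIntegral_eq_integral_of_forall_compl_eq_zero hoff] at hzero
      have hpos' := hcT.integral_pos_of_hasCompactSupport_nonneg_nonzero (μ := volMeasure v)
        (HasCompactSupport.intro hK hoff) (x := x₀) (fun x => ?_) (by
          rw [g.eq_one, one_mul]; exact hex₀.ne')
      · exact hpos'.ne' hzero
      · by_cases hx : x ∈ tsupport g
        · exact mul_nonneg g.nonneg (hgW hx).2.2.le
        · exact (hoff x hx).ge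
    intro x u
    refine le_antisymm (hle x u) ?_
    have h := hle x (-u)
    have h1 := elVal_smul v hL hs x (-1) u
    rw [neg_one_smul] at h1
    rw [h1, map_neg] at h
    linarith
  · intro h S K hS hS0 hK hSK
    subst hS0
    obtain ⟨-, δ, hδ, hδ'⟩ := first_variation v hL hF hS hK hSK
    refine ⟨δ, hδ, ?_⟩
    refine hδ'.trans ?_
    simp_rw [h]
    simp

end Critical

/-! ### Principal bundles -/

section Bundle

variable {EQ : Type*} [NormedAddCommGroup EQ] [NormedSpace ℝ EQ]
  {Q : Type*} [TopologicalSpace Q] [ChartedSpace EQ Q]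
  {ES : Type*} [NormedAddCommGroup ES] [NormedSpace ℝ ES]
  {S : Type*} [TopologicalSpace S] [ChartedSpace ES S]
  {EG : Type*} [NormedAddCommGroup EG] [NormedSpace ℝ EG]
  {G : Type*} [TopologicalSpace G] [ChartedSpace EG G] [Group G]
  [MulAction Gᵐᵒᵖ Q]

variable (EQ EG G) in
/-- The infinitesimal generators, with tangent spaces identified with the model spaces. -/
def genVal (q : Q) : EG →L[ℝ] EQ := tmap (E := EG) (E' := EQ) (fun g : G => q <• g) 1

variable (EQ) in
/-- The tangent map of the right translation, with tangent spaces identified with the model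
space. -/
def translVal (g : G) (q : Q) : EQ →L[ℝ] EQ := tmap (E := EQ) (E' := EQ) (fun q' : Q => q' <• g) q

/-- The connection form, with tangent spaces identified with the model spaces. -/
def PrincipalConnection.val (A : PrincipalConnection EQ Q EG G) (q : Q) : EQ →L[ℝ] EG := A.form q

theorem PrincipalConnection.val_gen (A : PrincipalConnection EQ Q EG G) (q : Q) (ξ : EG) :
    A.val q (genVal EQ EG G q ξ) = ξ := A.form_gen q ξ

variable {π : Q → S}

theorem IsPrincipalBundle.mdifferentiableAt_orbit
    (hπ : IsPrincipalBundle EQ ES EG G π) (q : Q) (g : G) :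
    MDifferentiableAt 𝓘(ℝ, EG) 𝓘(ℝ, EQ) (fun g : G => q <• g) g :=
  (hπ.smooth_act.comp (contMDiff_const.prodMk contMDiff_id)).mdifferentiable (by simp) g

theorem IsPrincipalBundle.mdifferentiableAt_transl
    (hπ : IsPrincipalBundle EQ ES EG G π) (g : G) (q : Q) :
    MDifferentiableAt 𝓘(ℝ, EQ) 𝓘(ℝ, EQ) (fun q : Q => q <• g) q :=
  (hπ.smooth_act.comp (contMDiff_id.prodMk contMDiff_const)).mdifferentiable (by simp) q

theorem IsPrincipalBundle.mdifferentiableAt_proj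
    (hπ : IsPrincipalBundle EQ ES EG G π) (q : Q) :
    MDifferentiableAt 𝓘(ℝ, EQ) 𝓘(ℝ, ES) π q :=
  hπ.smooth_proj.mdifferentiable (by simp) q

theorem act_one (q : Q) : q <• (1 : G) = q := by simp

theorem IsPrincipalBundle.tmap_proj_gen
    (hπ : IsPrincipalBundle EQ ES EG G π) (q : Q) (ξ : EG) :
    tmap (E := EQ) (E' := ES) π q (genVal EQ EG G q ξ) = 0 := by
  have h := tmap_comp (E := EG) (E' := EQ) (E'' := ES) (g := π) (f := fun g : G => q <• g) (x := 1)
    (hπ.mdifferentiableAt_proj _) (hπ.mdifferentiableAt_orbit q 1)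
  have h2 : (fun g : G => π (q <• g)) = fun _ => π q := funext fun g => hπ.proj_act q g
  rw [h2, tmap_const, act_one] at h
  exact (DFunLike.congr_fun h ξ).symm

theorem IsPrincipalBundle.tmap_proj_transl
    (hπ : IsPrincipalBundle EQ ES EG G π) (g : G) (q : Q) :
    (tmap (E := EQ) (E' := ES) π (q <• g)) ∘L (translVal EQ g q) =
      tmap (E := EQ) (E' := ES) π q := by
  have h := tmap_comp (E := EQ) (E' := EQ) (E'' := ES) (g := π) (f := fun q : Q => q <• g) (x := q)
    (hπ.mdifferentiableAt_proj _) (hπ.mdifferentiableAt_transl g q)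
  have h2 : (fun q : Q => π (q <• g)) = π := funext fun q => hπ.proj_act q g
  rw [h2] at h
  exact h.symm

theorem tmap_act (hπ : IsPrincipalBundle EQ ES EG G π)
    {E : Type*} [NormedAddCommGroup E] [NormedSpace ℝ E]
    {M : Type*} [TopologicalSpace M] [ChartedSpace E M] {a : M → Q} {b : M → G} {x : M}
    (ha : MDifferentiableAt 𝓘(ℝ, E) 𝓘(ℝ, EQ) a x) (hb : MDifferentiableAt 𝓘(ℝ, E) 𝓘(ℝ, EG) b x)
    (u : E) :
    tmap (E := E) (E' := EQ) (fun x => a x <• b x) x u =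
      translVal EQ (b x) (a x) (tmap (E := E) (E' := EQ) a x u) +
      tmap (E := EG) (E' := EQ) (fun g : G => a x <• g) (b x) (tmap (E := E) (E' := EG) b x u) := by
  have hf : MDifferentiableAt (𝓘(ℝ, EQ).prod 𝓘(ℝ, EG)) 𝓘(ℝ, EQ) (fun p : Q × G => p.1 <• p.2)
      (a x, b x) := hπ.smooth_act.mdifferentiable (by simp) _
  have h1 := mfderiv_comp_apply (I := 𝓘(ℝ, E)) (I' := 𝓘(ℝ, EQ).prod 𝓘(ℝ, EG)) (I'' := 𝓘(ℝ, EQ))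
    (f := fun x => (a x, b x)) (g := fun p : Q × G => p.1 <• p.2) x hf (ha.prodMk hb) u
  have h2 := mfderiv_prodMk ha hb
  have h3 := mfderiv_prod_eq_add_apply (v := mfderiv 𝓘(ℝ, E) (𝓘(ℝ, EQ).prod 𝓘(ℝ, EG))
    (fun x => (a x, b x)) x u) hf
  have h4 := h1.trans h3
  rw [h2] at h4
  exact h4

/-- Around each point of `Q` there are a local section of `π` through that point and a smooth
`G`-coordinate relative to it. -/
theorem IsPrincipalBundle.exists_section [LieGroup 𝓘(ℝ, EG) ∞ G]
    (hπ : IsPrincipalBundle EQ ES EG G π) (q : Q) :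
    ∃ σ : S → Q, σ (π q) = q ∧ MDifferentiableAt 𝓘(ℝ, ES) 𝓘(ℝ, EQ) σ (π q) ∧
      (∀ᶠ b in 𝓝 (π q), π (σ b) = b) ∧
      ∃ k : Q → G, k q = 1 ∧ MDifferentiableAt 𝓘(ℝ, EQ) 𝓘(ℝ, EG) k q ∧
        ∀ᶠ q' in 𝓝 q, q' = σ (π q') <• k q' := by
  obtain ⟨U, e, hU, hbU, hsrc, htgt, he, hes, h1, h2⟩ := hπ.locally_trivial (π q)
  have mem : ∀ q', q' ∈ e.source ↔ π q' ∈ U := fun q' => by rw [hsrc]; rfl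
  have hq : q ∈ e.source := (mem q).2 hbU
  have hproj : ∀ b ∈ U, ∀ g : G, (b, g) ∈ e.target := fun b hb g => by
    rw [htgt]; exact ⟨hb, mem_univ _⟩
  have hsec : ∀ b ∈ U, ∀ g : G, π (e.symm (b, g)) = b := fun b hb g => by
    rw [← h1 _ (e.map_target (hproj b hb g)), e.right_inv (hproj b hb g)]
  -- The section is the slice with the same `G`-coordinate as `q`, so it passes through `q`. The
  -- relative coordinate is a left quotient because `G` acts by right multiplication in the
  -- trivialisation.
  refine ⟨fun b => e.symm (b, (e q).2), ?_, ?_, ?_, fun q' => (e q).2⁻¹ * (e q').2, ?_, ?_, ?_⟩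
  · have : (π q, (e q).2) = e q := by rw [← h1 q hq]
    simp only [this, e.left_inv hq]
  · have h3 : ContMDiffAt (𝓘(ℝ, ES).prod 𝓘(ℝ, EG)) 𝓘(ℝ, EQ) ∞ e.symm (π q, (e q).2) :=
      hes.contMDiffAt (e.open_target.mem_nhds (hproj _ hbU _))
    exact (h3.comp (π q) (f := fun b => (b, (e q).2))
      (contMDiffAt_id.prodMk contMDiffAt_const)).mdifferentiableAt (by simp)
  · filter_upwards [hU.mem_nhds hbU] with b hb
    exact hsec b hb _
  · simp
  · have h3 : ContMDiffAt 𝓘(ℝ, EQ) (𝓘(ℝ, ES).prod 𝓘(ℝ, EG)) ∞ e q :=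
      he.contMDiffAt (e.open_source.mem_nhds hq)
    have h4 : ContMDiffAt 𝓘(ℝ, EQ) 𝓘(ℝ, EG) ∞ (fun q' => (e q).2⁻¹ * (e q').2) q :=
      contMDiffAt_const.mul h3.snd
    exact h4.mdifferentiableAt (by simp)
  · filter_upwards [e.open_source.mem_nhds hq] with q' hq'
    have hb : π q' ∈ U := (mem q').1 hq'
    have hs : e.symm (π q', (e q).2) ∈ e.source := e.map_target (hproj _ hb _)
    refine e.injOn hq' ((mem _).2 ?_) ?_
    · rw [hπ.proj_act, hsec _ hb]; exact hb
    · refine Prod.ext ?_ ?_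
      · rw [h1 _ hq', h1, hπ.proj_act, hsec _ hb]
        rw [mem, hπ.proj_act, hsec _ hb]; exact hb
      · rw [h2 _ hs, e.right_inv (hproj _ hb _)]
        simp

/-- The vertical space is the kernel of the tangent map of the projection. -/
theorem IsPrincipalBundle.gen_val_of_tmap_proj_eq_zero [LieGroup 𝓘(ℝ, EG) ∞ G]
    (hπ : IsPrincipalBundle EQ ES EG G π) (A : PrincipalConnection EQ Q EG G) (q : Q) (u : EQ)
    (hu : tmap (E := EQ) (E' := ES) π q u = 0) : genVal EQ EG G q (A.val q u) = u := by
  obtain ⟨σ, hσq, hσ, -, k, hk1, hk, h⟩ := hπ.exists_section q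
  have hσπ : MDifferentiableAt 𝓘(ℝ, EQ) 𝓘(ℝ, EQ) (fun q' => σ (π q')) q :=
    MDifferentiableAt.comp (g := σ) (f := π) q hσ (hπ.mdifferentiableAt_proj q)
  -- Differentiating `q' = σ (π q') · k q'`: if `Tπ u = 0`, the term from `σ ∘ π` drops out and `u`
  -- is the generator of `Tk u`.
  have h1 := tmap_act hπ hσπ hk u
  have h2 : tmap (E := EQ) (E' := EQ) (fun q' => σ (π q') <• k q') q u = u := by
    rw [← tmap_congr (E := EQ) (E' := EQ) (f := fun q' : Q => q') h]
    exact DFunLike.congr_fun (mfderiv_id (I := 𝓘(ℝ, EQ)) (x := q)) u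
  have h3 : tmap (E := EQ) (E' := EQ) (fun q' => σ (π q')) q u = 0 := by
    rw [tmap_comp (E := EQ) (E' := ES) (E'' := EQ) (g := σ) (f := π) hσ
      (hπ.mdifferentiableAt_proj q), ContinuousLinearMap.comp_apply, hu, map_zero]
  rw [h2, h3, map_zero, zero_add, hσq, hk1] at h1
  have h4 : u = genVal EQ EG G q (tmap (E := EQ) (E' := EG) k q u) := h1
  rw [h4, A.val_gen]

/-- The tangent map of a local section splits `Tπ`, and removing its vertical part makes it
horizontal. This existence is what gives the `epsilon` in `horLift` its meaning. -/
theorem IsPrincipalBundle.exists_lift [LieGroup 𝓘(ℝ, EG) ∞ G]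
    (hπ : IsPrincipalBundle EQ ES EG G π) (A : PrincipalConnection EQ Q EG G) (q : Q) :
    ∃ H : ES →L[ℝ] EQ, ∀ w, A.val q (H w) = 0 ∧ tmap (E := EQ) (E' := ES) π q (H w) = w := by
  obtain ⟨σ, hσq, hσ, hs, -⟩ := hπ.exists_section q
  have h1 := tmap_comp (E := ES) (E' := EQ) (E'' := ES) (g := π) (f := σ) (x := π q)
    (hπ.mdifferentiableAt_proj _) hσ
  have h2 : tmap (E := ES) (E' := ES) (fun b => π (σ b)) (π q) = ContinuousLinearMap.id ℝ ES := by
    rw [tmap_congr (E := ES) (E' := ES) (g := fun b : S => b) hs]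
    exact mfderiv_id (I := 𝓘(ℝ, ES)) (x := π q)
  rw [h2, hσq] at h1
  set T := tmap (E := ES) (E' := EQ) σ (π q)
  refine ⟨T - (genVal EQ EG G q ∘L A.val q) ∘L T, fun w => ⟨?_, ?_⟩⟩
  · simp [A.val_gen]
  · have := DFunLike.congr_fun h1 w
    simp only [sub_apply, ContinuousLinearMap.comp_apply, map_sub,
      hπ.tmap_proj_gen, sub_zero]
    exact this.symm

variable (ES) in
/-- The horizontal lift, with tangent spaces identified with the model spaces. -/
def PrincipalConnection.lift (A : PrincipalConnection EQ Q EG G) (π : Q → S) (q : Q) :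
    ES →L[ℝ] EQ := A.horLift ES π q

theorem IsPrincipalBundle.lift_spec [LieGroup 𝓘(ℝ, EG) ∞ G]
    (hπ : IsPrincipalBundle EQ ES EG G π) (A : PrincipalConnection EQ Q EG G) (q : Q) (w : ES) :
    A.val q (A.lift ES π q w) = 0 ∧ tmap (E := EQ) (E' := ES) π q (A.lift ES π q w) = w :=
  Classical.epsilon_spec (hπ.exists_lift A q) w

/-- The difference between `u` and the lift of its projection lies in the kernel of `Tπ`, hence is
vertical and determined by its value under the connection form. -/
theorem IsPrincipalBundle.lift_tmap_proj [LieGroup 𝓘(ℝ, EG) ∞ G]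
    (hπ : IsPrincipalBundle EQ ES EG G π) (A : PrincipalConnection EQ Q EG G) (q : Q) (u : EQ) :
    A.lift ES π q (tmap (E := EQ) (E' := ES) π q u) = u - genVal EQ EG G q (A.val q u) := by
  have h := hπ.lift_spec A q (tmap (E := EQ) (E' := ES) π q u)
  have h1 := hπ.gen_val_of_tmap_proj_eq_zero A q
    (u - A.lift ES π q (tmap (E := EQ) (E' := ES) π q u)) (by rw [map_sub, h.2, sub_self])
  rw [map_sub, h.1, sub_zero] at h1
  rw [h1, sub_sub_cancel]

end Bundle

/-! ### Sums and pullbacks of Lagrangians -/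

section Pullback

variable {n : ℕ} {N : Type*} [TopologicalSpace N] [ChartedSpace (EuclideanSpace ℝ (Fin n)) N]
  [IsManifold (𝓡 n) ∞ N]
  {E : Type*} [NormedAddCommGroup E] [NormedSpace ℝ E]
  {M : Type*} [TopologicalSpace M] [ChartedSpace E M] [IsManifold 𝓘(ℝ, E) ∞ M]
  {E' : Type*} [NormedAddCommGroup E'] [NormedSpace ℝ E']
  {M' : Type*} [TopologicalSpace M'] [ChartedSpace E' M'] [IsManifold 𝓘(ℝ, E') ∞ M']

local notation "𝔼" => EuclideanSpace ℝ (Fin n)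

theorem SmoothLagrangian.add {L₁ L₂ : Lagrangian n N E M} (h₁ : SmoothLagrangian L₁)
    (h₂ : SmoothLagrangian L₂) : SmoothLagrangian (fun x q j => L₁ x q j + L₂ x q j) :=
  fun x₀ q₀ => (h₁ x₀ q₀).add (h₂ x₀ q₀)

theorem smoothForce_zero : SmoothForce (fun _ _ _ => 0 : Force n N E M) := by
  intro x₀ q₀
  have h : ∀ p : (𝔼 × E) × (𝔼 →L[ℝ] E), (0 : E →L[ℝ] ℝ) ∘L (bwd (E := E) q₀ p.1.2) = 0 :=
    fun p => ContinuousLinearMap.zero_comp _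
  exact (contDiffOn_const (c := (0 : E →L[ℝ] ℝ))).congr fun p _ => h p

theorem SmoothLagrangian.contDiffAt_lagVal {L : Lagrangian n N E M}
    (hL : SmoothLagrangian L) (x : N) (q : M) (j : 𝔼 →L[ℝ] E) :
    ContDiffAt ℝ ∞ (lagVal L x q) j := by
  have hx := mem_extChartAt_source (I := 𝓡 n) x
  have hq := mem_extChartAt_source (I := 𝓘(ℝ, E)) q
  have h : lagVal L x q = fun j => coordLag L x q
      ((extChartAt (𝓡 n) x x, extChartAt 𝓘(ℝ, E) q q), j) := by
    funext j
    rw [lagVal_eq_coordLag L hx hq, fwd_self, bwd_self]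
    rfl
  rw [h]
  exact ContDiffAt.comp j (hL.contDiffAt (mem_extChartAt_target x) (mem_extChartAt_target q))
    (contDiffAt_const.prodMk contDiffAt_id)

theorem fiberVal_add {L₁ L₂ : Lagrangian n N E M} (h₁ : SmoothLagrangian L₁)
    (h₂ : SmoothLagrangian L₂) (x : N) (q : M) (j : 𝔼 →L[ℝ] E) (c : E) :
    fiberVal (fun x q j => L₁ x q j + L₂ x q j) x q j c =
      fiberVal L₁ x q j c + fiberVal L₂ x q j c := by
  have hd : ∀ {L : Lagrangian n N E M}, SmoothLagrangian L → ∀ i : Fin n,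
      DifferentiableAt ℝ (fun ε : ℝ => lagVal L x q (j + ε • dualTensor i c)) 0 := by
    intro L hL i
    have h1 : DifferentiableAt ℝ (fun ε : ℝ => j + ε • dualTensor i c) 0 := by fun_prop
    exact DifferentiableAt.comp (0 : ℝ)
      ((hL.contDiffAt_lagVal x q _).differentiableAt (by simp)) h1
  simp only [fiberVal_eq, ← Finset.sum_add_distrib, ← add_smul]
  refine Finset.sum_congr rfl fun i _ => ?_
  rw [← deriv_fun_add (hd h₁ i) (hd h₂ i)]
  rfl

theorem divVal_add (v : VolumeForm n N) {X Y : N → 𝔼} {x : N} (hX : SmoothVFAt X x)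
    (hY : SmoothVFAt Y x) : divVal v (fun x' => X x' + Y x') x = divVal v X x + divVal v Y x := by
  have h := divVal_sum v (Finset.univ : Finset Bool) (X := fun b => bif b then X else Y) (x := x)
    (by rintro (_ | _) - <;> assumption)
  simpa using h

/-- Once a vector is the variation of a family, identities between Euler–Lagrange forms follow from
the first variation formula and uniqueness of derivatives, with no computation in charts. -/
theorem exists_family_variation [T2Space N] [FiniteDimensional ℝ E] {s : N → M}
    (hs : ContMDiff (𝓡 n) 𝓘(ℝ, E) ∞ s) (x : N) (u : E) :
    ∃ S : ℝ → N → M, ContMDiff (𝓘(ℝ, ℝ).prod (𝓡 n)) 𝓘(ℝ, E) ∞ (fun p : ℝ × N => S p.1 p.2) ∧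
      S 0 = s ∧ variation (E := E) S x = u := by
  obtain ⟨V, hV, -, hvar⟩ := exists_bump_variation (E := E) hs x u
  obtain ⟨f, -, hfV⟩ := (SmoothBumpFunction.nhds_basis_tsupport (I := 𝓡 n) x).mem_iff.1 hV
  obtain ⟨S, hS, hS0, -, hSv⟩ := hvar f f.contMDiff (fun x => f.nonneg) (fun x => f.le_one) hfV
  refine ⟨S, hS, hS0, ?_⟩
  rw [hSv, f.eq_one, one_smul, bwd_self]
  rfl

/-- In the first variation formula the derivative along the family and the divergence of the
momentum field are both additive in the Lagrangian, so the remaining term is too. -/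
theorem elVal_add_lagrangian [T2Space N] [FiniteDimensional ℝ E] (v : VolumeForm n N)
    {L₁ L₂ : Lagrangian n N E M}
    (h₁ : SmoothLagrangian L₁) (h₂ : SmoothLagrangian L₂) {s : N → M}
    (hs : ContMDiff (𝓡 n) 𝓘(ℝ, E) ∞ s) (x : N) (u : E) :
    elVal v (fun x q j => L₁ x q j + L₂ x q j) s x u = elVal v L₁ s x u + elVal v L₂ s x u := by
  obtain ⟨S, hS, rfl, rfl⟩ := exists_family_variation (E := E) hs x u
  have hS' : SmoothFamilyNear (n := n) (E := E) S 0 x := Filter.Eventually.of_forall hS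
  have e := HasDerivAt.unique (hasDerivAt_lagVal v (h₁.add h₂) hS')
    ((hasDerivAt_lagVal v h₁ hS').add (hasDerivAt_lagVal v h₂ hS'))
  have hm : momentumField (fun x q j => L₁ x q j + L₂ x q j) S =
      fun x' => momentumField L₁ S x' + momentumField L₂ S x' :=
    funext fun x' => fiberVal_add h₁ h₂ _ _ _ _
  rw [hm, divVal_add v (smoothVFAt_momentumField h₁ hS x)
    (smoothVFAt_momentumField h₂ hS x)] at e
  linarith

theorem lagVal_lift (π : M → M') (l : Lagrangian n N E' M') (x : N) (q : M) (j : 𝔼 →L[ℝ] E) :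
    lagVal (liftLagrangian (EQ := E) π l) x q j =
      lagVal l x (π q) ((tmap (E := E) (E' := E') π q) ∘L j) := rfl

theorem fiberVal_lift (π : M → M') (l : Lagrangian n N E' M') (x : N) (q : M) (j : 𝔼 →L[ℝ] E)
    (c : E) : fiberVal (liftLagrangian (EQ := E) π l) x q j c =
      fiberVal l x (π q) ((tmap (E := E) (E' := E') π q) ∘L j)
        (tmap (E := E) (E' := E') π q c) := by
  simp only [fiberVal_eq, lagVal_lift]
  refine Finset.sum_congr rfl fun i _ => ?_
  congr 2
  funext ε
  congr 1
  ext w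
  simp

/-- In charts the jet `(y, z, J)` goes to `(y, π z, Dπ(z) J)`, a smooth map; the chart downstairs is
centred at the image of the point considered. -/
theorem SmoothLagrangian.lift {π : M → M'} (hπ : ContMDiff 𝓘(ℝ, E) 𝓘(ℝ, E') ∞ π)
    {l : Lagrangian n N E' M'} (hl : SmoothLagrangian l) :
    SmoothLagrangian (liftLagrangian (EQ := E) π l) := by
  intro x₀ q₀ p₀ hp₀
  obtain ⟨⟨h1, h2⟩, -⟩ := hp₀
  refine ContDiffAt.contDiffWithinAt ?_
  change ContDiffAt ℝ ∞ (coordLag (liftLagrangian (EQ := E) π l) x₀ q₀) p₀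
  set φ := extChartAt 𝓘(ℝ, E) q₀ with hφ
  set b₀ := π (φ.symm p₀.1.2) with hb₀
  set ψ := extChartAt 𝓘(ℝ, E') b₀ with hψ
  set π' : E → E' := fun z => ψ (π (φ.symm z)) with hπ'
  have hcont : ContinuousAt (fun z => π (φ.symm z)) p₀.1.2 :=
    ContinuousAt.comp (f := φ.symm) (g := π) (x := p₀.1.2) hπ.continuous.continuousAt
      (contMDiffAt_chart_symm h2).continuousAt
  have hsm : ContDiffAt ℝ ∞ π' p₀.1.2 := by
    rw [← contMDiffAt_iff_contDiffAt]
    exact ContMDiffAt.comp (I' := 𝓘(ℝ, E')) p₀.1.2 (contMDiffAt_chart (mem_extChartAt_source b₀))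
      (ContMDiffAt.comp (I' := 𝓘(ℝ, E)) p₀.1.2 (hπ _) (contMDiffAt_chart_symm h2))
  have hcoord : ContDiffAt ℝ ∞ (fun p : (𝔼 × E) × (𝔼 →L[ℝ] E) => coordLag l x₀ b₀
      ((p.1.1, π' p.1.2), (fderiv ℝ π' p.1.2) ∘L p.2)) p₀ := by
    have hz : ContDiffAt ℝ ∞ (fun p : (𝔼 × E) × (𝔼 →L[ℝ] E) => p.1.2) p₀ :=
      contDiffAt_snd.comp p₀ contDiffAt_fst
    have hy : ContDiffAt ℝ ∞ (fun p : (𝔼 × E) × (𝔼 →L[ℝ] E) => p.1.1) p₀ :=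
      contDiffAt_fst.comp p₀ contDiffAt_fst
    have hπz : ContDiffAt ℝ ∞ (fun p : (𝔼 × E) × (𝔼 →L[ℝ] E) => π' p.1.2) p₀ :=
      ContDiffAt.comp (g := π') (f := fun p : (𝔼 × E) × (𝔼 →L[ℝ] E) => p.1.2) p₀ hsm hz
    have hD : ContDiffAt ℝ ∞ (fderiv ℝ π') p₀.1.2 := hsm.fderiv_right (m := ∞) (by simp)
    have hDz : ContDiffAt ℝ ∞ (fun p : (𝔼 × E) × (𝔼 →L[ℝ] E) => fderiv ℝ π' p.1.2) p₀ :=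
      ContDiffAt.comp p₀ hD hz
    have hJ : ContDiffAt ℝ ∞ (fun p : (𝔼 × E) × (𝔼 →L[ℝ] E) => (fderiv ℝ π' p.1.2) ∘L p.2) p₀ :=
      hDz.clm_comp contDiffAt_snd
    exact ContDiffAt.comp p₀ (hl.contDiffAt h1 (mem_extChartAt_target b₀)) ((hy.prodMk hπz).prodMk hJ)
  refine hcoord.congr_of_eventuallyEq ?_
  have e1 : ∀ᶠ p : (𝔼 × E) × (𝔼 →L[ℝ] E) in 𝓝 p₀, p.1.1 ∈ (extChartAt (𝓡 n) x₀).target :=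
    (continuousAt_fst.fst).eventually ((isOpen_extChartAt_target x₀).eventually_mem h1)
  have e2 : ∀ᶠ p : (𝔼 × E) × (𝔼 →L[ℝ] E) in 𝓝 p₀, p.1.2 ∈ φ.target ∧
      π (φ.symm p.1.2) ∈ ψ.source :=
    (continuousAt_fst.snd).eventually (((isOpen_extChartAt_target q₀).eventually_mem h2).and
      (hcont.eventually ((isOpen_extChartAt_source b₀).eventually_mem (mem_extChartAt_source b₀))))
  filter_upwards [e1, e2] with p hp1 hp2
  have hqs := φ.map_target hp2.1
  have hd := fwd_tmap_bwd (E := E) (E' := E') (q₀ := b₀)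
    (hπ.mdifferentiableAt (x := φ.symm p.1.2) (by simp)) hqs hp2.2
  rw [φ.right_inv hp2.1] at hd
  change lagVal (liftLagrangian (EQ := E) π l) _ _ _ = _
  rw [lagVal_lift, lagVal_eq_coordLag l ((extChartAt (𝓡 n) x₀).map_target hp1) hp2.2,
    (extChartAt (𝓡 n) x₀).right_inv hp1]
  congr 2
  rw [← hd]
  ext w
  have hw : fwd (E := 𝔼) x₀ ((extChartAt (𝓡 n) x₀).symm p.1.1) (bwd (E := 𝔼) x₀ p.1.1 w) = w := by
    have := fwd_bwd (E := 𝔼) ((extChartAt (𝓡 n) x₀).map_target hp1) w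
    rwa [(extChartAt (𝓡 n) x₀).right_inv hp1] at this
  simp only [ContinuousLinearMap.comp_apply, hw]
  rfl

/-- The Euler–Lagrange form of the pullback of a Lagrangian by a map of the targets. -/
theorem elVal_lift [T2Space N] [FiniteDimensional ℝ E] (v : VolumeForm n N) {π : M → M'}
    (hπ : ContMDiff 𝓘(ℝ, E) 𝓘(ℝ, E') ∞ π)
    {l : Lagrangian n N E' M'} (hl : SmoothLagrangian l) {s : N → M}
    (hs : ContMDiff (𝓡 n) 𝓘(ℝ, E) ∞ s) (x : N) (u : E) :
    elVal v (liftLagrangian (EQ := E) π l) s x u =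
      elVal v l (fun x => π (s x)) x (tmap (E := E) (E' := E') π (s x) u) := by
  obtain ⟨S, hS, rfl, rfl⟩ := exists_family_variation (E := E) hs x u
  have hS' : SmoothFamilyNear (n := n) (E := E) S 0 x := Filter.Eventually.of_forall hS
  have hT : SmoothFamilyNear (n := n) (E := E') (fun ε x => π (S ε x)) 0 x :=
    Filter.Eventually.of_forall (hπ.comp hS)
  have hπd : ∀ q, MDifferentiableAt 𝓘(ℝ, E) 𝓘(ℝ, E') π q := fun q =>
    hπ.mdifferentiableAt (by simp)
  have hj : ∀ ε x, tmap (E := 𝔼) (E' := E') (fun x => π (S ε x)) x =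
      (tmap (E := E) (E' := E') π (S ε x)) ∘L (tmap (E := 𝔼) (E' := E) (S ε) x) := fun ε x =>
    tmap_comp (E := 𝔼) (E' := E) (E'' := E') (hπd _) (mdifferentiableAt_of_family (hS (ε, x)))
  have hv : ∀ x, variation (E := E') (fun ε x => π (S ε x)) x =
      tmap (E := E) (E' := E') π (S 0 x) (variation (E := E) S x) := fun x =>
    DFunLike.congr_fun (tmap_comp (E := ℝ) (E' := E) (E'' := E') (f := fun ε => S ε x) (hπd _)
      (mdifferentiableAt_curve_of_family (hS (0, x)))) 1
  have h1 := hasDerivAt_lagVal v (hl.lift hπ) hS'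
  have h2 := hasDerivAt_lagVal v hl hT
  -- By the chain rule the family upstairs and its projection have the same momentum field, so the
  -- divergences cancel when the two first variations are compared.
  have hm : momentumField (liftLagrangian (EQ := E) π l) S =
      momentumField l (fun ε x => π (S ε x)) := by
    funext x'
    simp only [momentumField, fiberVal_lift, hj, hv]
  simp only [hj, hv] at h2
  simp only [lagVal_lift, hm] at h1
  have := h1.unique h2
  linarith

end Pullback

/-! ### Exterior derivatives and families of curves -/

section TwoParameter

variable {E F V : Type*} [NormedAddCommGroup E] [NormedSpace ℝ E]
  [NormedAddCommGroup F] [NormedSpace ℝ F] [NormedAddCommGroup V] [NormedSpace ℝ V]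

/-- For a `1`-form `α` and a family `σ(ε, y)`, the derivative of `α(∂σ/∂y)` with respect to `ε` is
`∂/∂y (α(∂σ/∂ε)) + dα(∂σ/∂ε, ∂σ/∂y)`. -/
theorem hasDerivAt_pullback_form {α : E → E →L[ℝ] F} {σ : ℝ × V → E} {y₀ : V}
    (hσ : ContDiffAt ℝ ∞ σ (0, y₀)) (hα : DifferentiableAt ℝ α (σ (0, y₀))) :
    HasDerivAt
      (fun ε : ℝ => (α (σ (ε, y₀))) ∘L (fderiv ℝ σ (ε, y₀)) ∘L (ContinuousLinearMap.inr ℝ ℝ V))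
      (fderiv ℝ (fun y => α (σ (0, y)) (fderiv ℝ σ (0, y) (1, 0))) y₀ +
        (fderiv ℝ α (σ (0, y₀)) (fderiv ℝ σ (0, y₀) (1, 0)) -
          (fderiv ℝ α (σ (0, y₀))).flip (fderiv ℝ σ (0, y₀) (1, 0))) ∘L
          (fderiv ℝ σ (0, y₀)) ∘L (ContinuousLinearMap.inr ℝ ℝ V)) 0 := by
  have hline : HasDerivAt (fun ε : ℝ => (ε, y₀)) ((1 : ℝ), (0 : V)) 0 :=
    (hasDerivAt_id (0 : ℝ)).prodMk (hasDerivAt_const (0 : ℝ) y₀)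
  have h1 : HasFDerivAt σ (fderiv ℝ σ (0, y₀)) (0, y₀) :=
    (hσ.differentiableAt (by simp)).hasFDerivAt
  have h2 : HasFDerivAt (fderiv ℝ σ) (fderiv ℝ (fderiv ℝ σ) (0, y₀)) (0, y₀) :=
    ((hσ.fderiv_right (m := ∞) (by simp)).differentiableAt (by simp)).hasFDerivAt
  have h3 : HasFDerivAt (fun y : V => ((0 : ℝ), y)) (ContinuousLinearMap.inr ℝ ℝ V) y₀ :=
    (ContinuousLinearMap.inr ℝ ℝ V).hasFDerivAt
  -- Both `∂/∂ε` of `α(∂σ/∂y)` and `∂/∂y` of `α(∂σ/∂ε)` contain `α` of the mixed second derivative.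
  -- Symmetry cancels it and leaves the antisymmetrised derivative of `α`.
  have hsymm : IsSymmSndFDerivAt ℝ σ (0, y₀) :=
    hσ.isSymmSndFDerivAt (by simpa using ENat.LEInfty.out)
  have hα1 := hα.hasFDerivAt.comp ((0 : ℝ), y₀) h1
  have h4 : HasDerivAt (fun ε : ℝ => α (σ (ε, y₀)))
      (fderiv ℝ α (σ (0, y₀)) (fderiv ℝ σ (0, y₀) (1, 0))) 0 :=
    hα.hasFDerivAt.comp_hasDerivAt (0 : ℝ) (h1.comp_hasDerivAt (0 : ℝ) hline)
  have h5 : HasDerivAt (fun ε : ℝ => fderiv ℝ σ (ε, y₀))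
      (fderiv ℝ (fderiv ℝ σ) (0, y₀) (1, 0)) 0 := h2.comp_hasDerivAt (0 : ℝ) hline
  have h6 := h4.clm_comp (h5.clm_comp (hasDerivAt_const (0 : ℝ) (ContinuousLinearMap.inr ℝ ℝ V)))
  have h7 : HasFDerivAt (fun y : V => α (σ (0, y))) _ y₀ := hα1.comp y₀ h3
  have h8 : HasFDerivAt (fun y : V => fderiv ℝ σ (0, y)) _ y₀ := h2.comp y₀ h3
  have h9 := (h7.clm_apply (h8.clm_apply (hasFDerivAt_const ((1 : ℝ), (0 : V)) y₀))).fderiv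
  rw [h9]
  convert h6 using 1
  ext w
  simp only [hsymm.eq (0, w) (1, 0), add_apply, sub_apply, ContinuousLinearMap.comp_apply,
    ContinuousLinearMap.flip_apply, ContinuousLinearMap.inr_apply, zero_apply, map_zero, zero_add,
    add_zero]
  abel

end TwoParameter

/-! ### Curves with prescribed velocity -/

section Curves

variable {E : Type*} [NormedAddCommGroup E] [NormedSpace ℝ E]
  {M : Type*} [TopologicalSpace M] [ChartedSpace E M]

/-- A curve through `q` with velocity `u` at `0`, a straight line in the preferred chart. -/
def chartCurve (q : M) (u : E) (t : ℝ) : M :=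
  (extChartAt 𝓘(ℝ, E) q).symm (extChartAt 𝓘(ℝ, E) q q + t • u)

theorem chartCurve_zero (q : M) (u : E) : chartCurve q u 0 = q := by
  rw [chartCurve, zero_smul, add_zero]
  exact extChartAt_to_inv (I := 𝓘(ℝ, E)) q

variable [IsManifold 𝓘(ℝ, E) ∞ M]

theorem eventually_contMDiffAt_chartCurve (q : M) (u : E) :
    ∀ᶠ t in 𝓝 (0 : ℝ), ContMDiffAt 𝓘(ℝ, ℝ) 𝓘(ℝ, E) ∞ (chartCurve q u) t := by
  have hl : ContDiff ℝ ∞ (fun t : ℝ => extChartAt 𝓘(ℝ, E) q q + t • u) := by fun_prop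
  have h0 : extChartAt 𝓘(ℝ, E) q q + (0 : ℝ) • u ∈ (extChartAt 𝓘(ℝ, E) q).target := by
    rw [zero_smul, add_zero]
    exact mem_extChartAt_target q
  filter_upwards [hl.continuous.continuousAt.eventually
    ((isOpen_extChartAt_target q).eventually_mem h0)] with t ht
  exact ContMDiffAt.comp (I' := 𝓘(ℝ, E)) t (contMDiffAt_chart_symm ht) hl.contMDiff.contMDiffAt

theorem tmap_chart_symm_line {q₀ : M} {z : E} (hz : z ∈ (extChartAt 𝓘(ℝ, E) q₀).target) (u : E) :
    tmap (E := ℝ) (E' := E) (fun t : ℝ => (extChartAt 𝓘(ℝ, E) q₀).symm (z + t • u)) 0 1 =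
      bwd (E := E) q₀ z u := by
  have hl : HasDerivAt (fun t : ℝ => z + t • u) u 0 := by
    simpa only [one_smul, id_eq] using ((hasDerivAt_id (0 : ℝ)).smul_const u).const_add z
  have h0 : z + (0 : ℝ) • u = z := by simp
  have h := tmap_comp (E := ℝ) (E' := E) (E'' := E) (g := (extChartAt 𝓘(ℝ, E) q₀).symm)
    (f := fun t : ℝ => z + t • u) (x := 0)
    (mdifferentiableAt_chart_symm (by rw [h0]; exact hz)) hl.differentiableAt.mdifferentiableAt
  have h2 := DFunLike.congr_fun h 1
  rw [ContinuousLinearMap.comp_apply, h0, tmap_eq_fderiv, fderiv_apply_one_eq_deriv, hl.deriv] at h2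
  exact h2

theorem tmap_chartCurve (q : M) (u : E) : tmap (E := ℝ) (E' := E) (chartCurve q u) 0 1 = u :=
  (tmap_chart_symm_line (mem_extChartAt_target q) u).trans
    (DFunLike.congr_fun (bwd_self (E := E) q) u)

end Curves

/-! ### Infinitesimal generators and the connection form in charts -/

section Generators

variable {EQ : Type*} [NormedAddCommGroup EQ] [NormedSpace ℝ EQ]
  {Q : Type*} [TopologicalSpace Q] [ChartedSpace EQ Q] [IsManifold 𝓘(ℝ, EQ) ∞ Q]
  {ES : Type*} [NormedAddCommGroup ES] [NormedSpace ℝ ES]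
  {S : Type*} [TopologicalSpace S] [ChartedSpace ES S]
  {EG : Type*} [NormedAddCommGroup EG] [NormedSpace ℝ EG]
  {G : Type*} [TopologicalSpace G] [ChartedSpace EG G] [Group G] [LieGroup 𝓘(ℝ, EG) ∞ G]
  [MulAction Gᵐᵒᵖ Q] {π : Q → S}

variable (EQ EG G) in
/-- The infinitesimal generators in the chart around `q₀`. -/
def genCoord (q₀ : Q) (z : EQ) : EG →L[ℝ] EQ :=
  (fwd (E := EQ) q₀ ((extChartAt 𝓘(ℝ, EQ) q₀).symm z)) ∘L
    (genVal EQ EG G ((extChartAt 𝓘(ℝ, EQ) q₀).symm z))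

/-- The generators are the partial derivative in the group direction, at the identity, of the smooth
action written in charts. -/
theorem IsPrincipalBundle.contDiffAt_genCoord (hπ : IsPrincipalBundle EQ ES EG G π) {q₀ : Q}
    {z : EQ} (hz : z ∈ (extChartAt 𝓘(ℝ, EQ) q₀).target) :
    ContDiffAt ℝ ∞ (genCoord EQ EG G q₀) z := by
  set φ := extChartAt 𝓘(ℝ, EQ) q₀ with hφ
  set ψ := extChartAt 𝓘(ℝ, EG) (1 : G) with hψ
  have hψ1 : ψ.symm (ψ 1) = 1 := extChartAt_to_inv (I := 𝓘(ℝ, EG)) (1 : G)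
  let a : EQ × EG → EQ := fun p => φ (φ.symm p.1 <• ψ.symm p.2)
  have ha : ∀ z ∈ φ.target, ContDiffAt ℝ ∞ a (z, ψ 1) := by
    intro z hz
    rw [← contMDiffAt_iff_contDiffAt]
    have h1 : ContMDiffAt 𝓘(ℝ, EQ × EG) (𝓘(ℝ, EQ).prod 𝓘(ℝ, EG)) ∞
        (fun p : EQ × EG => (φ.symm p.1, ψ.symm p.2)) (z, ψ 1) := by
      refine ContMDiffAt.prodMk ?_ ?_
      · exact ContMDiffAt.comp (I' := 𝓘(ℝ, EQ)) (z, ψ 1) (contMDiffAt_chart_symm hz)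
          contDiffAt_fst.contMDiffAt
      · exact ContMDiffAt.comp (I' := 𝓘(ℝ, EG)) (z, ψ 1)
          (contMDiffAt_chart_symm (mem_extChartAt_target (1 : G))) contDiffAt_snd.contMDiffAt
    refine ContMDiffAt.comp (I' := 𝓘(ℝ, EQ)) (z, ψ 1) (contMDiffAt_chart ?_)
      (ContMDiffAt.comp (z, ψ 1) (hπ.smooth_act _) h1)
    simp only [hψ1, act_one]
    exact φ.map_target hz
  have hD : ContDiffAt ℝ ∞ (fun z => (fderiv ℝ a (z, ψ 1)) ∘L
      (ContinuousLinearMap.inr ℝ EQ EG)) z := by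
    have h1 : ContDiffAt ℝ ∞ (fderiv ℝ a) (z, ψ 1) := (ha z hz).fderiv_right (m := ∞) (by simp)
    have h2 : ContDiffAt ℝ ∞ (fun z : EQ => (z, ψ 1)) z := contDiffAt_id.prodMk contDiffAt_const
    have h3 : ContDiffAt ℝ ∞ (fun z => fderiv ℝ a (z, ψ 1)) z := ContDiffAt.comp z h1 h2
    exact h3.clm_comp contDiffAt_const
  refine hD.congr_of_eventuallyEq ?_
  filter_upwards [(isOpen_extChartAt_target q₀).eventually_mem hz] with z' hz'
  have h1 := fwd_tmap_bwd (E := EG) (E' := EQ) (q₀ := q₀) (x₀ := (1 : G))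
    (hπ.mdifferentiableAt_orbit (φ.symm z') 1) (mem_extChartAt_source (1 : G))
    (by rw [act_one]; exact φ.map_target hz')
  rw [bwd_self, ContinuousLinearMap.comp_id, act_one] at h1
  have h3 : HasFDerivAt (fun y : EG => (z', y)) (ContinuousLinearMap.inr ℝ EQ EG) (ψ 1) := by
    exact (hasFDerivAt_const (𝕜 := ℝ) z' (ψ 1)).prodMk (hasFDerivAt_id (𝕜 := ℝ) (ψ 1))
  have h4 := (((ha z' hz').differentiableAt (by simp)).hasFDerivAt.comp (ψ 1) h3).fderiv
  exact h1.trans h4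

namespace PrincipalConnection

variable (A : PrincipalConnection EQ Q EG G)

/-- The connection form in the chart around `q₀`. -/
def coord (q₀ : Q) (z : EQ) : EQ →L[ℝ] EG :=
  (A.val ((extChartAt 𝓘(ℝ, EQ) q₀).symm z)) ∘L (bwd (E := EQ) q₀ z)

theorem contDiffAt_coord {q₀ : Q} {z : EQ} (hz : z ∈ (extChartAt 𝓘(ℝ, EQ) q₀).target) :
    ContDiffAt ℝ ∞ (A.coord q₀) z :=
  (A.smooth q₀).contDiffAt ((isOpen_extChartAt_target q₀).mem_nhds hz)

theorem val_eq_coord {q₀ q : Q} (hq : q ∈ (extChartAt 𝓘(ℝ, EQ) q₀).source) (u : EQ) :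
    A.val q u = A.coord q₀ (extChartAt 𝓘(ℝ, EQ) q₀ q) (fwd (E := EQ) q₀ q u) := by
  rw [coord, ContinuousLinearMap.comp_apply, (extChartAt 𝓘(ℝ, EQ) q₀).left_inv hq, bwd_fwd hq]

theorem coord_genCoord {q₀ : Q} {z : EQ} (hz : z ∈ (extChartAt 𝓘(ℝ, EQ) q₀).target) (ξ : EG) :
    A.coord q₀ z (genCoord EQ EG G q₀ z ξ) = ξ := by
  have h := A.val_eq_coord ((extChartAt 𝓘(ℝ, EQ) q₀).map_target hz)
    (genVal EQ EG G ((extChartAt 𝓘(ℝ, EQ) q₀).symm z) ξ)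
  rw [A.val_gen, (extChartAt 𝓘(ℝ, EQ) q₀).right_inv hz] at h
  exact h.symm

/-- The exterior derivative of the connection form, with tangent spaces identified with the model
spaces. -/
def extVal (q : Q) (u w : EQ) : EG :=
  fderiv ℝ (A.coord q) (extChartAt 𝓘(ℝ, EQ) q q) u w -
    fderiv ℝ (A.coord q) (extChartAt 𝓘(ℝ, EQ) q q) w u

theorem extDer_eq (q : Q) (u w : EQ) : (A.extDer q u w : EG) = A.extVal q u w := by
  have h : (A.extDer q u w : EG) = A.extVal q (fwd (E := EQ) q q u) (fwd (E := EQ) q q w) := rfl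
  rw [h, fwd_self]
  rfl

theorem extVal_swap (q : Q) (u w : EQ) : A.extVal q u w = - A.extVal q w u := by
  simp [extVal]

theorem extVal_sub (q : Q) (u w w' : EQ) :
    A.extVal q u (w - w') = A.extVal q u w - A.extVal q u w' := by
  simp only [extVal, map_sub, sub_apply]
  abel

theorem val_transl_eq_zero (q : Q) (g : G) {u : EQ} (hu : A.val q u = 0) :
    A.val (q <• g) (translVal EQ g q u) = 0 := by
  have h : A.val (q <• g) (translVal EQ g q u) =
      tmap (E := EG) (E' := EG) (fun h : G => g⁻¹ * h * g⁻¹⁻¹) 1 (A.val q u) := A.equivariant q g u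
  rw [h, hu, map_zero]

/-- Contractions of the exterior derivative of the connection form with generators vanish on
horizontal vectors. -/
theorem extVal_gen (hπ : IsPrincipalBundle EQ ES EG G π) (q : Q) (ξ : EG) {u : EQ}
    (hu : A.val q u = 0) : A.extVal q (genVal EQ EG G q ξ) u = 0 := by
  set φ := extChartAt 𝓘(ℝ, EQ) q with hφ
  have hz₀ : φ q ∈ φ.target := mem_extChartAt_target q
  have hcs := eventually_contMDiffAt_chartCurve q u
  have hcu := tmap_chartCurve q u
  have hc0 := chartCurve_zero q u
  generalize chartCurve q u = c at hcs hcu hc0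
  -- Any curve through `1` with velocity `ξ` does; a one-parameter subgroup is not required.
  have hγs := eventually_contMDiffAt_chartCurve (1 : G) ξ
  have hγξ := tmap_chartCurve (1 : G) ξ
  have hγ0 := chartCurve_zero (1 : G) ξ
  generalize chartCurve (1 : G) ξ = γ at hγs hγξ hγ0
  -- The surface swept out when a curve with velocity `u` is translated by `γ`. At the origin its
  -- two partial velocities are `ξ_Q` and `u`.
  let σ : ℝ × ℝ → EQ := fun p => φ (c p.2 <• γ p.1)
  have hpair : ContMDiffAt 𝓘(ℝ, ℝ × ℝ) (𝓘(ℝ, EQ).prod 𝓘(ℝ, EG)) ∞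
      (fun p : ℝ × ℝ => (c p.2, γ p.1)) (0, 0) := by
    refine ContMDiffAt.prodMk ?_ ?_
    · exact ContMDiffAt.comp (I' := 𝓘(ℝ, ℝ)) (g := c) ((0 : ℝ), (0 : ℝ)) hcs.self_of_nhds
        contDiffAt_snd.contMDiffAt
    · exact ContMDiffAt.comp (I' := 𝓘(ℝ, ℝ)) (g := γ) ((0 : ℝ), (0 : ℝ)) hγs.self_of_nhds
        contDiffAt_fst.contMDiffAt
  have hprod : ContMDiffAt 𝓘(ℝ, ℝ × ℝ) 𝓘(ℝ, EQ) ∞ (fun p : ℝ × ℝ => c p.2 <• γ p.1) (0, 0) :=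
    ContMDiffAt.comp ((0 : ℝ), (0 : ℝ)) (hπ.smooth_act _) hpair
  have h00 : c 0 <• γ 0 = q := by rw [hγ0, hc0, act_one]
  have hσ : ContDiffAt ℝ ∞ σ (0, 0) := by
    rw [← contMDiffAt_iff_contDiffAt]
    refine ContMDiffAt.comp (I' := 𝓘(ℝ, EQ)) ((0 : ℝ), (0 : ℝ)) (contMDiffAt_chart ?_) hprod
    rw [h00]
    exact mem_extChartAt_source q
  have hσ0 : σ (0, 0) = φ q := by
    change φ (c 0 <• γ 0) = φ q
    rw [h00]
  have hev : ∀ᶠ p : ℝ × ℝ in 𝓝 (0, 0), DifferentiableAt ℝ σ p ∧ c p.2 <• γ p.1 ∈ φ.source := by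
    refine Filter.Eventually.and ?_ ?_
    · filter_upwards [(hσ.of_le (m := 1) (by simp)).eventually (by simp)] with p hp
      exact hp.differentiableAt (by simp)
    · refine hprod.continuousAt.eventually ((isOpen_extChartAt_source q).eventually_mem ?_)
      change c 0 <• γ 0 ∈ _
      rw [h00]
      exact mem_extChartAt_source q
  have hev1 : ∀ᶠ r : ℝ in 𝓝 0, DifferentiableAt ℝ σ (0, r) ∧ c r <• γ 0 ∈ φ.source :=
    (Continuous.prodMk_right (0 : ℝ)).continuousAt.eventually hev
  have hev2 : ∀ᶠ ε : ℝ in 𝓝 0, DifferentiableAt ℝ σ (ε, 0) ∧ c 0 <• γ ε ∈ φ.source :=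
    (Continuous.prodMk_left (0 : ℝ)).continuousAt.eventually hev
  have hγd : MDifferentiableAt 𝓘(ℝ, ℝ) 𝓘(ℝ, EG) γ 0 :=
    hγs.self_of_nhds.mdifferentiableAt (by simp)
  have hcd : MDifferentiableAt 𝓘(ℝ, ℝ) 𝓘(ℝ, EQ) c 0 :=
    hcs.self_of_nhds.mdifferentiableAt (by simp)
  have hε : ∀ᶠ r : ℝ in 𝓝 0, fderiv ℝ σ (0, r) (1, 0) =
      fwd (E := EQ) q (c r) (genVal EQ EG G (c r) ξ) ∧ c r ∈ φ.source := by
    filter_upwards [hev1] with r hr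
    obtain ⟨hd, hs⟩ := hr
    have hs' : c r ∈ φ.source := by rwa [hγ0, act_one] at hs
    refine ⟨?_, hs'⟩
    have hline : HasDerivAt (fun ε : ℝ => (ε, r)) ((1 : ℝ), (0 : ℝ)) 0 :=
      (hasDerivAt_id (0 : ℝ)).prodMk (hasDerivAt_const (0 : ℝ) r)
    have h1 := (hd.hasFDerivAt.comp_hasDerivAt (0 : ℝ) hline).deriv
    have ho : MDifferentiableAt 𝓘(ℝ, EG) 𝓘(ℝ, EQ) (fun g : G => c r <• g) (γ 0) :=
      hπ.mdifferentiableAt_orbit _ _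
    have h2 := fwd_tmap_curve (E := EQ) (q₀ := q) (c := fun ε => c r <• γ ε) (t := 0)
      (ho.comp (0 : ℝ) hγd) hs
    have h3 := DFunLike.congr_fun (tmap_comp (E := ℝ) (E' := EG) (E'' := EQ) ho hγd) 1
    rw [ContinuousLinearMap.comp_apply, hγ0] at h3
    rw [h3, hγξ, hγ0, act_one] at h2
    exact h1.symm.trans h2.symm
  -- By equivariance the translates of the horizontal vector `u` are horizontal, so the quantity
  -- differentiated in the pullback formula is identically zero.
  have hr : ∀ᶠ ε : ℝ in 𝓝 0,
      A.coord q (σ (ε, 0)) (fderiv ℝ σ (ε, 0) (0, 1)) = 0 := by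
    filter_upwards [hev2] with ε hε
    obtain ⟨hd, hs⟩ := hε
    have hline : HasDerivAt (fun r : ℝ => (ε, r)) ((0 : ℝ), (1 : ℝ)) 0 :=
      (hasDerivAt_const (0 : ℝ) ε).prodMk (hasDerivAt_id (0 : ℝ))
    have h1 := (hd.hasFDerivAt.comp_hasDerivAt (0 : ℝ) hline).deriv
    have ho : MDifferentiableAt 𝓘(ℝ, EQ) 𝓘(ℝ, EQ) (fun q : Q => q <• γ ε) (c 0) :=
      hπ.mdifferentiableAt_transl _ _
    have h2 := fwd_tmap_curve (E := EQ) (q₀ := q) (c := fun r => c r <• γ ε) (t := 0)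
      (ho.comp (0 : ℝ) hcd) hs
    have h3 := DFunLike.congr_fun (tmap_comp (E := ℝ) (E' := EQ) (E'' := EQ) ho hcd) 1
    rw [ContinuousLinearMap.comp_apply, hcu] at h3
    rw [h3] at h2
    rw [← h1]
    have h4 := A.val_eq_coord hs (translVal EQ (γ ε) (c 0) u)
    rw [A.val_transl_eq_zero (c 0) (γ ε) (by rw [hc0]; exact hu)] at h4
    rw [h4]
    exact congrArg _ h2.symm
  have hα : DifferentiableAt ℝ (A.coord q) (σ (0, 0)) := by
    rw [hσ0]
    exact (A.contDiffAt_coord hz₀).differentiableAt (by simp)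
  have key := hasDerivAt_pullback_form hσ hα
  have hzero : (fun ε : ℝ => (A.coord q (σ (ε, 0))) ∘L (fderiv ℝ σ (ε, 0)) ∘L
      (ContinuousLinearMap.inr ℝ ℝ ℝ)) =ᶠ[𝓝 0] fun _ => 0 := by
    filter_upwards [hr] with ε hε
    ext
    simpa using hε
  -- Along `ε = 0` the `ε`-velocity is the generator of `ξ`, whose value under the connection form
  -- is the constant `ξ`. Only the `dA` term of the pullback formula is left.
  have hD : fderiv ℝ (fun r => A.coord q (σ (0, r)) (fderiv ℝ σ (0, r) (1, 0))) 0 = 0 := by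
    have : (fun r => A.coord q (σ (0, r)) (fderiv ℝ σ (0, r) (1, 0))) =ᶠ[𝓝 0] fun _ => ξ := by
      filter_upwards [hε] with r hr
      have h4 := A.val_eq_coord hr.2 (genVal EQ EG G (c r) ξ)
      rw [A.val_gen] at h4
      have h5 : σ (0, r) = φ (c r) := by
        change φ (c r <• γ 0) = φ (c r)
        rw [hγ0, act_one]
      rw [hr.1, h5]
      exact h4.symm
    rw [this.fderiv_eq, fderiv_const_apply]
  have hu' : fderiv ℝ σ (0, 0) (0, 1) = u := by
    obtain ⟨hd, hs⟩ := hev2.self_of_nhds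
    have hline : HasDerivAt (fun r : ℝ => ((0 : ℝ), r)) ((0 : ℝ), (1 : ℝ)) 0 :=
      (hasDerivAt_const (0 : ℝ) (0 : ℝ)).prodMk (hasDerivAt_id (0 : ℝ))
    have h1 := (hd.hasFDerivAt.comp_hasDerivAt (0 : ℝ) hline).deriv
    have h2 : (fun r => σ (0, r)) = fun r => φ (c r) := by
      funext r
      change φ (c r <• γ 0) = φ (c r)
      rw [hγ0, act_one]
    have h3 := fwd_tmap_curve (E := EQ) (q₀ := q) (c := c) (t := 0) hcd
      (by rw [hc0]; exact mem_extChartAt_source q)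
    rw [hcu, hc0, fwd_self] at h3
    rw [← h1, Function.comp_def, h2]
    exact h3.symm
  have hg : fderiv ℝ σ (0, 0) (1, 0) = genVal EQ EG G q ξ := by
    have := hε.self_of_nhds.1
    rw [hc0, fwd_self] at this
    exact this
  have h := key.unique ((hasDerivAt_const (0 : ℝ) _).congr_of_eventuallyEq hzero)
  rw [hD, zero_add, hg, hσ0] at h
  have h1 := DFunLike.congr_fun h 1
  simp only [ContinuousLinearMap.comp_apply, ContinuousLinearMap.inr_apply, hu',
    sub_apply, ContinuousLinearMap.flip_apply, zero_apply] at h1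
  exact h1

end PrincipalConnection

end Generators

/-! ### The vertical Lagrangian -/

section Vertical

variable {n : ℕ} {N : Type*} [TopologicalSpace N] [ChartedSpace (EuclideanSpace ℝ (Fin n)) N]
  [IsManifold (𝓡 n) ∞ N]
  {EQ : Type*} [NormedAddCommGroup EQ] [NormedSpace ℝ EQ]
  {Q : Type*} [TopologicalSpace Q] [ChartedSpace EQ Q] [IsManifold 𝓘(ℝ, EQ) ∞ Q]
  {ES : Type*} [NormedAddCommGroup ES] [NormedSpace ℝ ES]
  {S : Type*} [TopologicalSpace S] [ChartedSpace ES S]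
  {EG : Type*} [NormedAddCommGroup EG] [NormedSpace ℝ EG]
  {G : Type*} [TopologicalSpace G] [ChartedSpace EG G] [Group G] [LieGroup 𝓘(ℝ, EG) ∞ G]
  [MulAction Gᵐᵒᵖ Q] {π : Q → S}

local notation "𝔼" => EuclideanSpace ℝ (Fin n)

/-- Noether's theorem: for an invariant Lagrangian, the Euler–Lagrange form on generators is the
divergence of the momentum. -/
theorem elVal_gen (v : VolumeForm n N) (hπ : IsPrincipalBundle EQ ES EG G π)
    {L : Lagrangian n N EQ Q} (hL : SmoothLagrangian L) (hinv : GInvariant G L) {s : N → Q}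
    (hs : ContMDiff (𝓡 n) 𝓘(ℝ, EQ) ∞ s) (x : N) (ξ : EG) :
    elVal v L s x (genVal EQ EG G (s x) ξ) = - divVal v (fun x' =>
      fiberVal L x' (s x') (tmap (E := 𝔼) (E' := EQ) s x') (genVal EQ EG G (s x') ξ)) x := by
  have hγs := eventually_contMDiffAt_chartCurve (1 : G) ξ
  have hγξ := tmap_chartCurve (1 : G) ξ
  have hγ0 := chartCurve_zero (1 : G) ξ
  generalize chartCurve (1 : G) ξ = γ at hγs hγξ hγ0
  -- The whole map is translated by `γ`. This variation need not have compact support and is smooth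
  -- only for small `ε`, which is all the first variation formula asks for.
  obtain ⟨T, hT⟩ : ∃ T : ℝ → N → Q, T = fun ε x => s x <• γ ε := ⟨_, rfl⟩
  have hT0 : T 0 = s := by
    funext x
    rw [hT]
    change s x <• γ 0 = s x
    rw [hγ0, act_one]
  have hTs : SmoothFamilyNear (n := n) (E := EQ) T 0 x := by
    have h1 : ∀ᶠ p : ℝ × N in 𝓝 (0, x), ContMDiffAt 𝓘(ℝ, ℝ) 𝓘(ℝ, EG) ∞ γ p.1 :=
      continuousAt_fst.eventually hγs
    filter_upwards [h1] with p hp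
    rw [hT]
    have h2 : ContMDiffAt (𝓘(ℝ, ℝ).prod (𝓡 n)) (𝓘(ℝ, EQ).prod 𝓘(ℝ, EG)) ∞
        (fun p : ℝ × N => (s p.2, γ p.1)) p :=
      ((hs.comp contMDiff_snd) p).prodMk (ContMDiffAt.comp (g := γ) p hp contMDiffAt_fst)
    exact ContMDiffAt.comp p (hπ.smooth_act _) h2
  have hvar : ∀ x, variation (E := EQ) T x = genVal EQ EG G (s x) ξ := by
    intro x
    have ho : MDifferentiableAt 𝓘(ℝ, EG) 𝓘(ℝ, EQ) (fun g : G => s x <• g) (γ 0) :=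
      hπ.mdifferentiableAt_orbit _ _
    have h3 := DFunLike.congr_fun (tmap_comp (E := ℝ) (E' := EG) (E'' := EQ) ho
      (hγs.self_of_nhds.mdifferentiableAt (by simp))) 1
    rw [ContinuousLinearMap.comp_apply, hγ0, hγξ] at h3
    rw [variation, hT]
    exact h3
  -- By invariance the Lagrangian is constant along the family, so the first variation is zero.
  have hconst : ∀ ε, lagVal L x (T ε x) (tmap (E := 𝔼) (E' := EQ) (T ε) x) =
      lagVal L x (s x) (tmap (E := 𝔼) (E' := EQ) s x) := by
    intro ε
    have h := tmap_comp (E := 𝔼) (E' := EQ) (E'' := EQ) (g := fun q : Q => q <• γ ε) (f := s)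
      (x := x) (hπ.mdifferentiableAt_transl _ _) (hs.mdifferentiableAt (by simp))
    rw [hT]
    change lagVal L x (s x <• γ ε) (tmap (E := 𝔼) (E' := EQ) (fun x => s x <• γ ε) x) = _
    rw [h]
    exact hinv (γ ε) x (s x) _
  have key := hasDerivAt_lagVal v hL hTs
  simp only [hconst] at key
  have h := key.unique (hasDerivAt_const (0 : ℝ) _)
  rw [hvar] at h
  have hm : momentumField L T = fun x' =>
      fiberVal L x' (s x') (tmap (E := 𝔼) (E' := EQ) s x') (genVal EQ EG G (s x') ξ) := by
    funext x'
    rw [momentumField, hvar, hT0]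
  rw [hm, hT0] at h
  linarith

theorem lagVal_verProj (A : PrincipalConnection EQ Q EG G) {L : Lagrangian n N EQ Q}
    (hver : ∀ x q j, L x q ((A.verProj q) ∘L j) = L x q j) (x : N) (q : Q) (j : 𝔼 →L[ℝ] EQ) :
    lagVal L x q j = lagVal L x q ((genVal EQ EG G q) ∘L ((A.val q) ∘L j)) :=
  (hver x q j).symm

/-- Adding a tensor with values in horizontal vectors does not change `A ∘ j`, the only part of `j`
on which `L` depends. -/
theorem fiberVal_horizontal (A : PrincipalConnection EQ Q EG G) {L : Lagrangian n N EQ Q}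
    (hver : ∀ x q j, L x q ((A.verProj q) ∘L j) = L x q j) (x : N) (q : Q) (j : 𝔼 →L[ℝ] EQ)
    {c : EQ} (hc : A.val q c = 0) : fiberVal L x q j c = 0 := by
  rw [fiberVal_eq]
  refine Finset.sum_eq_zero fun i _ => ?_
  have h : (fun ε : ℝ => lagVal L x q (j + ε • dualTensor i c)) = fun _ => lagVal L x q j := by
    funext ε
    rw [lagVal_verProj A hver, lagVal_verProj A hver x q j]
    congr 2
    ext w
    simp [hc]
  rw [h, deriv_const, zero_smul]

/-- The function `(q, ξ) ↦ L(ξ_Q(q))` in the chart around `q₀`. -/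
def vertCoord (L : Lagrangian n N EQ Q) (x : N) (q₀ : Q) (p : EQ × (𝔼 →L[ℝ] EG)) : ℝ :=
  lagVal L x ((extChartAt 𝓘(ℝ, EQ) q₀).symm p.1)
    ((genVal EQ EG G ((extChartAt 𝓘(ℝ, EQ) q₀).symm p.1)) ∘L p.2)

theorem contDiffAt_vertCoord (hπ : IsPrincipalBundle EQ ES EG G π) {L : Lagrangian n N EQ Q}
    (hL : SmoothLagrangian L) (x : N) {q₀ : Q} {p : EQ × (𝔼 →L[ℝ] EG)}
    (hp : p.1 ∈ (extChartAt 𝓘(ℝ, EQ) q₀).target) :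
    ContDiffAt ℝ ∞ (vertCoord (G := G) L x q₀) p := by
  set φ := extChartAt 𝓘(ℝ, EQ) q₀ with hφ
  have h1 : ContDiffAt ℝ ∞ (fun p : EQ × (𝔼 →L[ℝ] EG) => coordLag L x q₀
      ((extChartAt (𝓡 n) x x, p.1), (genCoord EQ EG G q₀ p.1) ∘L p.2)) p := by
    have hg : ContDiffAt ℝ ∞ (fun p : EQ × (𝔼 →L[ℝ] EG) => genCoord EQ EG G q₀ p.1) p :=
      ContDiffAt.comp p (hπ.contDiffAt_genCoord hp) contDiffAt_fst
    have hJ : ContDiffAt ℝ ∞ (fun p : EQ × (𝔼 →L[ℝ] EG) => (genCoord EQ EG G q₀ p.1) ∘L p.2) p :=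
      hg.clm_comp contDiffAt_snd
    exact ContDiffAt.comp p (hL.contDiffAt (mem_extChartAt_target x) hp)
      ((contDiffAt_const.prodMk contDiffAt_fst).prodMk hJ)
  refine h1.congr_of_eventuallyEq ?_
  filter_upwards [continuousAt_fst.eventually ((isOpen_extChartAt_target q₀).eventually_mem hp)]
    with p' hp'
  rw [vertCoord, lagVal_eq_coordLag L (mem_extChartAt_source x) (φ.map_target hp'), bwd_self,
    φ.right_inv hp']
  rfl

/-- The Euler–Lagrange form of a vertical Lagrangian along a family with horizontal variation. -/
theorem elVal_variation_horizontal (v : VolumeForm n N) (hπ : IsPrincipalBundle EQ ES EG G π)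
    (A : PrincipalConnection EQ Q EG G) {L : Lagrangian n N EQ Q} (hL : SmoothLagrangian L)
    (hver : ∀ x q j, L x q ((A.verProj q) ∘L j) = L x q j) {T : ℝ → N → Q} {x : N}
    (hT : SmoothFamilyNear (n := n) (E := EQ) T 0 x)
    (hhor : ∀ᶠ x' in 𝓝 x, A.val (T 0 x') (variation (E := EQ) T x') = 0)
    {ξ' : 𝔼 →L[ℝ] EG}
    (hξ' : ∀ w, ξ' w = A.extVal (T 0 x) (variation (E := EQ) T x)
      (tmap (E := 𝔼) (E' := EQ) (T 0) x w)) :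
    elVal v L (T 0) x (variation (E := EQ) T x) =
      fderiv ℝ (vertCoord (G := G) L x (T 0 x)) (extChartAt 𝓘(ℝ, EQ) (T 0 x) (T 0 x),
        (A.val (T 0 x)) ∘L (tmap (E := 𝔼) (E' := EQ) (T 0) x)) (variation (E := EQ) T x, ξ') := by
  set q₀ := T 0 x with hq₀
  set φ := extChartAt 𝓘(ℝ, EQ) q₀ with hφ
  set y₀ := extChartAt (𝓡 n) x x with hy₀
  set σ := coordFam (n := n) (E := EQ) T x q₀ with hσdef
  have hxs := mem_extChartAt_source (I := 𝓡 n) x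
  have hqs := mem_extChartAt_source (I := 𝓘(ℝ, EQ)) q₀
  have hT0 := hT.self_of_nhds
  have hσ : ContDiffAt ℝ ∞ σ (0, y₀) := contDiffAt_coordFam hT0 hxs hqs
  have hσ0 : σ (0, y₀) = φ q₀ := by
    simp only [hσdef, coordFam, hy₀, (extChartAt (𝓡 n) x).left_inv hxs]
    rfl
  have hα : DifferentiableAt ℝ (A.coord q₀) (σ (0, y₀)) := by
    rw [hσ0]
    exact (A.contDiffAt_coord (mem_extChartAt_target q₀)).differentiableAt (by simp)
  have hu : fderiv ℝ σ (0, y₀) (1, 0) = variation (E := EQ) T x := by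
    have h := fwd_variation (E := EQ) hT0 hxs hqs
    rw [← hq₀, fwd_self] at h
    exact h.symm
  have hj0 := jetCoord_coordFam (E := EQ) hT0 hxs hqs
  have hj : (fderiv ℝ σ (0, y₀)) ∘L (ContinuousLinearMap.inr ℝ ℝ 𝔼) =
      tmap (E := 𝔼) (E' := EQ) (T 0) x := by
    have h := congrArg Prod.snd hj0
    rw [← hq₀, fwd_self, bwd_self] at h
    exact h
  -- Horizontality of the variation on a whole neighbourhood is used here: `A(∂σ/∂ε)` vanishes near
  -- `y₀`, hence so does its derivative, and `A(∂σ/∂y)` varies by `dA` alone.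
  have hD : fderiv ℝ (fun y => A.coord q₀ (σ (0, y)) (fderiv ℝ σ (0, y) (1, 0))) y₀ = 0 := by
    have hq : ∀ᶠ x' in 𝓝 x, T 0 x' ∈ φ.source :=
      (ContMDiffAt.continuousAt_slice hT0).eventually ((isOpen_extChartAt_source q₀).mem_nhds hqs)
    have : (fun y => A.coord q₀ (σ (0, y)) (fderiv ℝ σ (0, y) (1, 0))) =ᶠ[𝓝 y₀] fun _ => 0 := by
      filter_upwards [eventually_chart_symm hxs (hhor.and (hq.and (hT.eventually_slice.and
        ((isOpen_extChartAt_source (I := 𝓡 n) x).eventually_mem hxs))))] with y hy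
      obtain ⟨hyt, h1, h2, h3, h4⟩ := hy
      have h5 := fwd_variation (E := EQ) (q₀ := q₀) h3 h4 h2
      rw [(extChartAt (𝓡 n) x).right_inv hyt] at h5
      rw [hσdef, ← h5]
      rw [A.val_eq_coord h2] at h1
      exact h1
    rw [this.fderiv_eq, fderiv_const_apply]
  have key := hasDerivAt_pullback_form hσ hα
  rw [hD, zero_add, hu, hj, hσ0] at key
  have hξ'' : (fderiv ℝ (A.coord q₀) (φ q₀) (variation (E := EQ) T x) -
      (fderiv ℝ (A.coord q₀) (φ q₀)).flip (variation (E := EQ) T x)) ∘L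
        (tmap (E := 𝔼) (E' := EQ) (T 0) x) = ξ' := by
    ext w
    rw [hξ' w]
    rfl
  rw [hξ''] at key
  have hline : HasDerivAt (fun ε : ℝ => (ε, y₀)) ((1 : ℝ), (0 : 𝔼)) 0 :=
    (hasDerivAt_id (0 : ℝ)).prodMk (hasDerivAt_const (0 : ℝ) y₀)
  have hz : HasDerivAt (fun ε : ℝ => σ (ε, y₀)) (variation (E := EQ) T x) 0 := by
    rw [← hu]
    exact (hσ.differentiableAt (by simp)).hasFDerivAt.comp_hasDerivAt (0 : ℝ) hline
  have hp0 : (σ (0, y₀), (A.coord q₀ (σ (0, y₀))) ∘L (fderiv ℝ σ (0, y₀)) ∘L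
      (ContinuousLinearMap.inr ℝ ℝ 𝔼)) =
      (φ q₀, (A.val q₀) ∘L (tmap (E := 𝔼) (E' := EQ) (T 0) x)) := by
    rw [hj, hσ0]
    congr 1
    ext w
    rw [ContinuousLinearMap.comp_apply, ContinuousLinearMap.comp_apply, A.val_eq_coord hqs,
      fwd_self]
    rfl
  have hΦ : HasFDerivAt (vertCoord (G := G) L x q₀) (fderiv ℝ (vertCoord (G := G) L x q₀)
      (φ q₀, (A.val q₀) ∘L (tmap (E := 𝔼) (E' := EQ) (T 0) x)))
      (σ (0, y₀), (A.coord q₀ (σ (0, y₀))) ∘L (fderiv ℝ σ (0, y₀)) ∘L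
        (ContinuousLinearMap.inr ℝ ℝ 𝔼)) := by
    rw [hp0]
    exact ((contDiffAt_vertCoord hπ hL x (mem_extChartAt_target q₀)).differentiableAt
      (by simp)).hasFDerivAt
  have h1 := hΦ.comp_hasDerivAt (0 : ℝ) (hz.prodMk key)
  have hev : ∀ᶠ ε : ℝ in 𝓝 0, ContMDiffAt (𝓘(ℝ, ℝ).prod (𝓡 n)) 𝓘(ℝ, EQ) ∞
      (fun p : ℝ × N => T p.1 p.2) (ε, x) ∧ T ε x ∈ φ.source :=
    (Continuous.prodMk_left x).continuousAt.eventually (hT.and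
      (hT0.continuousAt.eventually ((isOpen_extChartAt_source q₀).eventually_mem hqs)))
  have h2 := hasDerivAt_lagVal v hL hT
  -- Verticality of `L` expresses it along the family through the base point and `A` of the tangent
  -- map, the two quantities whose velocities are now known.
  have h3 : (fun ε => lagVal L x (T ε x) (tmap (E := 𝔼) (E' := EQ) (T ε) x)) =ᶠ[𝓝 0]
      (vertCoord (G := G) L x q₀) ∘ fun ε => (σ (ε, y₀), (A.coord q₀ (σ (ε, y₀))) ∘L
        (fderiv ℝ σ (ε, y₀)) ∘L (ContinuousLinearMap.inr ℝ ℝ 𝔼)) := by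
    filter_upwards [hev] with ε hε
    obtain ⟨hs, hq⟩ := hε
    have h := jetCoord_coordFam (E := EQ) (q₀ := q₀) hs hxs hq
    have ha : σ (ε, y₀) = φ (T ε x) := congrArg (fun p => p.1.2) h
    have hb : (fderiv ℝ σ (ε, y₀)) ∘L (ContinuousLinearMap.inr ℝ ℝ 𝔼) =
        (fwd (E := EQ) q₀ (T ε x)) ∘L (tmap (E := 𝔼) (E' := EQ) (T ε) x) := by
      have h' := congrArg Prod.snd h
      rw [bwd_self] at h'
      exact h'
    simp only [Function.comp_apply, vertCoord]
    rw [hb, ha, φ.left_inv hq, lagVal_verProj A hver]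
    congr 2
    ext w
    simp only [ContinuousLinearMap.comp_apply]
    exact A.val_eq_coord hq _
  have h4 := (h2.congr_of_eventuallyEq h3.symm).unique h1
  -- The momentum field of a horizontal variation is zero nearby, so the derivative of `L` is the
  -- whole Euler–Lagrange form.
  have h5 : divVal v (momentumField L T) x = 0 := by
    refine divVal_eq_zero v ?_
    filter_upwards [hhor] with x' hx'
    exact fiberVal_horizontal A hver x' _ _ hx'
  rw [h5, add_zero] at h4
  exact h4

end Vertical

/-! ### The horizontal force -/

section HorizontalForce

variable {n : ℕ} {N : Type*} [TopologicalSpace N] [ChartedSpace (EuclideanSpace ℝ (Fin n)) N]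
  [IsManifold (𝓡 n) ∞ N]
  {EQ : Type*} [NormedAddCommGroup EQ] [NormedSpace ℝ EQ]
  {Q : Type*} [TopologicalSpace Q] [ChartedSpace EQ Q] [IsManifold 𝓘(ℝ, EQ) ∞ Q]
  {ES : Type*} [NormedAddCommGroup ES] [NormedSpace ℝ ES]
  {S : Type*} [TopologicalSpace S] [ChartedSpace ES S]
  {EG : Type*} [NormedAddCommGroup EG] [NormedSpace ℝ EG]
  {G : Type*} [TopologicalSpace G] [ChartedSpace EG G] [Group G] [LieGroup 𝓘(ℝ, EG) ∞ G]
  [MulAction Gᵐᵒᵖ Q] {π : Q → S}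

local notation "𝔼" => EuclideanSpace ℝ (Fin n)

/-- A horizontal vector at `s x` extends to a family with horizontal variation near `x`. -/
theorem exists_horizontal_family (hπ : IsPrincipalBundle EQ ES EG G π)
    (A : PrincipalConnection EQ Q EG G) {s : N → Q} (hs : ContMDiff (𝓡 n) 𝓘(ℝ, EQ) ∞ s) (x : N)
    {u : EQ} (hu : A.val (s x) u = 0) :
    ∃ T : ℝ → N → Q, SmoothFamilyNear (n := n) (E := EQ) T 0 x ∧ T 0 = s ∧
      variation (E := EQ) T x = u ∧
      ∀ᶠ x' in 𝓝 x, A.val (T 0 x') (variation (E := EQ) T x') = 0 := by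
  classical
  set q₀ := s x with hq₀
  set φ := extChartAt 𝓘(ℝ, EQ) q₀ with hφ
  have hqs : q₀ ∈ φ.source := mem_extChartAt_source q₀
  -- The horizontal projection of the constant field `u` of the chart; it is still `u` at the
  -- centre, where `u` is already horizontal.
  obtain ⟨X, hX⟩ : ∃ X : EQ → EQ, X = fun z => u - genCoord EQ EG G q₀ z (A.coord q₀ z u) :=
    ⟨_, rfl⟩
  have hXs : ∀ z ∈ φ.target, ContDiffAt ℝ ∞ X z := by
    intro z hz
    rw [hX]
    exact contDiffAt_const.sub ((hπ.contDiffAt_genCoord hz).clm_apply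
      ((A.contDiffAt_coord hz).clm_apply contDiffAt_const))
  have hXh : ∀ z ∈ φ.target, A.coord q₀ z (X z) = 0 := by
    intro z hz
    rw [hX, map_sub, A.coord_genCoord hz, sub_self]
  have hX0 : X (φ q₀) = u := by
    have h := A.val_eq_coord hqs u
    rw [fwd_self, hu] at h
    have h' : A.coord q₀ (φ q₀) u = 0 := h.symm
    rw [hX]
    simp only [h', map_zero, sub_zero]
  obtain ⟨T, hT⟩ : ∃ T : ℝ → N → Q, T = fun ε x' =>
      if s x' ∈ φ.source then φ.symm (φ (s x') + ε • X (φ (s x'))) else s x' := ⟨_, rfl⟩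
  have hTin : ∀ x', s x' ∈ φ.source → ∀ ε, T ε x' = φ.symm (φ (s x') + ε • X (φ (s x'))) :=
    fun x' hx' ε => by rw [hT]; exact if_pos hx'
  have hT0 : T 0 = s := by
    funext x'
    by_cases hx' : s x' ∈ φ.source
    · rw [hTin x' hx', zero_smul, add_zero, φ.left_inv hx']
    · rw [hT]
      exact if_neg hx'
  have hsrc : ∀ᶠ x' in 𝓝 x, s x' ∈ φ.source :=
    hs.continuous.continuousAt.eventually ((isOpen_extChartAt_source q₀).eventually_mem hqs)
  have hvar : ∀ x', s x' ∈ φ.source →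
      variation (E := EQ) T x' = bwd (E := EQ) q₀ (φ (s x')) (X (φ (s x'))) := by
    intro x' hx'
    have h : (fun ε => T ε x') = fun ε => φ.symm (φ (s x') + ε • X (φ (s x'))) :=
      funext fun ε => hTin x' hx' ε
    rw [variation, h]
    exact tmap_chart_symm_line (φ.map_source hx') _
  refine ⟨T, ?_, hT0, ?_, ?_⟩
  · have hzs : ∀ p : ℝ × N, s p.2 ∈ φ.source → ContMDiffAt (𝓘(ℝ, ℝ).prod (𝓡 n)) 𝓘(ℝ, EQ) ∞
        (fun p : ℝ × N => φ (s p.2) + p.1 • X (φ (s p.2))) p := by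
      intro p hp
      have h1 : ContMDiffAt (𝓘(ℝ, ℝ).prod (𝓡 n)) 𝓘(ℝ, EQ) ∞ (fun p : ℝ × N => φ (s p.2)) p :=
        ContMDiffAt.comp (I' := 𝓘(ℝ, EQ)) (f := fun p : ℝ × N => s p.2) p (contMDiffAt_chart hp)
          ((hs.comp contMDiff_snd) p)
      have h2 : ContMDiffAt (𝓘(ℝ, ℝ).prod (𝓡 n)) 𝓘(ℝ, EQ) ∞ (fun p : ℝ × N => X (φ (s p.2))) p :=
        ContMDiffAt.comp (I' := 𝓘(ℝ, EQ)) (g := X) (f := fun p : ℝ × N => φ (s p.2)) p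
          (hXs _ (φ.map_source hp)).contMDiffAt h1
      exact h1.add (contMDiffAt_fst.smul h2)
    have hsrc' : ∀ᶠ p : ℝ × N in 𝓝 (0, x), s p.2 ∈ φ.source :=
      (continuousAt_snd (p := ((0 : ℝ), x))).eventually hsrc
    have htgt : ∀ᶠ p : ℝ × N in 𝓝 (0, x), φ (s p.2) + p.1 • X (φ (s p.2)) ∈ φ.target := by
      refine (hzs (0, x) hqs).continuousAt.eventually
        ((isOpen_extChartAt_target q₀).eventually_mem ?_)
      change φ q₀ + (0 : ℝ) • X (φ q₀) ∈ φ.target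
      rw [zero_smul, add_zero]
      exact φ.map_source hqs
    filter_upwards [hsrc'.eventually_nhds, htgt] with p hp ht
    have h3 : ContMDiffAt (𝓘(ℝ, ℝ).prod (𝓡 n)) 𝓘(ℝ, EQ) ∞
        (fun p : ℝ × N => φ.symm (φ (s p.2) + p.1 • X (φ (s p.2)))) p :=
      ContMDiffAt.comp (I' := 𝓘(ℝ, EQ)) (f := fun p : ℝ × N => φ (s p.2) + p.1 • X (φ (s p.2))) p
        (contMDiffAt_chart_symm ht) (hzs p hp.self_of_nhds)
    refine h3.congr_of_eventuallyEq ?_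
    filter_upwards [hp] with p' hp'
    exact hTin p'.2 hp' p'.1
  · rw [hvar x hqs, ← hq₀, hX0, bwd_self]
    rfl
  · filter_upwards [hsrc] with x' hx'
    rw [hvar x' hx', hT0]
    have h := hXh _ (φ.map_source hx')
    rw [PrincipalConnection.coord, ContinuousLinearMap.comp_apply, φ.left_inv hx'] at h
    exact h

/-- Together with `nablaBase_eq` this identifies the reduced derivatives with the partial
derivatives of one function: `ξ` moves over a fixed base point here, and the base point moves
horizontally with `ξ` fixed there. -/
theorem adjointDeriv_eq (hπ : IsPrincipalBundle EQ ES EG G π) {L : Lagrangian n N EQ Q}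
    (hL : SmoothLagrangian L) (hinv : GInvariant G L) (x : N) (q : Q) (ξ ζ : 𝔼 →L[ℝ] EG) :
    adjointDeriv (redLagrangian hπ L hinv x) q ξ ζ =
      fderiv ℝ (vertCoord (G := G) L x q) (extChartAt 𝓘(ℝ, EQ) q q, ξ) (0, ζ) := by
  have hline : HasDerivAt (fun ε : ℝ => (extChartAt 𝓘(ℝ, EQ) q q, ξ + ε • ζ))
      ((0 : EQ), ζ) 0 := by
    refine (hasDerivAt_const (0 : ℝ) _).prodMk ?_
    simpa only [one_smul, id_eq] using ((hasDerivAt_id (0 : ℝ)).smul_const ζ).const_add ξ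
  have hΦ : HasFDerivAt (vertCoord (G := G) L x q) (fderiv ℝ (vertCoord (G := G) L x q)
      (extChartAt 𝓘(ℝ, EQ) q q, ξ)) (extChartAt 𝓘(ℝ, EQ) q q, ξ + (0 : ℝ) • ζ) := by
    rw [zero_smul, add_zero]
    exact ((contDiffAt_vertCoord hπ hL x (mem_extChartAt_target q)).differentiableAt
      (by simp)).hasFDerivAt
  have h := (hΦ.comp_hasDerivAt (0 : ℝ) hline).deriv
  rw [← h]
  change deriv (fun ε : ℝ => lagVal L x q ((genVal EQ EG G q) ∘L (ξ + ε • ζ))) 0 = _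
  congr 1
  funext ε
  simp only [Function.comp_apply, vertCoord]
  rw [extChartAt_to_inv (I := 𝓘(ℝ, EQ)) q]

theorem nablaBase_eq (hπ : IsPrincipalBundle EQ ES EG G π) (A : PrincipalConnection EQ Q EG G)
    {L : Lagrangian n N EQ Q} (hL : SmoothLagrangian L) (hinv : GInvariant G L) (x : N) (q : Q)
    (ξ : 𝔼 →L[ℝ] EG) (w : ES) :
    A.nablaBase π (redLagrangian hπ L hinv x) q ξ w =
      fderiv ℝ (vertCoord (G := G) L x q) (extChartAt 𝓘(ℝ, EQ) q q, ξ)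
        (A.lift ES π q w, 0) := by
  set φ := extChartAt 𝓘(ℝ, EQ) q with hφ
  change tmap (E := EQ) (E' := ℝ) (fun q' : Q => lagVal L x q' ((genVal EQ EG G q') ∘L ξ)) q
    (A.lift ES π q w) = _
  have hqs : q ∈ φ.source := mem_extChartAt_source q
  have hin : HasFDerivAt (fun z : EQ => (z, ξ)) (ContinuousLinearMap.inl ℝ EQ (𝔼 →L[ℝ] EG))
      (φ q) :=
    (hasFDerivAt_id (𝕜 := ℝ) (φ q)).prodMk (hasFDerivAt_const (𝕜 := ℝ) ξ (φ q))
  have hΦ₀ : HasFDerivAt (vertCoord (G := G) L x q) (fderiv ℝ (vertCoord (G := G) L x q)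
      (φ q, ξ)) (φ q, ξ) :=
    ((contDiffAt_vertCoord hπ hL x (mem_extChartAt_target q)).differentiableAt
      (by simp)).hasFDerivAt
  have hΦ : HasFDerivAt (fun z => vertCoord (G := G) L x q (z, ξ))
      ((fderiv ℝ (vertCoord (G := G) L x q) (φ q, ξ)) ∘L
        (ContinuousLinearMap.inl ℝ EQ (𝔼 →L[ℝ] EG))) (φ q) :=
    HasFDerivAt.comp (g := vertCoord (G := G) L x q) (f := fun z : EQ => (z, ξ)) (φ q) hΦ₀ hin
  have hcongr : (fun q' : Q => lagVal L x q' ((genVal EQ EG G q') ∘L ξ)) =ᶠ[𝓝 q]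
      fun q' => vertCoord (G := G) L x q (φ q', ξ) := by
    filter_upwards [(isOpen_extChartAt_source (I := 𝓘(ℝ, EQ)) q).eventually_mem hqs] with q' hq'
    simp only [vertCoord]
    rw [(extChartAt 𝓘(ℝ, EQ) q).left_inv hq']
  rw [tmap_congr (E := EQ) (E' := ℝ) hcongr]
  have h := tmap_comp (E := EQ) (E' := EQ) (E'' := ℝ) (f := φ)
    (g := fun z => vertCoord (G := G) L x q (z, ξ)) (x := q)
    hΦ.differentiableAt.mdifferentiableAt (mdifferentiableAt_chart hqs)
  have h2 := DFunLike.congr_fun h (A.lift ES π q w)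
  rw [ContinuousLinearMap.comp_apply, tmap_eq_fderiv, hΦ.fderiv] at h2
  refine h2.trans ?_
  have h3 : tmap (E := EQ) (E' := EQ) φ q = ContinuousLinearMap.id ℝ EQ := fwd_self q
  rw [h3]
  rfl

variable (G) in
/-- The Lie bracket, with the Lie algebra identified with the model space. -/
def lieVal (a b : EG) : EG :=
  let a' : LieAlg EG G := a
  let b' : LieAlg EG G := b
  let c : LieAlg EG G := ⁅a', b'⁆
  c

/-- The bracket in the curvature is only ever evaluated on horizontal lifts, where both arguments
are zero. -/
theorem lieVal_zero : lieVal G (0 : EG) 0 = 0 := by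
  have h : (⁅(0 : LieAlg EG G), (0 : LieAlg EG G)⁆ : LieAlg EG G) = 0 := by
    rw [GroupLieAlgebra.bracket_def]
    simp
  exact h

/-- The reduced curvature, with tangent spaces identified with the model spaces. -/
def PrincipalConnection.redCurvVal (A : PrincipalConnection EQ Q EG G) (π : Q → S) (q : Q)
    (u w : ES) : EG := A.redCurvature ES π q u w

theorem PrincipalConnection.redCurvVal_eq (A : PrincipalConnection EQ Q EG G) (π : Q → S) (q : Q)
    (u w : ES) : A.redCurvVal π q u w = A.extVal q (A.lift ES π q u) (A.lift ES π q w) +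
      lieVal G (A.val q (A.lift ES π q u)) (A.val q (A.lift ES π q w)) := by
  rw [← A.extDer_eq]
  rfl

/-- The lift of `Tπ c` is `c` minus its vertical part, and `extVal_gen` discards that part against
the horizontal `u`. The sign comes from exchanging the arguments of `dA`. -/
theorem redCurvVal_tmap_proj (hπ : IsPrincipalBundle EQ ES EG G π)
    (A : PrincipalConnection EQ Q EG G) (q : Q) (c : EQ) {u : EQ} (hu : A.val q u = 0) :
    A.redCurvVal π q (tmap (E := EQ) (E' := ES) π q c) (tmap (E := EQ) (E' := ES) π q u) =
      - A.extVal q u c := by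
  have h2 := hπ.lift_tmap_proj A q u
  rw [hu, map_zero, sub_zero] at h2
  have h3 : A.val q (c - genVal EQ EG G q (A.val q c)) = 0 := by
    rw [map_sub, A.val_gen, sub_self]
  rw [A.redCurvVal_eq, hπ.lift_tmap_proj A q c, h2, hu, h3, lieVal_zero, add_zero, A.extVal_swap,
    A.extVal_sub, A.extVal_swap q u (genVal EQ EG G q (A.val q c)), A.extVal_gen hπ q _ hu,
    neg_zero, sub_zero]

/-- The contraction puts the jet into the first slot of the curvature, whereas a horizontal
variation produces `dA` with `u` in the first slot; hence the sign. -/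
theorem contrCurvature_eq (hπ : IsPrincipalBundle EQ ES EG G π)
    (A : PrincipalConnection EQ Q EG G) (x : N) (q : Q) (j : 𝔼 →L[ℝ] EQ) {u : EQ}
    (hu : A.val q u = 0) {ξ' : 𝔼 →L[ℝ] EG} (hξ' : ∀ w, ξ' w = A.extVal q u (j w)) :
    (A.contrCurvature (n := n) π (x := x) q ((tmap (E := EQ) (E' := ES) π q) ∘L j)
      (tmap (E := EQ) (E' := ES) π q u) : 𝔼 →L[ℝ] EG) = - ξ' := by
  have h : (A.contrCurvature (n := n) π (x := x) q ((tmap (E := EQ) (E' := ES) π q) ∘L j)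
      (tmap (E := EQ) (E' := ES) π q u) : 𝔼 →L[ℝ] EG) =
      ∑ i : Fin n, dualTensor i (A.redCurvVal π q (tmap (E := EQ) (E' := ES) π q
        (j (stdVec i))) (tmap (E := EQ) (E' := ES) π q u)) := rfl
  rw [h, ← sum_dualTensor ξ', ← Finset.sum_neg_distrib]
  refine Finset.sum_congr rfl fun i _ => ?_
  rw [redCurvVal_tmap_proj hπ A q _ hu, hξ', map_neg]

/-- A jet is recovered from its projection and its connection part, and a horizontal `u` is the lift
of its own projection, so reducing the force loses nothing. -/
theorem redForce_eq (hπ : IsPrincipalBundle EQ ES EG G π) (A : PrincipalConnection EQ Q EG G)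
    (F : Force n N EQ Q) (x : N) (q : Q) (j : 𝔼 →L[ℝ] EQ) {u : EQ} (hu : A.val q u = 0) :
    A.redForce π F x q ((tmap (E := EQ) (E' := ES) π q) ∘L j) ((A.val q) ∘L j)
      (tmap (E := EQ) (E' := ES) π q u) = forceVal F x q j u := by
  have h : A.redForce π F x q ((tmap (E := EQ) (E' := ES) π q) ∘L j) ((A.val q) ∘L j)
      (tmap (E := EQ) (E' := ES) π q u) = forceVal F x q
        ((A.lift ES π q) ∘L ((tmap (E := EQ) (E' := ES) π q) ∘L j) +
          (genVal EQ EG G q) ∘L ((A.val q) ∘L j))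
        (A.lift ES π q (tmap (E := EQ) (E' := ES) π q u) -
          genVal EQ EG G q (A.val q (A.lift ES π q (tmap (E := EQ) (E' := ES) π q u)))) := rfl
  have h2 := hπ.lift_tmap_proj A q u
  rw [hu, map_zero, sub_zero] at h2
  rw [h, h2, hu, map_zero, sub_zero]
  congr 1
  congr 1
  ext w
  simp [hπ.lift_tmap_proj A q]

/-- The horizontal force cancels the horizontal part of the Euler–Lagrange form of `L^v`. -/
theorem elVal_horizontal (v : VolumeForm n N) (hπ : IsPrincipalBundle EQ ES EG G π)
    (A : PrincipalConnection EQ Q EG G) {L : Lagrangian n N EQ Q} (hL : SmoothLagrangian L)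
    (hver : ∀ x q j, L x q ((A.verProj q) ∘L j) = L x q j) (hinv : GInvariant G L)
    {F : Force n N EQ Q}
    (hF : ∀ (x : N) (q : Q)
      (τ : TangentSpace (𝓡 n) x →L[ℝ] TangentSpace 𝓘(ℝ, ES) (π q))
      (ξ : TangentSpace (𝓡 n) x →L[ℝ] LieAlg EG G) (w : TangentSpace 𝓘(ℝ, ES) (π q)),
      A.redForce π F x q τ ξ w =
        - A.nablaBase π (redLagrangian hπ L hinv x) q ξ w +
          adjointDeriv (redLagrangian hπ L hinv x) q ξ (A.contrCurvature π q τ w))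
    {s : N → Q} (hs : ContMDiff (𝓡 n) 𝓘(ℝ, EQ) ∞ s) (x : N) {u : EQ} (hu : A.val (s x) u = 0) :
    elVal v L s x u + forceVal F x (s x) (tmap (E := 𝔼) (E' := EQ) s x) u = 0 := by
  obtain ⟨T, hT, rfl, rfl, hhor⟩ := exists_horizontal_family hπ A hs x hu
  set q := T 0 x with hq
  set j := tmap (E := 𝔼) (E' := EQ) (T 0) x with hj
  set u := variation (E := EQ) T x with hudef
  obtain ⟨ξ', hξ'⟩ : ∃ ξ' : 𝔼 →L[ℝ] EG, ∀ w, ξ' w = A.extVal q u (j w) :=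
    ⟨(fderiv ℝ (A.coord q) (extChartAt 𝓘(ℝ, EQ) q q) u -
      (fderiv ℝ (A.coord q) (extChartAt 𝓘(ℝ, EQ) q q)).flip u) ∘L j, fun w => rfl⟩
  have h1 := elVal_variation_horizontal v hπ A hL hver hT hhor hξ'
  have h2 := hF x q ((tmap (E := EQ) (E' := ES) π q) ∘L j) ((A.val q) ∘L j)
    (tmap (E := EQ) (E' := ES) π q u)
  have h3 := redForce_eq hπ A F x q j hu
  have h4 := nablaBase_eq hπ A hL hinv x q ((A.val q) ∘L j) (tmap (E := EQ) (E' := ES) π q u)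
  have h5 := contrCurvature_eq hπ A x q j hu hξ'
  have h6 := adjointDeriv_eq hπ hL hinv x q ((A.val q) ∘L j) (-ξ')
  have h7 := hπ.lift_tmap_proj A q u
  rw [hu, map_zero, sub_zero] at h7
  rw [h7] at h4
  have h8 := h3.symm.trans (h2.trans (congrArg₂ (fun a b : ℝ => - a + b) h4
    ((congrArg (fun ζ : 𝔼 →L[ℝ] EG =>
      adjointDeriv (redLagrangian hπ L hinv x) q ((A.val q) ∘L j) ζ) h5).trans h6)))
  rw [h1, h8]
  -- The Euler–Lagrange form is the differential of `vertCoord` at `(u, ξ')`; the force is minus its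
  -- value at `(u, 0)` plus its value at `(0, -ξ')`.
  have h9 : ((u, ξ') : EQ × (𝔼 →L[ℝ] EG)) = (u, 0) - (0, -ξ') := by simp
  rw [h9, map_sub]
  ring

end HorizontalForce

/-! ### Un-reduction -/

section Unreduce

variable {n : ℕ} {N : Type*} [TopologicalSpace N] [ChartedSpace (EuclideanSpace ℝ (Fin n)) N]
  [IsManifold (𝓡 n) ∞ N]
  {EQ : Type*} [NormedAddCommGroup EQ] [NormedSpace ℝ EQ]
  {Q : Type*} [TopologicalSpace Q] [ChartedSpace EQ Q] [IsManifold 𝓘(ℝ, EQ) ∞ Q]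
  {ES : Type*} [NormedAddCommGroup ES] [NormedSpace ℝ ES]
  {S : Type*} [TopologicalSpace S] [ChartedSpace ES S] [IsManifold 𝓘(ℝ, ES) ∞ S]
  {EG : Type*} [NormedAddCommGroup EG] [NormedSpace ℝ EG]
  {G : Type*} [TopologicalSpace G] [ChartedSpace EG G] [Group G] [LieGroup 𝓘(ℝ, EG) ∞ G]
  [MulAction Gᵐᵒᵖ Q] {π : Q → S}

local notation "𝔼" => EuclideanSpace ℝ (Fin n)

theorem gInvariant_lift (hπ : IsPrincipalBundle EQ ES EG G π) (l : Lagrangian n N ES S) :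
    GInvariant G (liftLagrangian (EQ := EQ) π l) := by
  intro g x q j
  have h : ∀ j : 𝔼 →L[ℝ] EQ, lagVal l x (π (q <• g))
      ((tmap (E := EQ) (E' := ES) π (q <• g)) ∘L ((translVal EQ g q) ∘L j)) =
      lagVal l x (π q) ((tmap (E := EQ) (E' := ES) π q) ∘L j) := fun j => by
    rw [← ContinuousLinearMap.comp_assoc, hπ.tmap_proj_transl, hπ.proj_act]
  exact h j

theorem liftLagrangian_horProj (hπ : IsPrincipalBundle EQ ES EG G π)
    (A : PrincipalConnection EQ Q EG G) (l : Lagrangian n N ES S) (x : N) (q : Q)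
    (j : TangentSpace (𝓡 n) x →L[ℝ] TangentSpace 𝓘(ℝ, EQ) q) :
    liftLagrangian (EQ := EQ) π l x q ((A.horProj q) ∘L j) = liftLagrangian π l x q j := by
  have h : ∀ j : 𝔼 →L[ℝ] EQ, (tmap (E := EQ) (E' := ES) π q) ∘L
      ((ContinuousLinearMap.id ℝ EQ - (genVal EQ EG G q) ∘L (A.val q)) ∘L j) =
      (tmap (E := EQ) (E' := ES) π q) ∘L j := by
    intro j
    ext w
    simp [hπ.tmap_proj_gen]
  exact congrArg (lagVal l x (π q)) (h j)

/-- The variational equations of `L^h + L^v` with the force `F` are the un-reduced equations. -/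
theorem isCritical_iff_unreducedEquations [T2Space N] [SecondCountableTopology N]
    [MeasurableSpace N] [BorelSpace N] [FiniteDimensional ℝ EQ]
    (v : VolumeForm n N) (hπ : IsPrincipalBundle EQ ES EG G π)
    (A : PrincipalConnection EQ Q EG G) {l : Lagrangian n N ES S} (hl : SmoothLagrangian l)
    {L : Lagrangian n N EQ Q} (hL : SmoothLagrangian L)
    (hver : ∀ x q j, L x q ((A.verProj q) ∘L j) = L x q j) (hinv : GInvariant G L)
    {F : Force n N EQ Q} (hFs : SmoothForce F)
    (hF : ∀ (x : N) (q : Q)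
      (τ : TangentSpace (𝓡 n) x →L[ℝ] TangentSpace 𝓘(ℝ, ES) (π q))
      (ξ : TangentSpace (𝓡 n) x →L[ℝ] LieAlg EG G) (w : TangentSpace 𝓘(ℝ, ES) (π q)),
      A.redForce π F x q τ ξ w =
        - A.nablaBase π (redLagrangian hπ L hinv x) q ξ w +
          adjointDeriv (redLagrangian hπ L hinv x) q ξ (A.contrCurvature π q τ w))
    {s : N → Q} (hs : ContMDiff (𝓡 n) 𝓘(ℝ, EQ) ∞ s) :
    IsCritical v (fun x q j => liftLagrangian π l x q j + L x q j) F s ↔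
      UnreducedEquations v A (liftLagrangian π l) L F s := by
  have hlift : SmoothLagrangian (liftLagrangian (EQ := EQ) π l) := hl.lift hπ.smooth_proj
  -- For the horizontal part of `u`, `EL(L^v)` cancels the force; for the vertical part, Noether's
  -- theorem replaces `EL(L^v)` by the momentum.
  have hsplit : ∀ (x : N) (u : EQ),
      elVal v (fun x q j => liftLagrangian π l x q j + L x q j) s x u +
        forceVal F x (s x) (tmap (E := 𝔼) (E' := EQ) s x) u =
      elVal v (liftLagrangian π l) s x u +
        (forceVal F x (s x) (tmap (E := 𝔼) (E' := EQ) s x)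
          (genVal EQ EG G (s x) (A.val (s x) u)) -
        divVal v (fun x' => fiberVal L x' (s x') (tmap (E := 𝔼) (E' := EQ) s x')
          (genVal EQ EG G (s x') (A.val (s x) u))) x) := by
    intro x u
    have h1 := elVal_horizontal v hπ A hL hver hinv hF hs x
      (u := u - genVal EQ EG G (s x) (A.val (s x) u)) (by rw [map_sub, A.val_gen, sub_self])
    have h2 := elVal_gen v hπ hL hinv hs x (A.val (s x) u)
    have h3 := elVal_add v hL hs x (u - genVal EQ EG G (s x) (A.val (s x) u))
      (genVal EQ EG G (s x) (A.val (s x) u))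
    rw [sub_add_cancel] at h3
    rw [map_sub] at h1
    rw [elVal_add_lagrangian v hlift hL hs]
    linarith
  have heq : UnreducedEquations v A (liftLagrangian π l) L F s ↔
      (∀ (x : N) (u : EQ), elVal v (liftLagrangian π l) s x u = 0) ∧
      (∀ (x : N) (u : EQ), divVal v (fun x' => fiberVal L x' (s x')
          (tmap (E := 𝔼) (E' := EQ) s x') (genVal EQ EG G (s x') (A.val (s x) u))) x =
        forceVal F x (s x) (tmap (E := 𝔼) (E' := EQ) s x)
          (genVal EQ EG G (s x) (A.val (s x) u))) := Iff.rfl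
  rw [isCritical_iff v (hlift.add hL) hFs hs, heq]
  simp only [hsplit]
  -- `L^h` is itself invariant, so Noether's theorem applies to it, and its momentum is zero because
  -- `Tπ` kills generators.
  have hvert : ∀ (x : N) (ξ : EG), elVal v (liftLagrangian π l) s x (genVal EQ EG G (s x) ξ) = 0 := by
    intro x ξ
    rw [elVal_gen v hπ hlift (gInvariant_lift hπ l) hs, neg_eq_zero]
    refine divVal_eq_zero v (Filter.Eventually.of_forall fun x' => ?_)
    rw [fiberVal_lift, hπ.tmap_proj_gen, fiberVal_zero]
  constructor
  · intro h
    have hv : ∀ (x : N) (u : EQ), divVal v (fun x' => fiberVal L x' (s x')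
          (tmap (E := 𝔼) (E' := EQ) s x') (genVal EQ EG G (s x') (A.val (s x) u))) x =
        forceVal F x (s x) (tmap (E := 𝔼) (E' := EQ) s x)
          (genVal EQ EG G (s x) (A.val (s x) u)) := by
      intro x u
      -- Testing on the vertical part of `u` separates the two equations: `hvert` removes `L^h`, and
      -- the connection form of that vertical part is again `A(u)`.
      have h1 := h x (genVal EQ EG G (s x) (A.val (s x) u))
      rw [hvert, A.val_gen] at h1
      linarith
    refine ⟨fun x u => ?_, hv⟩
    have h1 := h x u
    rw [hv] at h1
    linarith
  · rintro ⟨h1, h2⟩ x u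
    rw [h1, h2]
    ring

/-- Solutions of the un-reduced equations project to solutions of the Euler–Lagrange equations. -/
theorem UnreducedEquations.elVal_proj [T2Space N] [FiniteDimensional ℝ EQ]
    (v : VolumeForm n N) (hπ : IsPrincipalBundle EQ ES EG G π)
    (A : PrincipalConnection EQ Q EG G) {l : Lagrangian n N ES S} (hl : SmoothLagrangian l)
    {L : Lagrangian n N EQ Q} {F : Force n N EQ Q}
    {s : N → Q} (hs : ContMDiff (𝓡 n) 𝓘(ℝ, EQ) ∞ s)
    (h : UnreducedEquations v A (liftLagrangian π l) L F s) (x : N) (w : ES) :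
    elVal v l (fun x => π (s x)) x w = 0 := by
  -- Testing on horizontal lifts reaches every `w`, since the lift splits `Tπ`.
  have h1 : elVal v (liftLagrangian π l) s x (A.lift ES π (s x) w) = 0 := h.1 x _
  rw [elVal_lift v hπ.smooth_proj hl hs, (hπ.lift_spec A (s x) w).2] at h1
  exact h1

theorem isCritical_zero_force [T2Space N] [SecondCountableTopology N]
    [MeasurableSpace N] [BorelSpace N] [FiniteDimensional ℝ ES]
    (v : VolumeForm n N) {l : Lagrangian n N ES S} (hl : SmoothLagrangian l) {s : N → S}
    (hs : ContMDiff (𝓡 n) 𝓘(ℝ, ES) ∞ s) (h : ∀ x w, elVal v l s x w = 0) :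
    IsCritical v l (fun _ _ _ => 0) s := by
  rw [isCritical_iff v hl smoothForce_zero hs]
  intro x u
  rw [h, zero_add]
  rfl

end Unreduce

end Unreduction

end

/-! ### The un-reduction theorem. -/

theorem theorem3p1
    {n : ℕ} {N : Type*} [TopologicalSpace N] [ChartedSpace (EuclideanSpace ℝ (Fin n)) N]
    [IsManifold (𝓡 n) ∞ N] [T2Space N] [SecondCountableTopology N]
    [MeasurableSpace N] [BorelSpace N]
    {EQ : Type*} [NormedAddCommGroup EQ] [NormedSpace ℝ EQ] [FiniteDimensional ℝ EQ]
    {Q : Type*} [TopologicalSpace Q] [ChartedSpace EQ Q] [IsManifold 𝓘(ℝ, EQ) ∞ Q]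
    [T2Space Q] [SecondCountableTopology Q]
    {ES : Type*} [NormedAddCommGroup ES] [NormedSpace ℝ ES] [FiniteDimensional ℝ ES]
    {S : Type*} [TopologicalSpace S] [ChartedSpace ES S] [IsManifold 𝓘(ℝ, ES) ∞ S]
    [T2Space S] [SecondCountableTopology S]
    {EG : Type*} [NormedAddCommGroup EG] [NormedSpace ℝ EG] [FiniteDimensional ℝ EG]
    {G : Type*} [TopologicalSpace G] [ChartedSpace EG G] [Group G] [LieGroup 𝓘(ℝ, EG) ∞ G]
    [MulAction Gᵐᵒᵖ Q]
    (v : Unreduction.VolumeForm n N)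
    (π : Q → S) (hπ : Unreduction.IsPrincipalBundle EQ ES EG G π)
    (A : Unreduction.PrincipalConnection EQ Q EG G)
    (l : Unreduction.Lagrangian n N ES S) (hl : Unreduction.SmoothLagrangian l)
    (Lv : Unreduction.Lagrangian n N EQ Q) (hLv : Unreduction.SmoothLagrangian Lv)
    (hLv_ver : ∀ x q j, Lv x q ((A.verProj q) ∘L j) = Lv x q j)
    (hLv_inv : Unreduction.GInvariant G Lv)
    (F : Unreduction.Force n N EQ Q) (hF : Unreduction.SmoothForce F)
    (hF_equiv : Unreduction.GEquivariant G F)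
    (hFh : ∀ (x : N) (q : Q)
      (τ : TangentSpace (𝓡 n) x →L[ℝ] TangentSpace 𝓘(ℝ, ES) (π q))
      (ξ : TangentSpace (𝓡 n) x →L[ℝ] Unreduction.LieAlg EG G)
      (w : TangentSpace 𝓘(ℝ, ES) (π q)),
      A.redForce π F x q τ ξ w =
        - A.nablaBase π (Unreduction.redLagrangian hπ Lv hLv_inv x) q ξ w +
          Unreduction.adjointDeriv (Unreduction.redLagrangian hπ Lv hLv_inv x) q ξ
            (A.contrCurvature π q τ w)) :
    -- `L = L^h + L^v` is `G`-invariant and `L^h ∘ p^h = L^h`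
    (Unreduction.GInvariant G
        (fun x q j => Unreduction.liftLagrangian (EQ := EQ) π l x q j + Lv x q j) ∧
      ∀ x q j, Unreduction.liftLagrangian (EQ := EQ) π l x q ((A.horProj q) ∘L j) =
        Unreduction.liftLagrangian π l x q j) ∧
    -- the variational equations of `(L, F)` are the un-reduced equations
    (∀ s : N → Q, ContMDiff (𝓡 n) 𝓘(ℝ, EQ) ∞ s →
      (Unreduction.IsCritical v
          (fun x q j => Unreduction.liftLagrangian π l x q j + Lv x q j) F s ↔
        Unreduction.UnreducedEquations v A (Unreduction.liftLagrangian π l) Lv F s)) ∧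
    -- solutions project to solutions of the Euler–Lagrange equations of `l`
    (∀ s : N → Q, ContMDiff (𝓡 n) 𝓘(ℝ, EQ) ∞ s →
      Unreduction.UnreducedEquations v A (Unreduction.liftLagrangian π l) Lv F s →
      (∀ (x : N) (u : TangentSpace 𝓘(ℝ, ES) ((π ∘ s) x)),
          Unreduction.eulerLagrange v l (π ∘ s) x u = 0) ∧
        Unreduction.IsCritical v l (fun _ _ _ => 0) (π ∘ s)) := by
  have hπs : ContMDiff 𝓘(ℝ, EQ) 𝓘(ℝ, ES) ∞ π := hπ.smooth_proj
  refine ⟨⟨fun g x q j => ?_, fun x q j => Unreduction.liftLagrangian_horProj hπ A l x q j⟩,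
    fun s hs => Unreduction.isCritical_iff_unreducedEquations v hπ A hl hLv hLv_ver hLv_inv hF hFh
      hs, fun s hs h => ?_⟩
  · exact congrArg₂ (· + ·) (Unreduction.gInvariant_lift hπ l g x q j) (hLv_inv g x q j)
  · have hel := h.elVal_proj v hπ A hl hs
    exact ⟨hel, Unreduction.isCritical_zero_force v hl (hπs.comp hs) hel⟩
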